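/- Let $N$ be a nonnegative integer, let $q,c_0,\dots,c_4$ be nonzero complex numbers, and fix square roots $q^{1/2},c_0^{1/2},\dots,c_4^{1/2}$ with $$q^{(2N+3)/2}\,c_0^{1/2}c_1^{1/2}c_2^{1/2}c_3^{1/2}c_4^{1/2}=1$$ (so that $q^{2N+3}c_0c_1c_2c_3c_4=1$); all half-integer powers below are formed with these roots. Assume $$q,q^2,\dots,q^N\neq 1,\qquad c_0,c_1,c_2,c_3,c_4\notin\{q^{-1},\dots,q^{-N}\},$$ $$c_1c_2,\;c_2c_3,\;c_0c_3,\;c_0c_4,\;c_2c_4,\;qc_1c_2c_3,\;qc_0c_3c_4,\;qc_1c_2c_4\notin\{q^{-2},q^{-3},\dots,q^{-2N}\}.$$ Put $(a;q)_k=\prod_{l=0}^{k-1}(1-aq^l)$, $\left[{N\atop n}\right]_q=\frac{(q;q)_N}{(q;q)_n(q;q)_{N-n}}$ for $0\le n\le N$, and $$\lambda(x;c)=-(1-q^{-x})(1-cq^{x+1}),\qquad \xi_n(c,c')=\frac{(qc;q)_n}{(qc';q)_n}\Big(\frac{c'}{c}\Big)^{n/2},\qquad \omega_n(c)=(-1)^nc^{n/2}q^{n(n+1)/2}.$$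 For arbitrary parameters $\alpha,\beta,\gamma$ and $0\le n,x\le M$ let $$\Omega(n;\alpha,\beta,\gamma;M)=\left[{M\atop n}\right]_q\frac{(1-\beta\gamma q^{2n+1})\,(q\beta;q)_n\,(\alpha\beta\gamma q^{M+2};q)_n\,(q\alpha;q)_{M-n}}{(q\beta)^{n-M/2}\,(\beta\gamma q^{n+1};q)_{M+1}\,(q\gamma;q)_n},$$ where the factor $1-\beta\gamma q^{2n+1}$ is understood to be cancelled against the same factor of $(\beta\gamma q^{n+1};q)_{M+1}$, and $$p_n(x;\alpha,\beta,\gamma;M)=\Omega(n;\alpha,\beta,\gamma;M)\sum_{k=0}^{n}\frac{(q^{-n};q)_k\,(\beta\gamma q^{n+1};q)_k\,(q^{-x};q)_k\,(\alpha\beta q^{x+1};q)_k}{(q\beta;q)_k\,(\alpha\beta\gamma q^{M+2};q)_k\,(q^{-M};q)_k\,(q;q)_k}\,q^k,$$ with $p_n(x;\alpha,\beta,\gamma;M)=0$ if $n>M$ or $x>M$. For nonnegative integers with $i+j\le N$ and $x+y\le N$, the Griffiths polynomials of $q$-Racah type are $$G_{i,j}(x,y)=\sum_{a=0}^{\min(N-j,N-y)}\omega_a\Big(\frac{c_1c_2c_3}{c_4}\Big)\,p_i(a;c_1,c_2,c_3;N-j)\,p_j(y;c_3,c_0,c_4;N-a)\,p_a(x;c_4,c_2,c_1;N-y).$$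 Then: 1. For all nonnegative integers $x,y$ with $x+y\le N$, the values $G_{0,N}(x,y)$ and $G_{N,0}(x,y)$ are nonzero and $$G_{0,N}(x,y)=(-1)^N\Big(\frac{c_3}{c_1}\Big)^{N/2}\Big(\frac{c_1}{c_4}\Big)^{y/2}\,\xi_N(c_0,c_0c_4q^N)\,\xi_y(c_3,c_0),$$ $$G_{N,0}(x,y)=(c_0c_3q^{N+1})^{-N/2}\,\frac{\omega_y\big(\tfrac{c_1c_0c_3}{c_4}\big)}{\omega_x(c_2c_4)}\,\xi_N(c_2,c_2c_3q^N)\,\xi_x(c_4,c_2).$$ 2. For all nonnegative integers $i,j$ with $i+j\le N$, the ratio $G_{i,j}(x,y)/G_{0,N}(x,y)$ is a bivariate polynomial of total degree $N-j$ in $\lambda(x;c_4c_2)$ and $\lambda(y;c_0c_3)$; that is, there is a polynomial $P\in\mathbb C[X,Y]$ of total degree exactly $N-j$ such that $G_{i,j}(x,y)/G_{0,N}(x,y)=P(\lambda(x;c_4c_2),\lambda(y;c_0c_3))$ for all nonnegative integers $x,y$ with $x+y\le N$. 3. Likewise, for all such $i,j$, the ratio $G_{i,j}(x,y)/G_{N,0}(x,y)$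 is a bivariate polynomial of total degree exactly $N-i$ in $\lambda(x;c_4c_2)$ and $\lambda(y;c_0c_3)$, in the same sense. -/

import Mathlib

/-!
Griffiths polynomials of `q`-Racah type.

Half-integer powers of `q` and of the parameters `c₀, …, c₄` occur in the normalisations.
They are handled by working with chosen square roots: `h` denotes `q^{1/2}` and
`t i` denotes `c_i^{1/2}`, so `q = h ^ 2`, `c_i = (t i) ^ 2`, and every monomial
with half-integer exponents is the corresponding monomial in `h` and the `t i`.
Definitions in which half-integer powers occur take `h` and the square roots of the parameters
as arguments; the others take `q` and the parameters themselves.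
-/

namespace QRacah

noncomputable section

/-- The `q`-Pochhammer symbol `(a;q)_k = ∏_{l<k} (1 - a q^l)`. -/
def qPoch (a q : ℂ) (k : ℕ) : ℂ :=
  ∏ l ∈ Finset.range k, (1 - a * q ^ l)

/-- The `q`-binomial coefficient, equal to `0` for `n > N`. -/
def qBinom (q : ℂ) (N n : ℕ) : ℂ :=
  if n ≤ N then qPoch q q N / (qPoch q q n * qPoch q q (N - n)) else 0

/-- The terminating series `₄φ₃(q^{-n}, a₂, a₃, a₄; b₁, b₂, b₃; q; z)`, which is
the sum over `0 ≤ k ≤ n`. -/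
def phi43 (q : ℂ) (n : ℕ) (a₂ a₃ a₄ b₁ b₂ b₃ z : ℂ) : ℂ :=
  ∑ k ∈ Finset.range (n + 1),
    qPoch (q ^ (-(n : ℤ))) q k * qPoch a₂ q k * qPoch a₃ q k * qPoch a₄ q k /
      (qPoch b₁ q k * qPoch b₂ q k * qPoch b₃ q k) * (z ^ k / qPoch q q k)

/-- `qPochSkip a q m n` is `(a;q)_m / (1 - a q^n)` for `n < m`: the factor of index `n` of
`(a;q)_m` is left out. -/
def qPochSkip (a q : ℂ) (m n : ℕ) : ℂ :=
  ∏ l ∈ (Finset.range m).erase n, (1 - a * q ^ l)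

theorem qPochSkip_inv (a q : ℂ) {m n : ℕ} (hn : n < m) (h : 1 - a * q ^ n ≠ 0) :
    (1 - a * q ^ n) / qPoch a q m = 1 / qPochSkip a q m n := by
  have key : qPoch a q m = (1 - a * q ^ n) * qPochSkip a q m n :=
    (Finset.mul_prod_erase (Finset.range m) (fun l => 1 - a * q ^ l)
      (Finset.mem_range.2 hn)).symm
  rw [key, div_mul_eq_div_div, div_self h]

/-- The normalisation `Ω(n; c₁, c₂, c₃; N)`, where `q = h²`, `c_i = t_i²`:
`[N, n]_q (1 - c₂c₃q^{2n+1}) (qc₂;q)_n (c₁c₂c₃q^{N+2};q)_n (qc₁;q)_{N-n}` divided by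
`(qc₂)^{n-N/2} (c₂c₃q^{n+1};q)_{N+1} (qc₃;q)_n`.
The factor `1 - c₂c₃q^{2n+1}`, which is the factor of index `n` of `(c₂c₃q^{n+1};q)_{N+1}`, is
cancelled, so that the apparent poles at its zeros are removed. -/
def Omega (h t₁ t₂ t₃ : ℂ) (N n : ℕ) : ℂ :=
  qBinom (h ^ 2) N n *
    (qPoch (h ^ 2 * t₂ ^ 2) (h ^ 2) n *
      qPoch (t₁ ^ 2 * t₂ ^ 2 * t₃ ^ 2 * (h ^ 2) ^ (N + 2)) (h ^ 2) n *
      qPoch (h ^ 2 * t₁ ^ 2) (h ^ 2) (N - n)) /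
    ((h * t₂) ^ (2 * (n : ℤ) - (N : ℤ)) *
      qPochSkip (t₂ ^ 2 * t₃ ^ 2 * (h ^ 2) ^ (n + 1)) (h ^ 2) (N + 1) n *
      qPoch (h ^ 2 * t₃ ^ 2) (h ^ 2) n)

/-- The normalised univariate `q`-Racah polynomial `p_n(x; c₁, c₂, c₃; N)`, `q = h²`,
`c_i = t_i²`, with the convention that it vanishes for `n > N` or `x > N`. -/
def racah (h t₁ t₂ t₃ : ℂ) (N n x : ℕ) : ℂ :=
  if n ≤ N ∧ x ≤ N then
    Omega h t₁ t₂ t₃ N n *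
      phi43 (h ^ 2) n
        (t₂ ^ 2 * t₃ ^ 2 * (h ^ 2) ^ (n + 1))
        ((h ^ 2) ^ (-(x : ℤ)))
        (t₁ ^ 2 * t₂ ^ 2 * (h ^ 2) ^ (x + 1))
        (h ^ 2 * t₂ ^ 2)
        (t₁ ^ 2 * t₂ ^ 2 * t₃ ^ 2 * (h ^ 2) ^ (N + 2))
        ((h ^ 2) ^ (-(N : ℤ)))
        (h ^ 2)
  else 0

/-- `λ(x; c) = -(1 - q^{-x})(1 - c q^{x+1})`. -/
def lam (q c : ℂ) (x : ℕ) : ℂ :=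
  -(1 - q ^ (-(x : ℤ))) * (1 - c * q ^ (x + 1))

/-- `ξ_n(c₁, c₂) = (qc₁;q)_n / (qc₂;q)_n (c₂/c₁)^{n/2}`, where `q = h²`, `c_i = t_i²`. -/
def xi (h t₁ t₂ : ℂ) (n : ℕ) : ℂ :=
  qPoch (h ^ 2 * t₁ ^ 2) (h ^ 2) n / qPoch (h ^ 2 * t₂ ^ 2) (h ^ 2) n * (t₂ / t₁) ^ n

/-- `ω_n(c) = (-1)^n c^{n/2} q^{n(n+1)/2}`, where `q = h²`, `c = t²`. -/
def omega (h t : ℂ) (n : ℕ) : ℂ :=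
  (-1) ^ n * t ^ n * (h ^ 2) ^ ((n + 1).choose 2)

/-- The Griffiths polynomials of `q`-Racah type
`G_{i,j}(x, y; c₁, c₂, c₃, c₄; N)`, where `q = h²`, `c_i = (t i)²`. The parameter `c₀` is
determined by the others through `h^{2N+3} t₀ t₁ t₂ t₃ t₄ = 1`. -/
def griffiths (h : ℂ) (t : Fin 5 → ℂ) (N i j x y : ℕ) : ℂ :=
  ∑ a ∈ Finset.range (min (N - j) (N - y) + 1),
    omega h (t 1 * t 2 * t 3 / t 4) a *
      racah h (t 1) (t 2) (t 3) (N - j) i a *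
      racah h (t 3) (t 0) (t 4) (N - a) j y *
      racah h (t 4) (t 2) (t 1) (N - y) a x

/-- `a ∉ {q^{-m}, q^{-m-1}, …, q^{-n}}`. -/
def AvoidsInvPowers (q a : ℂ) (m n : ℕ) : Prop :=
  ∀ k : ℕ, m ≤ k → k ≤ n → a ≠ q ^ (-(k : ℤ))

/-- The standing constraints on the parameters, where `q = h²`, `c_i = (t i)²`. -/
structure Admissible (h : ℂ) (t : Fin 5 → ℂ) (N : ℕ) : Prop where
  h_ne : h ≠ 0
  t_ne : ∀ i, t i ≠ 0
  /-- `q^{2N+3} c₀ c₁ c₂ c₃ c₄ = 1`, for the chosen square roots. -/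
  balance : h ^ (2 * N + 3) * (t 0 * t 1 * t 2 * t 3 * t 4) = 1
  q_pow_ne : ∀ k : ℕ, 1 ≤ k → k ≤ N → (h ^ 2) ^ k ≠ 1
  c12 : AvoidsInvPowers (h ^ 2) (t 1 ^ 2 * t 2 ^ 2) 2 (2 * N)
  c23 : AvoidsInvPowers (h ^ 2) (t 2 ^ 2 * t 3 ^ 2) 2 (2 * N)
  c03 : AvoidsInvPowers (h ^ 2) (t 0 ^ 2 * t 3 ^ 2) 2 (2 * N)
  c04 : AvoidsInvPowers (h ^ 2) (t 0 ^ 2 * t 4 ^ 2) 2 (2 * N)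
  c24 : AvoidsInvPowers (h ^ 2) (t 2 ^ 2 * t 4 ^ 2) 2 (2 * N)
  c123 : AvoidsInvPowers (h ^ 2) (h ^ 2 * (t 1 ^ 2 * t 2 ^ 2 * t 3 ^ 2)) 2 (2 * N)
  c034 : AvoidsInvPowers (h ^ 2) (h ^ 2 * (t 0 ^ 2 * t 3 ^ 2 * t 4 ^ 2)) 2 (2 * N)
  c124 : AvoidsInvPowers (h ^ 2) (h ^ 2 * (t 1 ^ 2 * t 2 ^ 2 * t 4 ^ 2)) 2 (2 * N)
  c_single : ∀ i, AvoidsInvPowers (h ^ 2) (t i ^ 2) 1 N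

end

end QRacah

namespace QRacah

noncomputable section

/-! ### `q`-Pochhammer symbols -/

/-! The sum over `a` is rearranged so that two neighbouring `q`-Racah factors combine into a genuine
polynomial.

Sears' transformation, terminated by the variable instead of the degree, turns p_n(x;M) into an
explicit product times a polynomial of degree M-n in λ(x) (`sears`, `bareRacah_eq_dual`). In the
linked product p_j(y;N-a) p_a(x;N-y) this explicit product merges with Ω(a;N-y). The balancing
condition then splits the result into a function of y, a function of a, and exactly the Pochhammer
symbols that clear the denominators of p_a depending on N-y. These symbols are polynomials in λ(y)
(`pair_factor`), so what remains has total degree (N-a-j)+a = N-j in λ(x), λ(y) (`racah_mul_racah`,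
`hasRep_pairPoly`).

For the ratio with G_{0,N}, the last two factors are combined. The function of y that comes out does
not depend on i, j, and in G_{0,N} only a=0 survives, so it cancels in the ratio. The monomial
λ(x)^{N-j} comes only from a=N-j, with a coefficient containing p_i(N-j;N-j), which is nonzero
(`racah_last_ne`).

For the ratio with G_{N,0}, the first two factors are combined; this is the same identity with
relabelled parameters. It gives a polynomial of total degree N-i in λ(a;c₁c₂) and λ(y), and the
other a-dependent factors form a very-well-poised weight times a ₄φ₃ in x. It remains to sum weight
· λ(a)^s · ₄φ₃ over a. Exchanging summations produces moments of the weight. For s=0 they follow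
from a telescoping sum; for larger s they are the s=0 moments times a polynomial of degree s in
q^{-m} and λ(y) (`wpMoment_hasRep`). The outer sum over m with an extra q^{-mr} is a
`q`-Chu–Vandermonde sum times a polynomial of degree r in λ(x) (`cvMoment_hasRep`). The case s=0 is
G_{N,0} itself.

To get the exact degree, `HasRep` records a bound d for the total degree and the single coefficient
of u^d. This coefficient is additive and multiplicative, and its being nonzero forces total degree
d. -/

@[simp] theorem qPoch_zero (a q : ℂ) : qPoch a q 0 = 1 := by simp [qPoch]

theorem qPoch_succ (a q : ℂ) (k : ℕ) : qPoch a q (k + 1) = qPoch a q k * (1 - a * q ^ k) := by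
  simp [qPoch, Finset.prod_range_succ]

theorem qPoch_succ' (a q : ℂ) (k : ℕ) : qPoch a q (k + 1) = (1 - a) * qPoch (a * q) q k := by
  simp only [qPoch, Finset.prod_range_succ', pow_zero, mul_one]
  rw [mul_comm]
  congr 1
  exact Finset.prod_congr rfl fun l _ => by ring

theorem qPoch_add (a q : ℂ) (m n : ℕ) :
    qPoch a q (m + n) = qPoch a q m * qPoch (a * q ^ m) q n := by
  simp only [qPoch, Finset.prod_range_add]
  congr 1
  exact Finset.prod_congr rfl fun l _ => by ring

theorem qPoch_ne_zero {a q : ℂ} {k : ℕ} (h : ∀ l < k, 1 - a * q ^ l ≠ 0) : qPoch a q k ≠ 0 :=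
  Finset.prod_ne_zero_iff.2 fun l hl => h l (Finset.mem_range.1 hl)

theorem factor_ne_zero_of_qPoch {a q : ℂ} {k : ℕ} (h : qPoch a q k ≠ 0) {l : ℕ} (hl : l < k) :
    1 - a * q ^ l ≠ 0 :=
  Finset.prod_ne_zero_iff.1 h l (Finset.mem_range.2 hl)

theorem qPoch_ne_zero_of_le {a q : ℂ} {k m : ℕ} (h : qPoch a q k ≠ 0) (hm : m ≤ k) :
    qPoch a q m ≠ 0 :=
  qPoch_ne_zero fun _ hl => factor_ne_zero_of_qPoch h (hl.trans_le hm)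

theorem qPoch_neg_pow_eq_zero {q : ℂ} (hq : q ≠ 0) {n k : ℕ} (h : n < k) :
    qPoch (q ^ (-(n : ℤ))) q k = 0 :=
  Finset.prod_eq_zero (Finset.mem_range.2 h) (by
    rw [zpow_neg, zpow_natCast, inv_mul_cancel₀ (pow_ne_zero _ hq), sub_self])

/-- The hypothesis says (z q^l)(x q^{m-1-l}) = 1, so each factor of one symbol is a monomial times a
factor of the other, taken in reverse order. Every use of a balancing condition below goes through
this. -/
theorem qPoch_reverse {x z q : ℂ} {m : ℕ} (h : x * z * q ^ m = q) (hq : q ≠ 0) :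
    qPoch z q m * ((-x) ^ m * q ^ m.choose 2) = qPoch x q m := by
  have h1 : (-x) ^ m * q ^ m.choose 2 = ∏ l ∈ Finset.range m, (-x * q ^ (m - 1 - l)) := by
    rw [Finset.prod_mul_distrib, Finset.prod_const, Finset.card_range,
      Finset.prod_range_reflect (fun l => q ^ l) m, Finset.prod_pow_eq_pow_sum,
      Finset.sum_range_id, Nat.choose_two_right]
  rw [h1, qPoch, qPoch, ← Finset.prod_mul_distrib,
    ← Finset.prod_range_reflect (fun l => 1 - x * q ^ l) m]
  refine Finset.prod_congr rfl fun l hl => ?_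
  have hl : l < m := Finset.mem_range.1 hl
  obtain ⟨r, rfl⟩ : ∃ r, m = l + r + 1 := ⟨m - l - 1, by omega⟩
  have e : l + r + 1 - 1 - l = r := by omega
  rw [e]
  have h2 : x * z * q ^ (l + r) = 1 := by
    apply mul_right_cancel₀ hq
    rw [one_mul]; exact Eq.trans (by ring) h
  have h3 : z * q ^ l * (x * q ^ r) = 1 := by rw [← h2]; ring
  linear_combination h3

theorem choose_two_add (m n : ℕ) :
    (m + n).choose 2 = m.choose 2 + n.choose 2 + m * n := by
  induction n with
  | zero => simp
  | succ n ih =>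
    rw [← add_assoc, Nat.choose_succ_succ' (m + n), Nat.choose_succ_succ' n, ih]
    simp only [Nat.reduceAdd, Nat.choose_one_right]
    ring

/-- Reversal with x = q^{m+1}; it translates between (q^{-n};q)_k and `q`-binomial coefficients
without division. -/
theorem qPoch_neg_pow {q : ℂ} (hq : q ≠ 0) (m k : ℕ) :
    qPoch (q ^ (-((m + k : ℕ) : ℤ))) q k * qPoch q q m * ((-1) ^ k * q ^ (m * k + k + k.choose 2))
      = qPoch q q (m + k) := by
  have hz : q ^ (-((m + k : ℕ) : ℤ)) * q ^ (m + k) = 1 := by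
    rw [zpow_neg, zpow_natCast, inv_mul_cancel₀ (pow_ne_zero _ hq)]
  have h := qPoch_reverse (x := q * q ^ m) (z := q ^ (-((m + k : ℕ) : ℤ))) (m := k) (q := q)
    (by
      calc q * q ^ m * q ^ (-((m + k : ℕ) : ℤ)) * q ^ k
          = (q ^ (-((m + k : ℕ) : ℤ)) * q ^ (m + k)) * q := by ring
        _ = q := by rw [hz, one_mul]) hq
  rw [qPoch_add, ← h]
  rw [neg_pow]
  ring

/-! ### The `q`-Saalschütz and `q`-Chu–Vandermonde sums -/

/-- The summand of the homogeneous form of the `q`-Saalschütz sum. -/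
def saalTerm (q a e g : ℂ) (n k : ℕ) : ℂ :=
  qBinom q n k * qPoch a q k * (∏ l ∈ Finset.range k, (e - g * q ^ l)) *
    qPoch (a * g * q ^ k) q (n - k) * qPoch e q (n - k)

theorem saalTerm_of_lt (q a e g : ℂ) {n k : ℕ} (h : n < k) : saalTerm q a e g n k = 0 := by
  simp [saalTerm, qBinom, h.not_ge]

theorem saalTerm_succ_zero {q : ℂ} (a e g : ℂ) {n : ℕ} (hq : qPoch q q (n + 1) ≠ 0) :
    saalTerm q a e g (n + 1) 0 =
      (1 - a * e * q ^ n) * (1 - g * q ^ n) * saalTerm q a e g n 0 -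
        q ^ n * ((1 - a) * (e - g)) * saalTerm q a e g n 0 := by
  have h1 := qPoch_ne_zero_of_le hq (Nat.le_succ n)
  simp only [saalTerm, qBinom, qPoch_zero, Nat.zero_le, if_true, Nat.sub_zero, one_mul,
    div_self hq, div_self h1, Finset.range_zero, Finset.prod_empty, mul_one, pow_zero]
  rw [qPoch_succ, qPoch_succ]
  ring

/-- A creative-telescoping certificate. With R(k) = q^{n-k}(1-aq^k)(e-gq^k)·T(n,k), T being
`saalTerm`, the (n+1)-summand is (1-aeq^n)(1-gq^n) times the n-summand plus R(k) - R(k+1). -/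
theorem saalTerm_succ_succ {q : ℂ} (a e g : ℂ) {n k : ℕ} (hq : qPoch q q (n + 1) ≠ 0)
    (hk : k ≤ n) :
    saalTerm q a e g (n + 1) (k + 1) =
      (1 - a * e * q ^ n) * (1 - g * q ^ n) * saalTerm q a e g n (k + 1) -
        q ^ (n - (k + 1)) * ((1 - a * q ^ (k + 1)) * (e - g * q ^ (k + 1))) *
          saalTerm q a e g n (k + 1) +
        q ^ (n - k) * ((1 - a * q ^ k) * (e - g * q ^ k)) * saalTerm q a e g n k := by
  obtain ⟨r, rfl⟩ := Nat.exists_eq_add_of_le hk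
  rcases r with _ | r
  -- Case k = n: the truncated exponent n-(k+1) only multiplies a vanishing term.
  · have h0 : saalTerm q a e g (k + 0) (k + 1) = 0 := saalTerm_of_lt _ _ _ _ (by omega)
    rw [h0]
    have h1 : qPoch q q k ≠ 0 := qPoch_ne_zero_of_le hq (by omega)
    simp only [add_zero] at hq ⊢
    simp only [saalTerm, qBinom, le_refl, if_true, Nat.sub_self, qPoch_zero, mul_one,
      div_self hq, div_self h1, Finset.prod_range_succ]
    rw [qPoch_succ]; ring
  · have e1 : k + (r + 1) + 1 - (k + 1) = r + 1 := by omega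
    have e2 : k + (r + 1) - (k + 1) = r := by omega
    have e3 : k + (r + 1) - k = r + 1 := by omega
    have hn : qPoch q q (k + (r + 1) + 1) =
        qPoch q q (k + (r + 1)) * (1 - q * q ^ (k + (r + 1))) := qPoch_succ _ _ _
    have hk1 : qPoch q q (k + 1) = qPoch q q k * (1 - q * q ^ k) := qPoch_succ _ _ _
    have hr1 : qPoch q q (r + 1) = qPoch q q r * (1 - q * q ^ r) := qPoch_succ _ _ _
    have n1 : qPoch q q k ≠ 0 := qPoch_ne_zero_of_le hq (by omega)
    have n2 : qPoch q q r ≠ 0 := qPoch_ne_zero_of_le hq (by omega)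
    have n3 : 1 - q * q ^ k ≠ 0 := factor_ne_zero_of_qPoch hq (by omega)
    have n4 : 1 - q * q ^ r ≠ 0 := factor_ne_zero_of_qPoch hq (by omega)
    simp only [saalTerm, qBinom, e1, e2, e3, hn, hk1, hr1, Finset.prod_range_succ,
      if_pos (show k + 1 ≤ k + (r + 1) + 1 by omega), if_pos (show k + 1 ≤ k + (r + 1) by omega),
      if_pos (show k ≤ k + (r + 1) by omega)]
    have p1 : qPoch (a * g * q ^ (k + 1)) q (r + 1) =
        qPoch (a * g * q ^ (k + 1)) q r * (1 - a * g * q ^ (k + 1) * q ^ r) := qPoch_succ _ _ _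
    have p2 : qPoch (a * g * q ^ k) q (r + 1) =
        (1 - a * g * q ^ k) * qPoch (a * g * q ^ (k + 1)) q r := by
      rw [qPoch_succ']; congr 2; ring
    have p3 : qPoch e q (r + 1) = qPoch e q r * (1 - e * q ^ r) := qPoch_succ _ _ _
    have p4 : qPoch a q (k + 1) = qPoch a q k * (1 - a * q ^ k) := qPoch_succ _ _ _
    rw [p1, p2, p3, p4]
    field_simp
    ring

/-- Summing the certificate over k shows that both sides acquire the factor (1-aeq^n)(1-gq^n) when n
increases. In this homogeneous form the parameters are free: no balancing condition, no denominators
in a, e, g, and e = 0 is allowed, which is the `q`-Chu–Vandermonde case. -/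
theorem saalschuetz {q : ℂ} (a e g : ℂ) (n : ℕ) (hq : qPoch q q n ≠ 0) :
    ∑ k ∈ Finset.range (n + 1), saalTerm q a e g n k = qPoch g q n * qPoch (a * e) q n := by
  induction n with
  | zero => simp [saalTerm, qBinom]
  | succ n ih =>
    have hn := ih (qPoch_ne_zero_of_le hq (Nat.le_succ n))
    have htop : ∑ k ∈ Finset.range (n + 2), saalTerm q a e g n k =
        qPoch g q n * qPoch (a * e) q n := by
      rw [Finset.sum_range_succ, hn, saalTerm_of_lt _ _ _ _ (Nat.lt_succ_self n), add_zero]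
    -- Partial sums, with the boundary term of the telescoping made explicit; it vanishes at m =
    -- n+1.
    have key : ∀ m ≤ n + 1, ∑ k ∈ Finset.range (m + 1), saalTerm q a e g (n + 1) k =
        (1 - a * e * q ^ n) * (1 - g * q ^ n) * ∑ k ∈ Finset.range (m + 1), saalTerm q a e g n k -
        q ^ (n - m) * ((1 - a * q ^ m) * (e - g * q ^ m)) * saalTerm q a e g n m := by
      intro m
      induction m with
      | zero =>
        intro _
        rw [zero_add, Finset.sum_range_one, Finset.sum_range_one, saalTerm_succ_zero a e g hq]
        simp
      | succ m ihm =>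
        intro hm
        rw [Finset.sum_range_succ, ihm (by omega), saalTerm_succ_succ a e g hq (by omega),
          Finset.sum_range_succ _ (m + 1)]
        ring
    rw [key (n + 1) le_rfl, htop, saalTerm_of_lt _ _ _ _ (Nat.lt_succ_self n), qPoch_succ,
      qPoch_succ]
    ring

end

end QRacah

/-! ### The balanced ₃φ₂ sum and Sears' transformation -/

namespace QRacah

noncomputable section

/-- Dictionary between the standard balanced ₃φ₂ and the homogeneous form: the parameters become a,
e/(ab), e/a, and the remaining factor is independent of k. -/
theorem saalTerm_eq_balanced {q : ℂ} {a b e f : ℂ} (hq : q ≠ 0) (ha : a ≠ 0) (hb : b ≠ 0)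
    {n k : ℕ} (hk : k ≤ n) (hn : qPoch q q n ≠ 0) (h : e * f * q ^ n = a * b * q)
    (he : qPoch e q n ≠ 0) (hf : qPoch f q n ≠ 0) :
    qPoch (q ^ (-(n : ℤ))) q k * qPoch a q k * qPoch b q k / (qPoch e q k * qPoch f q k) *
        (q ^ k / qPoch q q k) *
        ((-(e / (a * b))) ^ n * q ^ n.choose 2 * (qPoch e q n * qPoch f q n)) =
      saalTerm q a (e / (a * b)) (e / a) n k := by
  obtain ⟨m, rfl⟩ := Nat.exists_eq_add_of_le hk
  have hek := qPoch_ne_zero_of_le he hk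
  have hfk := qPoch_ne_zero_of_le hf hk
  have hqk := qPoch_ne_zero_of_le hn hk
  have hqm : qPoch q q m ≠ 0 := qPoch_ne_zero_of_le hn (by omega)
  have hneg := qPoch_neg_pow hq m k
  rw [add_comm m k] at hneg
  have hprod : ∏ l ∈ Finset.range k, (e / (a * b) - e / a * q ^ l) =
      (e / (a * b)) ^ k * qPoch b q k := by
    rw [qPoch, ← Finset.card_range k, ← Finset.prod_const, Finset.card_range,
      ← Finset.prod_mul_distrib]
    refine Finset.prod_congr rfl fun l _ => ?_
    field_simp
  -- The balancing condition, in the shape that allows (e/(ab);q)_m to be reversed into (fq^k;q)_m.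
  have hE : e / (a * b) * f * q ^ (k + m) = q := by
    field_simp; linear_combination h
  generalize e / (a * b) = E at *
  have hrev := qPoch_reverse (x := f * q ^ k) (z := E) (m := m) (q := q)
    (Eq.trans (by ring) hE) hq
  have hpow : (E * f) ^ m * q ^ (2 * m.choose 2 + 2 * (k * m)) = q ^ (k * m) := by
    have h2 : 2 * m.choose 2 + m = m * m := by
      rw [Nat.choose_two_right, Nat.mul_div_cancel' (Nat.even_mul_pred_self m).two_dvd]
      rcases m with _ | m
      · rfl
      · simp; ring
    apply mul_right_cancel₀ (pow_ne_zero m hq)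
    calc (E * f) ^ m * q ^ (2 * m.choose 2 + 2 * (k * m)) * q ^ m
        = (E * f) ^ m * q ^ ((2 * m.choose 2 + m) + 2 * (k * m)) := by ring
      _ = (E * f * q ^ (k + m)) ^ m * q ^ (k * m) := by rw [h2]; ring
      _ = q ^ (k * m) * q ^ m := by rw [hE]; ring
  have hsub : k + m - k = m := by omega
  rw [saalTerm, hprod, qBinom, if_pos hk, hsub, qPoch_add e, qPoch_add f, ← hrev,
    choose_two_add, ← hneg]
  have e1 : a * (e / a) = e := by field_simp
  rw [e1]
  have e2 : (-E) ^ (k + m) * q ^ (k.choose 2 + m.choose 2 + k * m) *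
      ((-(f * q ^ k)) ^ m * q ^ m.choose 2) =
      (-1) ^ k * E ^ k * q ^ (k.choose 2 + k * m) := by
    have e3 : (-1 : ℂ) ^ (m * 2) = 1 := by rw [mul_comm, pow_mul]; norm_num
    calc _ = (-1) ^ k * E ^ k * q ^ k.choose 2 *
          ((E * f) ^ m * q ^ (2 * m.choose 2 + 2 * (k * m))) * (-1) ^ (m * 2) := by
          rw [neg_pow E, neg_pow (f * q ^ k)]; ring
      _ = _ := by rw [hpow, e3]; ring
  field_simp
  linear_combination (qPoch (q ^ (-((k + m : ℕ) : ℤ))) q k * q ^ k * qPoch (q ^ k * e) q m *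
    qPoch E q m * qPoch a q k * qPoch b q k) * e2

theorem sum_balanced {q : ℂ} {a b e f : ℂ} (hq : q ≠ 0) (ha : a ≠ 0) (hb : b ≠ 0)
    {n : ℕ} (hn : qPoch q q n ≠ 0) (h : e * f * q ^ n = a * b * q)
    (he0 : e ≠ 0) (he : qPoch e q n ≠ 0) (hf : qPoch f q n ≠ 0) :
    ∑ k ∈ Finset.range (n + 1), qPoch (q ^ (-(n : ℤ))) q k * qPoch a q k * qPoch b q k /
        (qPoch e q k * qPoch f q k) * (q ^ k / qPoch q q k) =
      a ^ n * (qPoch (e / a) q n * qPoch (f / a) q n) / (qPoch e q n * qPoch f q n) := by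
  have hE : e / (a * b) ≠ 0 := div_ne_zero he0 (mul_ne_zero ha hb)
  have hX : (-(e / (a * b))) ^ n * q ^ n.choose 2 * (qPoch e q n * qPoch f q n) ≠ 0 :=
    mul_ne_zero (mul_ne_zero (pow_ne_zero _ (neg_ne_zero.2 hE)) (pow_ne_zero _ hq))
      (mul_ne_zero he hf)
  apply mul_right_cancel₀ hX
  rw [Finset.sum_mul, Finset.sum_congr rfl fun k hk =>
    saalTerm_eq_balanced hq ha hb (Nat.lt_succ_iff.1 (Finset.mem_range.1 hk)) hn h he hf,
    saalschuetz _ _ _ _ hn]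
  -- The homogeneous sum yields (e/a;q)_n (e/b;q)_n; balancing reverses the second symbol into
  -- (f/a;q)_n.
  have hrev := qPoch_reverse (x := e / b) (z := f / a) (m := n) (q := q)
    (by field_simp; linear_combination h) hq
  have e1 : a * (e / (a * b)) = e / b := by field_simp
  rw [e1, ← hrev]
  have e2 : (-(e / b)) ^ n = a ^ n * (-(e / (a * b))) ^ n := by
    rw [← mul_pow]; congr 1; field_simp
  rw [e2]
  field_simp

theorem sum_range_triangle (n : ℕ) (F : ℕ → ℕ → ℂ) :
    ∑ k ∈ Finset.range (n + 1), ∑ l ∈ Finset.range (k + 1), F k l =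
      ∑ l ∈ Finset.range (n + 1), ∑ s ∈ Finset.range (n - l + 1), F (l + s) l := by
  rw [Finset.sum_comm' (t' := Finset.range (n + 1)) (s' := fun l => Finset.Ico l (n + 1))]
  · refine Finset.sum_congr rfl fun l hl => ?_
    have : l < n + 1 := Finset.mem_range.1 hl
    rw [Finset.sum_Ico_eq_sum_range, show n + 1 - l = n - l + 1 by omega]
  · intro x y
    simp only [Finset.mem_range, Finset.mem_Ico]
    omega

/-- Sears' transformation of a terminating balanced `₄φ₃`. -/
theorem sears {q : ℂ} {a b c d e f : ℂ} (hq : q ≠ 0) (ha : a ≠ 0) (hb : b ≠ 0) (hc : c ≠ 0)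
    (hd0 : d ≠ 0) (he0 : e ≠ 0) {n : ℕ} (hn : qPoch q q n ≠ 0)
    (h : d * e * f * q ^ n = a * b * c * q)
    (hd : qPoch d q n ≠ 0) (he : qPoch e q n ≠ 0) (hf : qPoch f q n ≠ 0) :
    ∑ k ∈ Finset.range (n + 1), qPoch (q ^ (-(n : ℤ))) q k * qPoch a q k * qPoch b q k *
        qPoch c q k / (qPoch d q k * qPoch e q k * qPoch f q k) * (q ^ k / qPoch q q k) =
      ∑ l ∈ Finset.range (n + 1), qPoch (q ^ (-(n : ℤ))) q l * qPoch a q l *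
        (qPoch (d / b) q l * qPoch (d / c) q l * (b * c * q / d) ^ l /
          (qPoch d q l * qPoch q q l)) *
        ((a * q ^ l) ^ (n - l) * (qPoch (e / a) q (n - l) * qPoch (f / a) q (n - l)) /
          (qPoch e q n * qPoch f q n)) := by
  have hg : b * c / d ≠ 0 := div_ne_zero (mul_ne_zero hb hc) hd0
  -- The product (b;q)_k (c;q)_k is replaced by the Saalschütz sum that evaluates to it, with
  -- parameters d/b, bc/d, b. After exchanging the sums the inner one is again balanced.
  have step : ∀ k ∈ Finset.range (n + 1),
      qPoch (q ^ (-(n : ℤ))) q k * qPoch a q k * qPoch b q k *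
        qPoch c q k / (qPoch d q k * qPoch e q k * qPoch f q k) * (q ^ k / qPoch q q k) =
      ∑ l ∈ Finset.range (k + 1), qPoch (q ^ (-(n : ℤ))) q k * qPoch a q k *
        saalTerm q (d / b) (b * c / d) b k l /
          (qPoch d q k * qPoch e q k * qPoch f q k) * (q ^ k / qPoch q q k) := by
    intro k hk
    have hk : k ≤ n := Nat.lt_succ_iff.1 (Finset.mem_range.1 hk)
    rw [← Finset.sum_mul, ← Finset.sum_div, ← Finset.mul_sum,
      saalschuetz _ _ _ _ (qPoch_ne_zero_of_le hn hk),
      show d / b * (b * c / d) = c by field_simp]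
    ring
  rw [Finset.sum_congr rfl step, sum_range_triangle]
  refine Finset.sum_congr rfl fun l hl => ?_
  obtain ⟨m, rfl⟩ := Nat.exists_eq_add_of_le (Nat.lt_succ_iff.1 (Finset.mem_range.1 hl))
  have hsub : l + m - l = m := by omega
  have hqm : qPoch q q m ≠ 0 := qPoch_ne_zero_of_le hn (by omega)
  have hql : qPoch q q l ≠ 0 := qPoch_ne_zero_of_le hn (by omega)
  have hdl : qPoch d q l ≠ 0 := qPoch_ne_zero_of_le hd (by omega)
  have hel : qPoch e q l ≠ 0 := qPoch_ne_zero_of_le he (by omega)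
  have hfl : qPoch f q l ≠ 0 := qPoch_ne_zero_of_le hf (by omega)
  have he' := he
  have hf' := hf
  rw [qPoch_add] at he' hf'
  have hem := right_ne_zero_of_mul he'
  have hfm := right_ne_zero_of_mul hf'
  -- Balancing of the inner ₃φ₂, with shifted parameters aq^l, bc/d over eq^l, fq^l and terminated
  -- by q^{-m}.
  have hbal : e * q ^ l * (f * q ^ l) * q ^ m = a * q ^ l * (b * c / d) * q := by
    field_simp
    have : d * e * f * q ^ l * q ^ m = a * b * c * q := by rw [← h]; ring
    linear_combination this
  have inner := sum_balanced hq (mul_ne_zero ha (pow_ne_zero l hq)) hg hqm hbal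
    (mul_ne_zero he0 (pow_ne_zero l hq)) hem hfm
  rw [mul_div_mul_right _ _ (pow_ne_zero l hq), mul_div_mul_right _ _ (pow_ne_zero l hq)] at inner
  have hz : q ^ (-((l + m : ℕ) : ℤ)) * q ^ l = q ^ (-(m : ℤ)) := by
    rw [← zpow_natCast, ← zpow_add₀ hq]; congr 1; push_cast; ring
  rw [hsub, qPoch_add e, qPoch_add f]
  have hprod : ∏ u ∈ Finset.range l, (b * c / d - b * q ^ u) =
      (b * c / d) ^ l * qPoch (d / c) q l := by
    rw [qPoch, ← Finset.card_range l, ← Finset.prod_const, Finset.card_range,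
      ← Finset.prod_mul_distrib]
    refine Finset.prod_congr rfl fun u _ => ?_
    field_simp
  have e0 : ∀ A B : ℂ, (a * q ^ l) ^ m * (A * B) /
      (qPoch e q l * qPoch (e * q ^ l) q m * (qPoch f q l * qPoch (f * q ^ l) q m)) =
      (a * q ^ l) ^ m * (A * B) / (qPoch (e * q ^ l) q m * qPoch (f * q ^ l) q m) *
        (1 / (qPoch e q l * qPoch f q l)) := by
    intro A B; field_simp
  rw [e0, ← inner, Finset.sum_mul, Finset.mul_sum]
  refine Finset.sum_congr rfl fun s hs => ?_
  obtain ⟨r, rfl⟩ := Nat.exists_eq_add_of_le (Nat.lt_succ_iff.1 (Finset.mem_range.1 hs))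
  have hs1 : l + s - l = s := by omega
  have hds : qPoch (d * q ^ l) q s ≠ 0 := by
    have := qPoch_ne_zero_of_le hd (show l + s ≤ l + (s + r) by omega)
    rw [qPoch_add] at this; exact right_ne_zero_of_mul this
  have hes : qPoch (e * q ^ l) q s ≠ 0 := qPoch_ne_zero_of_le hem (by omega)
  have hfs : qPoch (f * q ^ l) q s ≠ 0 := qPoch_ne_zero_of_le hfm (by omega)
  have hqs : qPoch q q s ≠ 0 := qPoch_ne_zero_of_le hqm (by omega)
  have hqls : qPoch q q (l + s) ≠ 0 := qPoch_ne_zero_of_le hn (by omega)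
  rw [saalTerm, hprod, qBinom, if_pos (by omega), hs1, show d / b * b * q ^ l = d * q ^ l by
    field_simp, qPoch_add (q ^ _), hz, qPoch_add a, qPoch_add d, qPoch_add e, qPoch_add f]
  generalize qPoch (d * q ^ l) q s = D2 at *
  generalize qPoch (e * q ^ l) q s = E2 at *
  generalize qPoch (f * q ^ l) q s = F2 at *
  generalize qPoch d q l = D1 at *
  generalize qPoch e q l = E1 at *
  generalize qPoch f q l = F1 at *
  generalize qPoch q q (l + s) = Q1 at *
  generalize qPoch q q l = Q2 at *
  generalize qPoch q q s = Q3 at *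
  generalize qPoch a q l = A1
  generalize qPoch (a * q ^ l) q s = A2
  generalize qPoch (b * c / d) q s = G
  generalize qPoch (q ^ (-((l + (s + r) : ℕ) : ℤ))) q l = Z1
  generalize qPoch (q ^ (-((s + r : ℕ) : ℤ))) q s = Z2
  generalize qPoch (d / b) q l = B1
  generalize qPoch (d / c) q l = C1
  have e2 : (b * c * q / d) ^ l = (b * c / d) ^ l * q ^ l := by rw [← mul_pow]; ring
  rw [e2, pow_add]
  generalize (b * c / d) ^ l = W
  clear hz inner hprod hbal step h hn hd he hf hem hfm he' hf' hqm e0 e2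
  field_simp

end

end QRacah

namespace QRacah

noncomputable section

/-! ### The bare `q`-Racah polynomials and their dual expansion -/

/-- The polynomial `(q^{-x};q)_k (c q^{x+1};q)_k` of degree `k` in `λ(x;c)`. -/
def latticePoly (q c : ℂ) (x k : ℕ) : ℂ :=
  qPoch (q ^ (-(x : ℤ))) q k * qPoch (c * q ^ (x + 1)) q k

/-- The `q`-Racah polynomial as a bare `₄φ₃` series, summed over `0 ≤ k ≤ M`. -/
def bareRacah (q α β γ : ℂ) (M n x : ℕ) : ℂ :=
  ∑ k ∈ Finset.range (M + 1), qPoch (q ^ (-(n : ℤ))) q k * qPoch (β * γ * q ^ (n + 1)) q k *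
    latticePoly q (α * β) x k /
      (qPoch (q * β) q k * qPoch (α * β * γ * q ^ (M + 2)) q k * qPoch (q ^ (-(M : ℤ))) q k) *
        (q ^ k / qPoch q q k)

/-- The coefficients of the expansion of the `q`-Racah polynomials of degree `n` on `M + 1` points
which terminates at `M - n`. -/
def dualCoeff (q α β γ : ℂ) (M n l : ℕ) : ℂ :=
  qPoch (q ^ (-((M - n : ℕ) : ℤ))) q l * qPoch (q ^ (-(M : ℤ)) / (β * γ * q ^ (n + 1))) q l *
    (β * γ * q ^ (M + 2)) ^ l /
  (qPoch (q ^ (-(M : ℤ))) q l * qPoch q q l * ((-β) ^ l * q ^ (l + 1).choose 2) *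
    (qPoch (q * α) q l * qPoch (γ * q * q ^ (M - l)) q l))

/-- The dual polynomial, of degree `M - n` in `λ(x;αβ)`. -/
def dualRacah (q α β γ : ℂ) (M n x : ℕ) : ℂ :=
  ∑ l ∈ Finset.range (M - n + 1), dualCoeff q α β γ M n l * latticePoly q (α * β) x l

/-- The prefactor relating `bareRacah` and `dualRacah`. -/
def dualFactor (q α β γ : ℂ) (M x : ℕ) : ℂ :=
  (-β) ^ x * q ^ (x + 1).choose 2 * (qPoch (q * α) q x * qPoch (γ * q * q ^ (M - x)) q x) /
    (qPoch (q * β) q x * qPoch (α * β * γ * q ^ (M + 2)) q x)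

theorem latticePoly_eq_zero {q : ℂ} (hq : q ≠ 0) (c : ℂ) {x k : ℕ} (h : x < k) :
    latticePoly q c x k = 0 := by
  rw [latticePoly, qPoch_neg_pow_eq_zero hq h, zero_mul]

theorem sum_range_extend {n M : ℕ} (h : n ≤ M) {f : ℕ → ℂ} (hf : ∀ k, n < k → f k = 0) :
    ∑ k ∈ Finset.range (n + 1), f k = ∑ k ∈ Finset.range (M + 1), f k :=
  Finset.sum_subset (Finset.range_subset_range.2 (by omega)) fun k _ hk =>
    hf k (by simpa using hk)

theorem qPoch_neg_pow_ne_zero {q : ℂ} (hq : q ≠ 0) {M k : ℕ} (hk : k ≤ M)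
    (hM : qPoch q q M ≠ 0) : qPoch (q ^ (-(M : ℤ))) q k ≠ 0 := by
  obtain ⟨m, rfl⟩ := Nat.exists_eq_add_of_le hk
  rw [add_comm] at hM ⊢
  rw [← qPoch_neg_pow hq] at hM
  exact left_ne_zero_of_mul (left_ne_zero_of_mul hM)

/-- Separates x from l in the summand produced by Sears. The first symbol is reversed into
(qα·q^l;q)_{x-l}, a quotient of (qα;q)_x by (qα;q)_l; the second is likewise a quotient of symbols
in γ. The x-part goes to `dualFactor`, the l-part to `dualCoeff`. -/
theorem dualFactor_summand {q α β γ : ℂ} (hq : q ≠ 0) (hα : α ≠ 0) (hβ : β ≠ 0)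
    {M x l : ℕ} (hl : l ≤ x) (hx : x ≤ M) (hqα : qPoch (q * α) q M ≠ 0)
    (hqγ : qPoch (γ * q * q ^ (M - l)) q l ≠ 0) :
    (α * β * q ^ (x + 1) * q ^ l) ^ (x - l) *
      (qPoch (q * β / (α * β * q ^ (x + 1))) q (x - l) *
        qPoch (α * β * γ * q ^ (M + 2) / (α * β * q ^ (x + 1))) q (x - l)) =
    (-β) ^ x * q ^ (x + 1).choose 2 * (qPoch (q * α) q x * qPoch (γ * q * q ^ (M - x)) q x) /
     (((-β) ^ l * q ^ (l + 1).choose 2) *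
      (qPoch (q * α) q l * qPoch (γ * q * q ^ (M - l)) q l)) := by
  obtain ⟨m, rfl⟩ := Nat.exists_eq_add_of_le hl
  obtain ⟨r, rfl⟩ := Nat.exists_eq_add_of_le hx
  have hqαl : qPoch (q * α) q l ≠ 0 := qPoch_ne_zero_of_le hqα (by omega)
  have s1 : l + m - l = m := by omega
  have s2 : l + m + r - (l + m) = r := by omega
  have s3 : l + m + r - l = r + m := by omega
  rw [s3] at hqγ
  rw [s1, s2, s3]
  have hrev := qPoch_reverse (x := q * α * q ^ l)
    (z := q * β / (α * β * q ^ (l + m + 1))) (m := m) (q := q) (by field_simp; ring) hq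
  have e1 : α * β * γ * q ^ (l + m + r + 2) / (α * β * q ^ (l + m + 1)) = γ * q * q ^ r := by
    field_simp; ring
  have e2 : qPoch (γ * q * q ^ r) q (l + m) =
      qPoch (γ * q * q ^ r) q m * qPoch (γ * q * q ^ (r + m)) q l := by
    rw [add_comm l m, qPoch_add]; congr 2; ring
  have e3 : (l + m + 1).choose 2 + m.choose 2 = (l + 1).choose 2 + m * (l + m) := by
    have h2 : 2 * m.choose 2 + m = m * m := by
      rw [Nat.choose_two_right, Nat.mul_div_cancel' (Nat.even_mul_pred_self m).two_dvd]
      rcases m with _ | m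
      · rfl
      · simp; ring
    have := choose_two_add (l + 1) m
    rw [show l + m + 1 = l + 1 + m by ring, this]
    linear_combination h2
  rw [e1, e2, qPoch_add, ← hrev, eq_div_iff (by
    exact mul_ne_zero (mul_ne_zero (pow_ne_zero _ (neg_ne_zero.2 hβ)) (pow_ne_zero _ hq))
      (mul_ne_zero hqαl hqγ))]
  have e4 : (-β) ^ (l + m) * (-(q * α * q ^ l)) ^ m * q ^ ((l + m + 1).choose 2 + m.choose 2) =
      (α * β * q ^ (l + m + 1) * q ^ l) ^ m * (-β) ^ l * q ^ (l + 1).choose 2 := by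
    rw [e3]
    have : (α * β * q ^ (l + m + 1) * q ^ l) = (-β) * (-(q * α * q ^ l)) * q ^ (l + m) := by ring
    rw [this, mul_pow, mul_pow, pow_add, pow_add, ← pow_mul, mul_comm (l + m) m]
    ring
  rw [pow_add q] at e4
  linear_combination (-qPoch (q * α) q l * qPoch (q * β / (α * β * q ^ (l + m + 1))) q m *
    qPoch (γ * q * q ^ r) q m * qPoch (γ * q * q ^ (r + m)) q l) * e4

/-- Sears' transformation with q^{-x} as terminating parameter, b = q^{-n} and d = q^{-M}. The new
parameter d/b = q^{-(M-n)} is what makes the transformed series stop at M-n. -/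
theorem bareRacah_eq_dual {q α β γ : ℂ} (hq : q ≠ 0) (hα : α ≠ 0) (hβ : β ≠ 0) (hγ : γ ≠ 0)
    {M n x : ℕ} (hn : n ≤ M) (hx : x ≤ M) (hM : qPoch q q M ≠ 0)
    (hqα : qPoch (q * α) q M ≠ 0) (hqβ : qPoch (q * β) q M ≠ 0) (hqγ : qPoch (q * γ) q M ≠ 0)
    (h3 : qPoch (α * β * γ * q ^ (M + 2)) q M ≠ 0) :
    bareRacah q α β γ M n x = dualFactor q α β γ M x * dualRacah q α β γ M n x := by
  have hγl : ∀ l ≤ M, qPoch (γ * q * q ^ (M - l)) q l ≠ 0 := by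
    intro l hl
    rw [show M = M - l + l by omega, qPoch_add, mul_comm q γ] at hqγ
    exact right_ne_zero_of_mul hqγ
  have hS := sears (q := q) (a := α * β * q ^ (x + 1)) (b := q ^ (-(n : ℤ)))
    (c := β * γ * q ^ (n + 1)) (d := q ^ (-(M : ℤ))) (e := q * β)
    (f := α * β * γ * q ^ (M + 2)) (n := x) hq
    (mul_ne_zero (mul_ne_zero hα hβ) (pow_ne_zero _ hq)) (zpow_ne_zero _ hq)
    (mul_ne_zero (mul_ne_zero hβ hγ) (pow_ne_zero _ hq)) (zpow_ne_zero _ hq)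
    (mul_ne_zero hq hβ) (qPoch_ne_zero_of_le hM hx)
    (by rw [zpow_neg, zpow_neg, zpow_natCast, zpow_natCast]; field_simp; ring)
    (qPoch_neg_pow_ne_zero hq hx hM) (qPoch_ne_zero_of_le hqβ hx) (qPoch_ne_zero_of_le h3 hx)
  have hb : q ^ (-(M : ℤ)) / q ^ (-(n : ℤ)) = q ^ (-((M - n : ℕ) : ℤ)) := by
    rw [← zpow_sub₀ hq]; congr 1; push_cast [hn]; ring
  have hc : q ^ (-(n : ℤ)) * (β * γ * q ^ (n + 1)) * q / q ^ (-(M : ℤ)) =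
      β * γ * q ^ (M + 2) := by
    rw [zpow_neg, zpow_neg, zpow_natCast, zpow_natCast]; field_simp; ring
  rw [hb, hc] at hS
  have h1 : bareRacah q α β γ M n x = ∑ k ∈ Finset.range (x + 1),
      qPoch (q ^ (-(x : ℤ))) q k * qPoch (α * β * q ^ (x + 1)) q k * qPoch (q ^ (-(n : ℤ))) q k *
        qPoch (β * γ * q ^ (n + 1)) q k / (qPoch (q ^ (-(M : ℤ))) q k * qPoch (q * β) q k *
        qPoch (α * β * γ * q ^ (M + 2)) q k) * (q ^ k / qPoch q q k) := by
    rw [bareRacah, sum_range_extend hx fun k hk => by rw [qPoch_neg_pow_eq_zero hq hk]; simp]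
    refine Finset.sum_congr rfl fun k _ => ?_
    rw [latticePoly]; ring
  rw [h1, hS, dualRacah, Finset.mul_sum,
    sum_range_extend (show M - n ≤ M by omega) (fun l hl => by
      rw [dualCoeff, qPoch_neg_pow_eq_zero hq hl]; simp),
    sum_range_extend hx (fun l hl => by rw [qPoch_neg_pow_eq_zero hq hl]; simp)]
  refine Finset.sum_congr rfl fun l hl => ?_
  by_cases hlx : l ≤ x
  · rw [dualFactor_summand hq hα hβ hlx hx hqα (hγl l (hlx.trans hx)), dualFactor, dualCoeff,
      latticePoly]
    ring
  · rw [latticePoly_eq_zero hq _ (not_le.1 hlx), qPoch_neg_pow_eq_zero hq (not_le.1 hlx)]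
    simp

theorem dualCoeff_zero (q α β γ : ℂ) (M n : ℕ) : dualCoeff q α β γ M n 0 = 1 := by
  simp [dualCoeff]

theorem racah_eq_bareRacah {h : ℂ} (hh : h ≠ 0) (t₁ t₂ t₃ : ℂ) {M n x : ℕ} (hn : n ≤ M)
    (hx : x ≤ M) :
    racah h t₁ t₂ t₃ M n x =
      Omega h t₁ t₂ t₃ M n * bareRacah (h ^ 2) (t₁ ^ 2) (t₂ ^ 2) (t₃ ^ 2) M n x := by
  have hq : h ^ 2 ≠ 0 := pow_ne_zero _ hh
  rw [racah, if_pos ⟨hn, hx⟩, phi43, bareRacah,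
    sum_range_extend hn fun k hk => by rw [qPoch_neg_pow_eq_zero hq hk]; simp]
  congr 1
  refine Finset.sum_congr rfl fun k _ => ?_
  rw [latticePoly]
  ring

/-- The duality `n ↔ x`, `α ↔ γ` of the `q`-Racah polynomials. -/
theorem bareRacah_duality (q α β γ : ℂ) (M n x : ℕ) :
    bareRacah q α β γ M n x = bareRacah q γ β α M x n := by
  refine Finset.sum_congr rfl fun k _ => ?_
  rw [latticePoly, latticePoly, show γ * β * α = α * β * γ by ring, mul_comm β γ, mul_comm β α]
  ring

end

end QRacah

namespace QRacah

noncomputable section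

/-! ### Products of two `q`-Racah polynomials with linked parameters -/

theorem qPochSkip_add (a q : ℂ) {m n : ℕ} (hn : n < m) (k : ℕ) :
    qPochSkip a q (m + k) n = qPochSkip a q m n * qPoch (a * q ^ m) q k := by
  induction k with
  | zero => simp
  | succ k ih =>
    rw [qPoch_succ, ← mul_assoc, ← ih, ← add_assoc]
    simp only [qPochSkip]
    rw [Finset.range_add_one, Finset.erase_insert_of_ne (by omega), Finset.prod_insert (by simp)]
    ring

theorem qPochSkip_ne_zero {a q : ℂ} {m n : ℕ} (h : ∀ l < m, l ≠ n → 1 - a * q ^ l ≠ 0) :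
    qPochSkip a q m n ≠ 0 :=
  Finset.prod_ne_zero_iff.2 fun l hl => by
    rw [Finset.mem_erase, Finset.mem_range] at hl
    exact h l hl.2 hl.1

theorem qPoch_eq_mul_prod_Ico (a q : ℂ) {k n : ℕ} (h : k ≤ n) :
    qPoch a q n = qPoch a q k * ∏ l ∈ Finset.Ico k n, (1 - a * q ^ l) :=
  (Finset.prod_range_mul_prod_Ico _ h).symm

/-- Genericity of the parameters of the product
`p_j(y; s₃, s₀, s₄; N - a) p_a(x; s₄, s₂, s₁; N - y)`. -/
structure PairGeneric (h s₀ s₁ s₂ s₃ s₄ : ℂ) (N : ℕ) : Prop where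
  h_ne : h ≠ 0
  ne₀ : s₀ ≠ 0
  ne₁ : s₁ ≠ 0
  ne₂ : s₂ ≠ 0
  ne₃ : s₃ ≠ 0
  ne₄ : s₄ ≠ 0
  balance : h ^ (2 * N + 3) * (s₀ * s₁ * s₂ * s₃ * s₄) = 1
  qq : qPoch (h ^ 2) (h ^ 2) N ≠ 0
  q₀ : qPoch (h ^ 2 * s₀ ^ 2) (h ^ 2) N ≠ 0
  q₁ : qPoch (h ^ 2 * s₁ ^ 2) (h ^ 2) N ≠ 0
  q₂ : qPoch (h ^ 2 * s₂ ^ 2) (h ^ 2) N ≠ 0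
  q₃ : qPoch (h ^ 2 * s₃ ^ 2) (h ^ 2) N ≠ 0
  q₄ : qPoch (h ^ 2 * s₄ ^ 2) (h ^ 2) N ≠ 0
  q₀₄ : ∀ k, 2 ≤ k → k ≤ 2 * N → 1 - s₀ ^ 2 * s₄ ^ 2 * (h ^ 2) ^ k ≠ 0
  q₂₁ : ∀ k, 2 ≤ k → k ≤ 2 * N → 1 - s₂ ^ 2 * s₁ ^ 2 * (h ^ 2) ^ k ≠ 0
  q₃₀₄ : ∀ k, 3 ≤ k → k ≤ 2 * N + 1 → 1 - s₃ ^ 2 * s₀ ^ 2 * s₄ ^ 2 * (h ^ 2) ^ k ≠ 0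
  q₄₂₁ : ∀ k, 3 ≤ k → k ≤ 2 * N + 1 → 1 - s₄ ^ 2 * s₂ ^ 2 * s₁ ^ 2 * (h ^ 2) ^ k ≠ 0

theorem qPoch_shift_ne_zero {q c : ℂ} {s m k lo hi : ℕ} (h : ∀ k, lo ≤ k → k ≤ hi → 1 - c * q ^ k ≠ 0)
    (h1 : lo ≤ s) (h2 : s + k ≤ hi + 1) (hm : s = m) : qPoch (c * q ^ m) q k ≠ 0 := by
  subst hm
  refine qPoch_ne_zero fun l hl => ?_
  have := h (s + l) (by omega) (by omega)
  rwa [pow_add, ← mul_assoc] at this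

/-- `(q^{-K};q)_a (αβγ q^{K+2};q)_a ₄φ₃`, a polynomial in `λ(x;αβ)` and in
`q^{-K} + αβγ q^{K+2}`. -/
def pairPoly (q α β γ : ℂ) (K a x : ℕ) : ℂ :=
  ∑ k ∈ Finset.range (a + 1), qPoch (q ^ (-(a : ℤ))) q k * qPoch (β * γ * q ^ (a + 1)) q k * q ^ k /
    (qPoch (q * β) q k * qPoch q q k) * latticePoly q (α * β) x k *
      ∏ l ∈ Finset.Ico k a,
        ((1 - q ^ (-(K : ℤ)) * q ^ l) * (1 - α * β * γ * q ^ (K + 2) * q ^ l))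

/-- Multiplying by the full symbols of length a clears the denominators that depend on K; the unused
factors l = k, …, a-1 remain in the k-th term. -/
theorem pairPoly_eq_bareRacah {q : ℂ} (hq : q ≠ 0) (α β γ : ℂ) {K a : ℕ} (x : ℕ) (ha : a ≤ K)
    (hK : qPoch q q K ≠ 0) (h3 : qPoch (α * β * γ * q ^ (K + 2)) q K ≠ 0) :
    qPoch (q ^ (-(K : ℤ))) q a * qPoch (α * β * γ * q ^ (K + 2)) q a *
      bareRacah q α β γ K a x = pairPoly q α β γ K a x := by
  rw [bareRacah, pairPoly, ← sum_range_extend ha fun k hk => by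
    rw [qPoch_neg_pow_eq_zero hq hk]; simp, Finset.mul_sum]
  refine Finset.sum_congr rfl fun k hk => ?_
  have hk : k ≤ a := Nat.lt_succ_iff.1 (Finset.mem_range.1 hk)
  have n1 := qPoch_neg_pow_ne_zero hq (hk.trans ha) hK
  have n2 := qPoch_ne_zero_of_le h3 (hk.trans ha)
  rw [Finset.prod_mul_distrib, qPoch_eq_mul_prod_Ico (q ^ (-(K : ℤ))) q hk,
    qPoch_eq_mul_prod_Ico (α * β * γ * q ^ (K + 2)) q hk]
  generalize ∏ l ∈ Finset.Ico k a, (1 - q ^ (-(K : ℤ)) * q ^ l) = A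
  generalize ∏ l ∈ Finset.Ico k a, (1 - α * β * γ * q ^ (K + 2) * q ^ l) = B
  generalize qPoch (q ^ (-(K : ℤ))) q k = C at *
  generalize qPoch (α * β * γ * q ^ (K + 2)) q k = D at *
  field_simp

/-- Matches the convention p_a = 0 beyond the range: a term with k ≤ x contains the factor l = K,
which is zero, and a term with k > x is killed by (q^{-x};q)_k. Thus the range of a can be taken
independent of y. -/
theorem pairPoly_eq_zero {q : ℂ} (hq : q ≠ 0) (α β γ : ℂ) {K a x : ℕ} (hx : x ≤ K) (ha : K < a) :
    pairPoly q α β γ K a x = 0 := by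
  refine Finset.sum_eq_zero fun k _ => ?_
  by_cases hk : x < k
  · rw [latticePoly_eq_zero hq _ hk]; simp
  · rw [Finset.prod_eq_zero (i := K) (by rw [Finset.mem_Ico]; omega), mul_zero]
    rw [zpow_neg, zpow_natCast, inv_mul_cancel₀ (pow_ne_zero _ hq)]; simp

/-- The part of the normalisation of the product that does not depend on `x` and `y`. -/
def pairConst (h s₁ s₂ s₄ : ℂ) (N a : ℕ) : ℂ :=
  (-1) ^ a * (h ^ 2) ^ (a * (N - a) + a + a.choose 2) * (h * s₂) ^ ((N : ℤ) - 2 * a) *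
    (qPoch (h ^ 2 * s₂ ^ 2) (h ^ 2) a * qPoch (h ^ 2 * s₄ ^ 2) (h ^ 2) (N - a)) /
    (qPoch (h ^ 2) (h ^ 2) a * qPoch (h ^ 2 * s₁ ^ 2) (h ^ 2) a *
      qPochSkip (s₂ ^ 2 * s₁ ^ 2 * (h ^ 2) ^ (a + 1)) (h ^ 2) (N + 1) a)

/-- The symbols in s₄ combine into one of length N-a. The denominator of `Omega` is completed to
length N+1 by y further factors, which balancing identifies, after reversal, with the symbol in
s₃s₀s₄ in the denominator of `dualFactor`. What mixes a and y afterwards is only the pair of symbols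
absorbed by `pairPoly`. -/
theorem Omega_mul_dualFactor {h s₀ s₁ s₂ s₃ s₄ : ℂ} {N : ℕ}
    (H : PairGeneric h s₀ s₁ s₂ s₃ s₄ N) {a y : ℕ} (hay : a + y ≤ N) :
    Omega h s₄ s₂ s₁ (N - y) a * dualFactor (h ^ 2) (s₃ ^ 2) (s₀ ^ 2) (s₄ ^ 2) (N - a) y =
      (s₁ / s₄) ^ y * xi h s₃ s₀ y * pairConst h s₁ s₂ s₄ N a *
        (qPoch ((h ^ 2) ^ (-((N - y : ℕ) : ℤ))) (h ^ 2) a *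
          qPoch (s₄ ^ 2 * s₂ ^ 2 * s₁ ^ 2 * (h ^ 2) ^ (N - y + 2)) (h ^ 2) a) := by
  obtain ⟨r, rfl⟩ := Nat.exists_eq_add_of_le hay
  have hh := H.h_ne
  have hq : h ^ 2 ≠ 0 := pow_ne_zero _ hh
  have e1 : a + y + r - y = r + a := by omega
  have e2 : a + y + r - a = r + y := by omega
  have e3 : r + a - a = r := by omega
  have e4 : r + y - y = r := by omega
  have e0 : a + y + r + 1 = (r + a + 1) + y := by ring
  rw [Omega, dualFactor, pairConst, xi, qBinom, e1, if_pos (by omega), e2, e3, e4, e0,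
    qPochSkip_add _ _ (show a < r + a + 1 by omega), qPoch_add (h ^ 2 * s₄ ^ 2) _ r y,
    ← qPoch_neg_pow hq r a]
  have hbal := H.balance
  have hrev := qPoch_reverse (x := s₃ ^ 2 * s₀ ^ 2 * s₄ ^ 2 * (h ^ 2) ^ (r + y + 2))
    (z := s₂ ^ 2 * s₁ ^ 2 * (h ^ 2) ^ (a + 1) * (h ^ 2) ^ (r + a + 1)) (m := y) (q := h ^ 2)
    (by
      calc _ = (h ^ (2 * (a + y + r) + 3) * (s₀ * s₁ * s₂ * s₃ * s₄)) ^ 2 * h ^ 2 := by ring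
        _ = h ^ 2 := by rw [hbal]; ring) hq
  have hx0 : s₃ ^ 2 * s₀ ^ 2 * s₄ ^ 2 * (h ^ 2) ^ (r + y + 2) ≠ 0 := by
    have := H.ne₃; have := H.ne₀; have := H.ne₄; positivity
  -- This uses the balancing condition for the chosen square roots; its square alone would leave a
  -- sign raised to the power y.
  have hb : (s₀ ^ 2 * h ^ 2 * (s₃ * s₄)) =
      (s₃ ^ 2 * s₀ ^ 2 * s₄ ^ 2 * (h ^ 2) ^ (r + y + 2)) * (s₁ * s₀ * (h ^ 2) ^ a * (h * s₂)) := by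
    calc _ = (s₀ ^ 2 * h ^ 2 * (s₃ * s₄)) *
          (h ^ (2 * (a + y + r) + 3) * (s₀ * s₁ * s₂ * s₃ * s₄)) := by rw [hbal, mul_one]
      _ = _ := by ring
  rw [← hrev]
  have n1 : qPoch (h ^ 2) (h ^ 2) r ≠ 0 := qPoch_ne_zero_of_le H.qq (by omega)
  have n2 : qPoch (h ^ 2) (h ^ 2) a ≠ 0 := qPoch_ne_zero_of_le H.qq (by omega)
  have e5 : h ^ 2 * s₄ ^ 2 * (h ^ 2) ^ r = s₄ ^ 2 * h ^ 2 * (h ^ 2) ^ r := by ring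
  rw [e5]
  generalize s₃ ^ 2 * s₀ ^ 2 * s₄ ^ 2 * (h ^ 2) ^ (r + y + 2) = X at *
  have e6 : (h * s₂) ^ (((a + y + r : ℕ) : ℤ) - 2 * a) =
      (h * s₂) ^ y / (h * s₂) ^ (2 * (a : ℤ) - ((r + a : ℕ) : ℤ)) := by
    rw [← zpow_natCast, ← zpow_sub₀ (mul_ne_zero hh H.ne₂)]
    congr 1; push_cast; ring
  have e7 : (y + 1).choose 2 = y.choose 2 + y := by
    rw [Nat.choose_succ_succ' y]; simp; ring
  rw [e6, e7]
  have hz : (h * s₂) ^ (2 * (a : ℤ) - ((r + a : ℕ) : ℤ)) ≠ 0 :=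
    zpow_ne_zero _ (mul_ne_zero hh H.ne₂)
  have key : (-s₀ ^ 2) ^ y * (h ^ 2) ^ (y.choose 2 + y) * (s₃ ^ y * s₄ ^ y) *
      (h ^ 2) ^ (r * a + a + a.choose 2) = (-X) ^ y * (h ^ 2) ^ y.choose 2 *
      (s₁ ^ y * s₀ ^ y * (h * s₂) ^ y) * (h ^ 2) ^ (a * (r + y) + a + a.choose 2) := by
    calc _ = (-1) ^ y * (s₀ ^ 2 * h ^ 2 * (s₃ * s₄)) ^ y *
          ((h ^ 2) ^ y.choose 2 * (h ^ 2) ^ (r * a + a + a.choose 2)) := by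
          rw [neg_pow (s₀ ^ 2)]; ring
      _ = _ := by rw [hb, neg_pow X]; ring
  have q1 : (-X) ^ y * (h ^ 2) ^ y.choose 2 ≠ 0 :=
    mul_ne_zero (pow_ne_zero _ (neg_ne_zero.2 hx0)) (pow_ne_zero _ hq)
  generalize (-X) ^ y * (h ^ 2) ^ y.choose 2 = XY at *
  generalize (h * s₂) ^ (2 * (a : ℤ) - ((r + a : ℕ) : ℤ)) = Z at *
  have m3 := pow_ne_zero y H.ne₃
  have m4 := pow_ne_zero y H.ne₄
  rw [div_pow, div_pow]
  generalize (h ^ 2) ^ (a * (r + y) + a + a.choose 2) = E1 at *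
  generalize (h ^ 2) ^ (r * a + a + a.choose 2) = E2 at *
  generalize (h * s₂) ^ y = E3 at *
  generalize (-s₀ ^ 2) ^ y * (h ^ 2) ^ (y.choose 2 + y) = E4 at *
  generalize s₃ ^ y = S3 at *
  generalize s₄ ^ y = S4 at *
  generalize s₁ ^ y = S1 at *
  generalize s₀ ^ y = S0 at *
  generalize qPoch (h ^ 2) (h ^ 2) r = Q1 at *
  generalize qPoch (h ^ 2) (h ^ 2) a = Q2 at *
  generalize qPochSkip _ _ _ _ = SK
  generalize qPoch (s₂ ^ 2 * s₁ ^ 2 * (h ^ 2) ^ (a + 1) * (h ^ 2) ^ (r + a + 1)) (h ^ 2) y = Y1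
  generalize qPoch (h ^ 2 * s₁ ^ 2) (h ^ 2) a = Y2
  generalize qPoch (h ^ 2 * s₂ ^ 2) (h ^ 2) a = Y3
  generalize qPoch (h ^ 2 * s₄ ^ 2) (h ^ 2) r = Y4
  generalize qPoch (h ^ 2 * s₀ ^ 2) (h ^ 2) y = Y5
  generalize qPoch (h ^ 2 * s₃ ^ 2) (h ^ 2) y = Y6
  generalize qPoch (s₄ ^ 2 * h ^ 2 * (h ^ 2) ^ r) (h ^ 2) y = Y7
  generalize qPoch (s₄ ^ 2 * s₂ ^ 2 * s₁ ^ 2 * (h ^ 2) ^ (r + a + 2)) (h ^ 2) a = Y8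
  generalize qPoch ((h ^ 2) ^ (-((r + a : ℕ) : ℤ))) (h ^ 2) a = Y9
  clear hrev hb hbal e0 e1 e2 e3 e4 e5 e6 e7
  have key2 : E4 * E2 / XY = S1 * S0 * E3 * E1 / (S3 * S4) := by
    rw [div_eq_div_iff q1 (mul_ne_zero m3 m4)]; linear_combination key
  calc _ = (E4 * E2 / XY) * ((Q1 / Q1) * (Y9 * (-1) ^ a / Q2 * (Y3 * Y8 * Y4) / (Z * SK * Y2) *
        (Y6 * Y7) / (Y5 * Y1))) := by ring
    _ = _ := by rw [key2, div_self n1]; ring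

/-- The core factorisation: a function of y, a constant depending on a and j, and a polynomial
factor. -/
theorem racah_mul_racah {h s₀ s₁ s₂ s₃ s₄ : ℂ} {N : ℕ}
    (H : PairGeneric h s₀ s₁ s₂ s₃ s₄ N) {a j x y : ℕ} (haj : a + j ≤ N) (hxy : x + y ≤ N) :
    racah h s₃ s₀ s₄ (N - a) j y * racah h s₄ s₂ s₁ (N - y) a x =
      (s₁ / s₄) ^ y * xi h s₃ s₀ y *
        (pairConst h s₁ s₂ s₄ N a * Omega h s₃ s₀ s₄ (N - a) j) *
        (dualRacah (h ^ 2) (s₃ ^ 2) (s₀ ^ 2) (s₄ ^ 2) (N - a) j y *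
          pairPoly (h ^ 2) (s₄ ^ 2) (s₂ ^ 2) (s₁ ^ 2) (N - y) a x) := by
  have hq : h ^ 2 ≠ 0 := pow_ne_zero _ H.h_ne
  by_cases hay : a + y ≤ N
  · have hO := Omega_mul_dualFactor H hay
    have h304 : qPoch (s₃ ^ 2 * s₀ ^ 2 * s₄ ^ 2 * (h ^ 2) ^ (N - a + 2)) (h ^ 2) (N - a) ≠ 0 := by
      rcases Nat.eq_zero_or_pos (N - a) with h0 | h0
      · rw [h0]; simp
      · exact qPoch_shift_ne_zero H.q₃₀₄ (s := N - a + 2) (by omega) (by omega) rfl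
    have h421 : qPoch (s₄ ^ 2 * s₂ ^ 2 * s₁ ^ 2 * (h ^ 2) ^ (N - y + 2)) (h ^ 2) (N - y) ≠ 0 := by
      rcases Nat.eq_zero_or_pos (N - y) with h0 | h0
      · rw [h0]; simp
      · exact qPoch_shift_ne_zero H.q₄₂₁ (s := N - y + 2) (by omega) (by omega) rfl
    rw [racah_eq_bareRacah H.h_ne _ _ _ (by omega) (by omega),
      racah_eq_bareRacah H.h_ne _ _ _ (by omega) (by omega),
      bareRacah_eq_dual hq (pow_ne_zero _ H.ne₃) (pow_ne_zero _ H.ne₀) (pow_ne_zero _ H.ne₄)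
        (by omega) (by omega) (qPoch_ne_zero_of_le H.qq (by omega))
        (qPoch_ne_zero_of_le H.q₃ (by omega)) (qPoch_ne_zero_of_le H.q₀ (by omega))
        (qPoch_ne_zero_of_le H.q₄ (by omega)) h304,
      ← pairPoly_eq_bareRacah hq _ _ _ x (by omega) (qPoch_ne_zero_of_le H.qq (by omega)) h421]
    linear_combination (Omega h s₃ s₀ s₄ (N - a) j *
      dualRacah (h ^ 2) (s₃ ^ 2) (s₀ ^ 2) (s₄ ^ 2) (N - a) j y *
      bareRacah (h ^ 2) (s₄ ^ 2) (s₂ ^ 2) (s₁ ^ 2) (N - y) a x) * hO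
  -- For a + y > N both sides vanish, the left one by the convention in `racah`.
  · rw [pairPoly_eq_zero hq _ _ _ (by omega) (by omega), racah, if_neg (by omega)]
    simp

end

end QRacah

namespace QRacah

noncomputable section

/-! ### Functions which are bivariate polynomials of bounded degree -/

/-- `f` is a polynomial of total degree at most `d` in `u` and `v`, in which the coefficient of
`u ^ d` is `c`. -/
def HasRep {ι : Type*} (u v : ι → ℂ) (d : ℕ) (c : ℂ) (f : ι → ℂ) : Prop :=
  ∃ P : MvPolynomial (Fin 2) ℂ, P.totalDegree ≤ d ∧ P.coeff (Finsupp.single 0 d) = c ∧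
    ∀ i, f i = MvPolynomial.eval ![u i, v i] P

namespace HasRep

variable {ι : Type*} {u v f g : ι → ℂ} {d e : ℕ} {a b : ℂ}

theorem congr (hf : HasRep u v d a f) (h : ∀ i, g i = f i) : HasRep u v d a g := by
  obtain ⟨P, h1, h2, h3⟩ := hf
  exact ⟨P, h1, h2, fun i => (h i).trans (h3 i)⟩

theorem const (a : ℂ) : HasRep u v 0 a fun _ => a :=
  ⟨MvPolynomial.C a, by simp, by simp, by simp⟩

theorem fst : HasRep u v 1 1 u :=
  ⟨MvPolynomial.X 0, by simp, by simp [MvPolynomial.coeff_X], by simp⟩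

theorem snd : HasRep u v 1 0 v :=
  ⟨MvPolynomial.X 1, by simp, by
    rw [MvPolynomial.coeff_X, if_neg]
    intro h
    have := DFunLike.congr_fun h 0
    simp at this, by simp⟩

theorem add (hf : HasRep u v d a f) (hg : HasRep u v d b g) :
    HasRep u v d (a + b) fun i => f i + g i := by
  obtain ⟨P, h1, h2, h3⟩ := hf
  obtain ⟨Q, k1, k2, k3⟩ := hg
  exact ⟨P + Q, (MvPolynomial.totalDegree_add _ _).trans (max_le h1 k1), by simp [h2, k2],
    fun i => by simp [h3, k3]⟩

theorem sum {κ : Type*} (s : Finset κ) {F : κ → ι → ℂ} {c : κ → ℂ}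
    (h : ∀ k ∈ s, HasRep u v d (c k) (F k)) :
    HasRep u v d (∑ k ∈ s, c k) fun i => ∑ k ∈ s, F k i := by
  classical
  induction s using Finset.induction_on with
  | empty => exact ⟨0, by simp, by simp, by simp⟩
  | insert k s hk ih =>
    have := (h k (Finset.mem_insert_self _ _)).add
      (ih fun l hl => h l (Finset.mem_insert_of_mem hl))
    simpa only [Finset.sum_insert hk] using this

/-- Two monomials of degrees at most d and e whose product is u^{d+e} must be u^d and u^e, so the
recorded coefficients multiply. -/
theorem mul (hf : HasRep u v d a f) (hg : HasRep u v e b g) :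
    HasRep u v (d + e) (a * b) fun i => f i * g i := by
  obtain ⟨P, h1, h2, h3⟩ := hf
  obtain ⟨Q, k1, k2, k3⟩ := hg
  refine ⟨P * Q, (MvPolynomial.totalDegree_mul _ _).trans (add_le_add h1 k1), ?_,
    fun i => by simp [h3, k3]⟩
  rw [MvPolynomial.coeff_mul, Finset.sum_eq_single (Finsupp.single 0 d, Finsupp.single 0 e)]
  · rw [h2, k2]
  · rintro ⟨m, n⟩ hmn hne
    rw [Finset.HasAntidiagonal.mem_antidiagonal] at hmn
    simp only at hmn ⊢
    have hdeg : m.degree + n.degree = d + e := by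
      rw [← map_add, hmn, Finsupp.degree_single]
    have hm1 : m 1 = 0 := by
      have := DFunLike.congr_fun hmn 1
      simp at this; omega
    have hn1 : n 1 = 0 := by
      have := DFunLike.congr_fun hmn 1
      simp at this; omega
    have hm : m = Finsupp.single 0 (m 0) := by
      ext i; fin_cases i <;> simp [hm1]
    have hn : n = Finsupp.single 0 (n 0) := by
      ext i; fin_cases i <;> simp [hn1]
    rw [hm, hn] at hdeg
    simp only [Finsupp.degree_single] at hdeg
    have hcase : d < m 0 ∨ e < n 0 := by
      by_contra hcon
      push Not at hcon
      apply hne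
      rw [hm, hn, show m 0 = d by omega, show n 0 = e by omega]
    rcases hcase with hc | hc
    · rw [MvPolynomial.coeff_eq_zero_of_totalDegree_lt, zero_mul]
      rw [hm]
      refine h1.trans_lt ?_
      change d < (Finsupp.single (0 : Fin 2) (m 0)).degree
      rwa [Finsupp.degree_single]
    · rw [MvPolynomial.coeff_eq_zero_of_totalDegree_lt (f := Q), mul_zero]
      rw [hn]
      refine k1.trans_lt ?_
      change e < (Finsupp.single (0 : Fin 2) (n 0)).degree
      rwa [Finsupp.degree_single]
  · intro h; exact absurd (by simp) h

/-- Enlarging the degree bound makes the recorded coefficient zero; this is how lower-order terms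
drop out of leading coefficients. -/
theorem mono (hf : HasRep u v d a f) (h : d < e) : HasRep u v e 0 f := by
  obtain ⟨P, h1, h2, h3⟩ := hf
  refine ⟨P, h1.trans h.le, MvPolynomial.coeff_eq_zero_of_totalDegree_lt ?_, h3⟩
  refine h1.trans_lt ?_
  change d < (Finsupp.single (0 : Fin 2) e).degree
  rwa [Finsupp.degree_single]

theorem const_mul (c : ℂ) (hf : HasRep u v d a f) : HasRep u v d (c * a) fun i => c * f i := by
  have := (const (u := u) (v := v) c).mul hf
  rwa [zero_add] at this

/-- A linear factor `r + s u`. -/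
theorem linear_fst (r s : ℂ) : HasRep u v 1 s fun i => r + s * u i := by
  have := ((const (u := u) (v := v) r).mono one_pos).add (fst.const_mul s)
  simpa using this

/-- A linear factor `r + s v`. -/
theorem linear_snd (r s : ℂ) : HasRep u v 1 0 fun i => r + s * v i := by
  have := ((const (u := u) (v := v) r).mono one_pos).add (snd.const_mul s)
  simpa using this

theorem prod {κ : Type*} (s : Finset κ) {F : κ → ι → ℂ} {c : κ → ℂ}
    (h : ∀ k ∈ s, HasRep u v 1 (c k) (F k)) :
    HasRep u v s.card (∏ k ∈ s, c k) fun i => ∏ k ∈ s, F k i := by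
  classical
  induction s using Finset.induction_on with
  | empty => simpa using const (1 : ℂ)
  | insert k s hk ih =>
    have := (h k (Finset.mem_insert_self _ _)).mul
      (ih fun l hl => h l (Finset.mem_insert_of_mem hl))
    simpa only [Finset.prod_insert hk, Finset.card_insert_of_notMem hk, add_comm 1] using this

theorem totalDegree_eq {P : MvPolynomial (Fin 2) ℂ} (h : P.totalDegree ≤ d)
    (hP : P.coeff (Finsupp.single 0 d) ≠ 0) : P.totalDegree = d := by
  refine le_antisymm h ?_
  have := MvPolynomial.le_totalDegree (MvPolynomial.mem_support_iff.2 hP)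
  change (Finsupp.single (0 : Fin 2) d).degree ≤ _ at this
  rwa [Finsupp.degree_single] at this

theorem exists_totalDegree_eq (hf : HasRep u v d a f) (ha : a ≠ 0) :
    ∃ P : MvPolynomial (Fin 2) ℂ, P.totalDegree = d ∧
      ∀ i, f i = MvPolynomial.eval ![u i, v i] P := by
  obtain ⟨P, h1, h2, h3⟩ := hf
  exact ⟨P, totalDegree_eq h1 (h2 ▸ ha), h3⟩

/-- Expansion in monomials. -/
theorem exists_coeff (hf : HasRep u v d a f) :
    ∃ c : ℕ → ℕ → ℂ, c d 0 = a ∧ (∀ i j, d < i + j → c i j = 0) ∧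
      ∀ p, f p = ∑ i ∈ Finset.range (d + 1), ∑ j ∈ Finset.range (d + 1),
        c i j * u p ^ i * v p ^ j := by
  obtain ⟨P, h1, h2, h3⟩ := hf
  let m : ℕ → ℕ → Fin 2 →₀ ℕ := fun i j => Finsupp.single 0 i + Finsupp.single 1 j
  have hdeg : ∀ i j, (m i j).degree = i + j := fun i j => by simp [m]
  have hc : ∀ i j, d < i + j → P.coeff (m i j) = 0 := fun i j hij => by
    apply MvPolynomial.coeff_eq_zero_of_totalDegree_lt
    refine h1.trans_lt ?_
    change d < (m i j).degree
    rwa [hdeg]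
  refine ⟨fun i j => P.coeff (m i j), by simpa [m] using h2, hc, fun p => ?_⟩
  rw [h3, MvPolynomial.eval_eq', ← Finset.sum_product']
  have hm : ∀ s : Fin 2 →₀ ℕ, m (s 0) (s 1) = s := fun s => by
    ext i; fin_cases i <;> simp [m]
  have hm0 : ∀ i j, m i j 0 = i := fun i j => by simp [m]
  have hm1 : ∀ i j, m i j 1 = j := fun i j => by simp [m]
  refine Finset.sum_bij_ne_zero (fun s _ _ => (s 0, s 1)) ?_ ?_ ?_ ?_
  · intro s hs _
    have := (MvPolynomial.le_totalDegree hs).trans h1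
    change s.degree ≤ d at this
    rw [← hm s, hdeg] at this
    simp only [Finset.mem_product, Finset.mem_range]
    omega
  · intro s _ _ t _ _ hst
    rw [Prod.mk.injEq] at hst
    rw [← hm s, ← hm t, hst.1, hst.2]
  · rintro ⟨i, j⟩ _ hne
    refine ⟨m i j, ?_, ?_, by rw [hm0, hm1]⟩
    · rw [MvPolynomial.mem_support_iff]
      intro h0
      simp [h0] at hne
    · simpa [hm0, hm1, Fin.prod_univ_two, mul_assoc] using hne
  · intro s _ _
    simp [hm, Fin.prod_univ_two, mul_assoc]

theorem pow_mul_pow (i j : ℕ) (h : i + j ≤ d) :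
    HasRep u v d (if i = d then 1 else 0) fun p => u p ^ i * v p ^ j := by
  have hu : ∀ i, HasRep u v i 1 fun p => u p ^ i := fun i => by
    simpa using prod (u := u) (v := v) (Finset.range i) (F := fun _ => u) (c := fun _ => 1)
      fun _ _ => fst
  have hv : ∀ j, HasRep u v j (0 ^ j) fun p => v p ^ j := fun i => by
    simpa using prod (u := u) (v := v) (Finset.range i) (F := fun _ => v) (c := fun _ => 0)
      fun _ _ => snd
  have huv := (hu i).mul (hv j)
  rcases h.eq_or_lt with rfl | h
  · rcases Nat.eq_zero_or_pos j with rfl | hj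
    · simpa using huv
    · rw [if_neg (by omega)]
      simpa [hj.ne'] using huv
  · rw [if_neg (by omega)]
    exact huv.mono h

/-- A sum of functions indexed by the monomials of a polynomial. -/
theorem sum_monomials {κ : Type*} {u' v' : κ → ℂ} {c : ℕ → ℕ → ℂ} {F : ℕ → ℕ → κ → ℂ}
    {γ : ℕ → ℂ} (hc : ∀ i j, d < i + j → c i j = 0)
    (hF : ∀ i j, i + j ≤ d → HasRep u' v' d (if i = d then γ d else 0) (F i j)) :
    HasRep u' v' d (c d 0 * γ d) fun p => ∑ i ∈ Finset.range (d + 1), ∑ j ∈ Finset.range (d + 1),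
        c i j * F i j p := by
  have h1 : ∀ i ∈ Finset.range (d + 1), ∀ j ∈ Finset.range (d + 1),
      HasRep u' v' d (if j = 0 then (if i = d then c d 0 * γ d else 0) else 0)
        (fun p => c i j * F i j p) := by
    intro i _ j _
    by_cases hij : i + j ≤ d
    · convert (hF i j hij).const_mul (c i j) using 1
      split_ifs with h1 h2 h2
      · rw [h1, h2]
      · rw [mul_zero]
      · omega
      · rw [mul_zero]
    · rw [hc i j (by omega)]
      have e : (if j = 0 then (if i = d then c d 0 * γ d else 0) else 0) = 0 := by
        split_ifs <;> first | omega | rfl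
      rw [e]
      rcases Nat.eq_zero_or_pos d with rfl | h0
      · exact (const 0).congr fun _ => by rw [zero_mul]
      · exact ((const 0).mono h0).congr fun _ => by rw [zero_mul]
  have h2 := sum _ fun i hi => sum _ (h1 i hi)
  simpa using h2

end HasRep

end

end QRacah

namespace QRacah

noncomputable section

/-! ### Degrees and leading coefficients -/

theorem zpow_neg_mul_pow_succ {q : ℂ} (hq : q ≠ 0) (x : ℕ) : q ^ (-(x : ℤ)) * q ^ (x + 1) = q := by
  rw [zpow_neg, zpow_natCast, pow_succ, ← mul_assoc, inv_mul_cancel₀ (pow_ne_zero _ hq), one_mul]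

/-- The product of q^{-x} and cq^{x+1} is constant, so each pair of factors with the same index is
affine in λ(x;c). -/
theorem latticePoly_eq_prod {q : ℂ} (hq : q ≠ 0) (c : ℂ) (x k : ℕ) :
    latticePoly q c x k = ∏ l ∈ Finset.range k,
      ((1 - q ^ l) * (1 - c * q ^ (l + 1)) + (-q ^ l) * lam q c x) := by
  rw [latticePoly, qPoch, qPoch, ← Finset.prod_mul_distrib]
  refine Finset.prod_congr rfl fun l _ => ?_
  have h := zpow_neg_mul_pow_succ hq x
  rw [lam]
  linear_combination (c * q ^ l * q ^ l - c * q ^ l) * h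

section Rep

variable {ι : Type*} {u v : ι → ℂ}

theorem hasRep_latticePoly {q : ℂ} (hq : q ≠ 0) (c : ℂ) {X : ι → ℕ}
    (hu : ∀ i, u i = lam q c (X i)) (k : ℕ) :
    HasRep u v k (∏ l ∈ Finset.range k, (-q ^ l)) fun i => latticePoly q c (X i) k := by
  have h := HasRep.prod (u := u) (v := v) (Finset.range k) fun l _ =>
    HasRep.linear_fst (u := u) (v := v) ((1 - q ^ l) * (1 - c * q ^ (l + 1))) (-q ^ l)
  rw [Finset.card_range] at h
  exact h.congr fun i => by rw [latticePoly_eq_prod hq, hu]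

theorem hasRep_latticePoly_snd {q : ℂ} (hq : q ≠ 0) (c : ℂ) {X : ι → ℕ}
    (hv : ∀ i, v i = lam q c (X i)) (k : ℕ) :
    HasRep u v k (if k = 0 then 1 else 0) fun i => latticePoly q c (X i) k := by
  have h := HasRep.prod (u := u) (v := v) (Finset.range k) fun l _ =>
    HasRep.linear_snd (u := u) (v := v) ((1 - q ^ l) * (1 - c * q ^ (l + 1))) (-q ^ l)
  rw [Finset.card_range, Finset.prod_const, Finset.card_range, zero_pow_eq] at h
  exact h.congr fun i => by rw [latticePoly_eq_prod hq, hv]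

/-- Balancing gives q^{-(N-y)} = Gq^{N+2}·Cq^{y+1}, while Gq^{N-y+2} = Gq^{N+2}·q^{-y}. Their
product is independent of y and their sum is affine in λ(y;C). -/
theorem pair_factor {q G C : ℂ} (hq : q ≠ 0) {N y : ℕ} (hy : y ≤ N)
    (h : G * C * q ^ (2 * N + 3) = 1) (l : ℕ) :
    (1 - q ^ (-((N - y : ℕ) : ℤ)) * q ^ l) * (1 - G * q ^ (N - y + 2) * q ^ l) =
      (1 + G * q ^ (2 * l + 2) - G * q ^ (N + 2) * q ^ l * (1 + C * q)) +
        (-(G * q ^ (N + 2) * q ^ l)) * lam q C y := by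
  obtain ⟨K, rfl⟩ := Nat.exists_eq_add_of_le hy
  have e1 : y + K - y = K := by omega
  rw [e1, lam]
  have h1 := zpow_neg_mul_pow_succ hq y
  have h2 : q ^ (-(K : ℤ)) * q ^ K = 1 := by
    rw [zpow_neg, zpow_natCast, inv_mul_cancel₀ (pow_ne_zero _ hq)]
  have h3 : q ^ (-(K : ℤ)) = G * C * q ^ (2 * y + K + 3) := by
    calc q ^ (-(K : ℤ)) = q ^ (-(K : ℤ)) * (G * C * q ^ (2 * (y + K) + 3)) := by rw [h, mul_one]
      _ = (q ^ (-(K : ℤ)) * q ^ K) * (G * C * q ^ (2 * y + K + 3)) := by ring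
      _ = _ := by rw [h2, one_mul]
  have h4 : G * q ^ (y + K + 2) * q ^ (-(y : ℤ)) = G * q ^ (K + 2) := by
    calc _ = G * q ^ (K + 1) * (q ^ (-(y : ℤ)) * q ^ (y + 1)) := by ring
      _ = _ := by rw [h1]; ring
  linear_combination (G * q ^ (2 + 2 * l)) * h2 - q ^ l * h3 + q ^ l * h4 -
    (G * C * q ^ (y + K + 2) * q ^ l) * h1

variable {q α β γ C : ℂ} {N a : ℕ} {X Y : ι → ℕ}

/-- The k-th term has degree k in λ(X) and a-k in λ(Y), hence total degree a; only k = a contributes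
to λ(X)^a. -/
theorem hasRep_pairPoly (hq : q ≠ 0) (hY : ∀ i, Y i ≤ N)
    (h : α * β * γ * C * q ^ (2 * N + 3) = 1) (hu : ∀ i, u i = lam q (α * β) (X i))
    (hv : ∀ i, v i = lam q C (Y i)) (haq : qPoch q q a ≠ 0)
    (hβ : qPoch (q * β) q a ≠ 0) (hβγ : qPoch (β * γ * q ^ (a + 1)) q a ≠ 0) :
    ∃ c ≠ 0, HasRep u v a c fun i => pairPoly q α β γ (N - Y i) a (X i) := by
  set κ : ℕ → ℂ := fun k => qPoch (q ^ (-(a : ℤ))) q k * qPoch (β * γ * q ^ (a + 1)) q k * q ^ k /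
    (qPoch (q * β) q k * qPoch q q k) with hκ
  have hsum := HasRep.sum (u := u) (v := v) (Finset.range (a + 1))
    (F := fun k i => κ k * latticePoly q (α * β) (X i) k * ∏ l ∈ Finset.Ico k a,
        ((1 - q ^ (-((N - Y i : ℕ) : ℤ)) * q ^ l) * (1 - α * β * γ * q ^ (N - Y i + 2) * q ^ l)))
    (c := fun k => κ k * (∏ l ∈ Finset.range k, (-q ^ l)) * (if a - k = 0 then 1 else 0)) (by
      intro k hk
      have hk : k ≤ a := Nat.lt_succ_iff.1 (Finset.mem_range.1 hk)
      have h2 := HasRep.prod (u := u) (v := v) (Finset.Ico k a) fun l _ =>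
        HasRep.linear_snd (u := u) (v := v)
          (1 + α * β * γ * q ^ (2 * l + 2) - α * β * γ * q ^ (N + 2) * q ^ l * (1 + C * q))
          (-(α * β * γ * q ^ (N + 2) * q ^ l))
      rw [Nat.card_Ico, Finset.prod_const, Nat.card_Ico, zero_pow_eq] at h2
      have h3 := ((hasRep_latticePoly (v := v) hq (α * β) hu k).const_mul (κ k)).mul h2
      rw [Nat.add_sub_cancel' hk] at h3
      refine h3.congr fun i => ?_
      congr 1
      exact Finset.prod_congr rfl fun l _ => by rw [pair_factor hq (hY i) h l, hv])
  rw [Finset.sum_eq_single a] at hsum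
  · refine ⟨_, ?_, hsum⟩
    rw [Nat.sub_self, if_pos rfl, mul_one]
    refine mul_ne_zero (div_ne_zero (mul_ne_zero (mul_ne_zero ?_ hβγ) (pow_ne_zero _ hq))
      (mul_ne_zero hβ haq)) (Finset.prod_ne_zero_iff.2 fun l _ => neg_ne_zero.2 (pow_ne_zero _ hq))
    exact qPoch_neg_pow_ne_zero hq le_rfl haq
  · intro k hk hka
    have hk : k < a + 1 := Finset.mem_range.1 hk
    rw [if_neg (by omega), mul_zero]
  · intro hk; simp at hk

/-- The same expansion with λ(Y) as the leading variable: now only k = 0 contributes, and its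
coefficient is nonzero by balancing alone. -/
theorem hasRep_pairPoly_swap (hq : q ≠ 0) (hY : ∀ i, Y i ≤ N)
    (h : α * β * γ * C * q ^ (2 * N + 3) = 1) (hv : ∀ i, v i = lam q (α * β) (X i))
    (hu : ∀ i, u i = lam q C (Y i)) :
    ∃ c ≠ 0, HasRep u v a c fun i => pairPoly q α β γ (N - Y i) a (X i) := by
  set κ : ℕ → ℂ := fun k => qPoch (q ^ (-(a : ℤ))) q k * qPoch (β * γ * q ^ (a + 1)) q k * q ^ k /
    (qPoch (q * β) q k * qPoch q q k) with hκ
  have hsum := HasRep.sum (u := u) (v := v) (Finset.range (a + 1))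
    (F := fun k i => κ k * latticePoly q (α * β) (X i) k * ∏ l ∈ Finset.Ico k a,
        ((1 - q ^ (-((N - Y i : ℕ) : ℤ)) * q ^ l) * (1 - α * β * γ * q ^ (N - Y i + 2) * q ^ l)))
    (c := fun k => κ k * (if k = 0 then 1 else 0) *
      ∏ l ∈ Finset.Ico k a, (-(α * β * γ * q ^ (N + 2) * q ^ l))) (by
      intro k hk
      have hk : k ≤ a := Nat.lt_succ_iff.1 (Finset.mem_range.1 hk)
      have h2 := HasRep.prod (u := u) (v := v) (Finset.Ico k a) fun l _ =>
        HasRep.linear_fst (u := u) (v := v)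
          (1 + α * β * γ * q ^ (2 * l + 2) - α * β * γ * q ^ (N + 2) * q ^ l * (1 + C * q))
          (-(α * β * γ * q ^ (N + 2) * q ^ l))
      rw [Nat.card_Ico] at h2
      have h3 := ((hasRep_latticePoly_snd (u := u) hq (α * β) hv k).const_mul (κ k)).mul h2
      rw [Nat.add_sub_cancel' hk] at h3
      refine h3.congr fun i => ?_
      congr 1
      exact Finset.prod_congr rfl fun l _ => by rw [pair_factor hq (hY i) h l, hu])
  rw [Finset.sum_eq_single 0] at hsum
  · refine ⟨_, ?_, hsum⟩
    have hG : α * β * γ ≠ 0 := fun h0 => by simp [h0] at h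
    rw [if_pos rfl, mul_one]
    refine mul_ne_zero (by simp [hκ]) (Finset.prod_ne_zero_iff.2 fun l _ => neg_ne_zero.2 ?_)
    exact mul_ne_zero (mul_ne_zero hG (pow_ne_zero _ hq)) (pow_ne_zero _ hq)
  · intro k _ hk
    rw [if_neg hk, mul_zero, zero_mul]
  · intro hk; simp at hk

theorem hasRep_dualRacah (hq : q ≠ 0) {M n : ℕ} (hu : ∀ i, u i = lam q (α * β) (X i)) :
    HasRep u v (M - n)
      (dualCoeff q α β γ M n (M - n) * ∏ l ∈ Finset.range (M - n), (-q ^ l))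
      fun i => dualRacah q α β γ M n (X i) := by
  have hsum := HasRep.sum (u := u) (v := v) (d := M - n) (Finset.range (M - n + 1))
    (F := fun l i => dualCoeff q α β γ M n l * latticePoly q (α * β) (X i) l)
    (c := fun k => if k = M - n then
      dualCoeff q α β γ M n (M - n) * ∏ l ∈ Finset.range (M - n), (-q ^ l) else 0) (by
      intro k hk
      have h1 := (hasRep_latticePoly (v := v) hq (α * β) hu k).const_mul (dualCoeff q α β γ M n k)
      split_ifs with hkM
      · subst hkM; exact h1
      · exact h1.mono (by have := Finset.mem_range.1 hk; omega))
  rw [Finset.sum_ite_eq', if_pos (by simp)] at hsum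
  exact hsum

theorem hasRep_dualRacah_snd (hq : q ≠ 0) {M n : ℕ} (hv : ∀ i, v i = lam q (α * β) (X i)) :
    HasRep u v (M - n) (if M - n = 0 then 1 else 0) fun i => dualRacah q α β γ M n (X i) := by
  have hsum := HasRep.sum (u := u) (v := v) (d := M - n) (Finset.range (M - n + 1))
    (F := fun l i => dualCoeff q α β γ M n l * latticePoly q (α * β) (X i) l)
    (c := fun k => if k = M - n then (if M - n = 0 then 1 else 0) else 0) (by
      intro k hk
      have h1 := (hasRep_latticePoly_snd (u := u) hq (α * β) hv k).const_mul
        (dualCoeff q α β γ M n k)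
      split_ifs with hkM h0
      · subst hkM; rw [if_pos h0, mul_one] at h1
        have e : dualCoeff q α β γ M n (M - n) = 1 := by rw [h0, dualCoeff_zero]
        rw [e] at h1 ⊢
        exact h1
      · subst hkM; rw [if_neg h0, mul_zero] at h1; exact h1
      · exact h1.mono (by have := Finset.mem_range.1 hk; omega))
  rw [Finset.sum_ite_eq', if_pos (by simp)] at hsum
  exact hsum

end Rep

/-! ### Non-vanishing of the normalisations and leading coefficients -/

theorem Omega_ne_zero {h s₁ s₂ s₃ : ℂ} {M n : ℕ} (hn : n ≤ M) (hh : h ≠ 0) (h₂ : s₂ ≠ 0)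
    (hqq : qPoch (h ^ 2) (h ^ 2) M ≠ 0) (hq₁ : qPoch (h ^ 2 * s₁ ^ 2) (h ^ 2) M ≠ 0)
    (hq₂ : qPoch (h ^ 2 * s₂ ^ 2) (h ^ 2) M ≠ 0) (hq₃ : qPoch (h ^ 2 * s₃ ^ 2) (h ^ 2) M ≠ 0)
    (h₂₃ : ∀ k, 2 ≤ k → k ≤ 2 * M → 1 - s₂ ^ 2 * s₃ ^ 2 * (h ^ 2) ^ k ≠ 0)
    (h₁₂₃ : ∀ k, 3 ≤ k → k ≤ 2 * M + 1 → 1 - s₁ ^ 2 * s₂ ^ 2 * s₃ ^ 2 * (h ^ 2) ^ k ≠ 0) :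
    Omega h s₁ s₂ s₃ M n ≠ 0 := by
  have n1 : qPoch (s₁ ^ 2 * s₂ ^ 2 * s₃ ^ 2 * (h ^ 2) ^ (M + 2)) (h ^ 2) n ≠ 0 := by
    rcases Nat.eq_zero_or_pos n with h0 | h0
    · rw [h0]; simp
    · exact qPoch_shift_ne_zero h₁₂₃ (s := M + 2) (by omega) (by omega) rfl
  have n2 : qPochSkip (s₂ ^ 2 * s₃ ^ 2 * (h ^ 2) ^ (n + 1)) (h ^ 2) (M + 1) n ≠ 0 := by
    -- Omitting l = n removes the exponent 2n+1, so the exponents 1 (n = 0) and 2M+1 (n = M) never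
    -- occur and the rest lie between 2 and 2M.
    refine qPochSkip_ne_zero fun l hl hln => ?_
    have := h₂₃ (n + 1 + l) (by omega) (by omega)
    rwa [pow_add, ← mul_assoc] at this
  rw [Omega, qBinom, if_pos hn]
  refine div_ne_zero (mul_ne_zero (div_ne_zero hqq (mul_ne_zero ?_ ?_))
    (mul_ne_zero (mul_ne_zero ?_ n1) ?_)) (mul_ne_zero (mul_ne_zero (zpow_ne_zero _
      (mul_ne_zero hh h₂)) n2) ?_)
  · exact qPoch_ne_zero_of_le hqq hn
  · exact qPoch_ne_zero_of_le hqq (Nat.sub_le _ _)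
  · exact qPoch_ne_zero_of_le hq₂ hn
  · exact qPoch_ne_zero_of_le hq₁ (Nat.sub_le _ _)
  · exact qPoch_ne_zero_of_le hq₃ hn

namespace PairGeneric

variable {h s₀ s₁ s₂ s₃ s₄ : ℂ} {N : ℕ}

theorem q_ne (H : PairGeneric h s₀ s₁ s₂ s₃ s₄ N) : h ^ 2 ≠ 0 := pow_ne_zero _ H.h_ne

theorem Omega_ne (H : PairGeneric h s₀ s₁ s₂ s₃ s₄ N) {M n : ℕ} (hn : n ≤ M) (hM : M ≤ N) :
    Omega h s₃ s₀ s₄ M n ≠ 0 :=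
  Omega_ne_zero hn H.h_ne H.ne₀ (qPoch_ne_zero_of_le H.qq hM) (qPoch_ne_zero_of_le H.q₃ hM)
    (qPoch_ne_zero_of_le H.q₀ hM) (qPoch_ne_zero_of_le H.q₄ hM)
    (fun k h1 h2 => H.q₀₄ k h1 (by omega)) (fun k h1 h2 => H.q₃₀₄ k h1 (by omega))

theorem q₃₀₄_ne (H : PairGeneric h s₀ s₁ s₂ s₃ s₄ N) {M n : ℕ} (hn : n ≤ M) (hM : M ≤ N) :
    qPoch (s₃ ^ 2 * s₀ ^ 2 * s₄ ^ 2 * (h ^ 2) ^ (M + 2)) (h ^ 2) n ≠ 0 := by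
  rcases Nat.eq_zero_or_pos n with h0 | h0
  · rw [h0]; simp
  · exact qPoch_shift_ne_zero H.q₃₀₄ (s := M + 2) (by omega) (by omega) rfl

theorem q₄₂₁_ne (H : PairGeneric h s₀ s₁ s₂ s₃ s₄ N) {M n : ℕ} (hn : n ≤ M) (hM : M ≤ N) :
    qPoch (s₄ ^ 2 * s₂ ^ 2 * s₁ ^ 2 * (h ^ 2) ^ (M + 2)) (h ^ 2) n ≠ 0 := by
  rcases Nat.eq_zero_or_pos n with h0 | h0
  · rw [h0]; simp
  · exact qPoch_shift_ne_zero H.q₄₂₁ (s := M + 2) (by omega) (by omega) rfl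

theorem skip_ne (H : PairGeneric h s₀ s₁ s₂ s₃ s₄ N) {M a : ℕ} (ha : a ≤ M) (hM : M ≤ N) :
    qPochSkip (s₂ ^ 2 * s₁ ^ 2 * (h ^ 2) ^ (a + 1)) (h ^ 2) (M + 1) a ≠ 0 := by
  refine qPochSkip_ne_zero fun l hl hln => ?_
  have := H.q₂₁ (a + 1 + l) (by omega) (by omega)
  rwa [pow_add, ← mul_assoc] at this

theorem pairConst_ne (H : PairGeneric h s₀ s₁ s₂ s₃ s₄ N) {a : ℕ} (ha : a ≤ N) :
    pairConst h s₁ s₂ s₄ N a ≠ 0 :=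
  div_ne_zero (mul_ne_zero (mul_ne_zero (mul_ne_zero (pow_ne_zero _ (by norm_num))
    (pow_ne_zero _ H.q_ne)) (zpow_ne_zero _ (mul_ne_zero H.h_ne H.ne₂)))
    (mul_ne_zero (qPoch_ne_zero_of_le H.q₂ ha) (qPoch_ne_zero_of_le H.q₄ (Nat.sub_le _ _))))
    (mul_ne_zero (mul_ne_zero (qPoch_ne_zero_of_le H.qq ha) (qPoch_ne_zero_of_le H.q₁ ha))
      (H.skip_ne ha le_rfl))

theorem shift₄_ne (H : PairGeneric h s₀ s₁ s₂ s₃ s₄ N) {M l : ℕ} (hM : M ≤ N) (hl : l ≤ M) :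
    qPoch (s₄ ^ 2 * h ^ 2 * (h ^ 2) ^ (M - l)) (h ^ 2) l ≠ 0 := by
  have := qPoch_ne_zero_of_le H.q₄ hM
  rw [show M = M - l + l by omega, qPoch_add, mul_comm (h ^ 2) (s₄ ^ 2)] at this
  exact right_ne_zero_of_mul this

theorem shift₃_ne (H : PairGeneric h s₀ s₁ s₂ s₃ s₄ N) {M l : ℕ} (hM : M ≤ N) (hl : l ≤ M) :
    qPoch (s₃ ^ 2 * h ^ 2 * (h ^ 2) ^ (M - l)) (h ^ 2) l ≠ 0 := by
  have := qPoch_ne_zero_of_le H.q₃ hM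
  rw [show M = M - l + l by omega, qPoch_add, mul_comm (h ^ 2) (s₃ ^ 2)] at this
  exact right_ne_zero_of_mul this

theorem dualCoeff_ne (H : PairGeneric h s₀ s₁ s₂ s₃ s₄ N) {M n : ℕ} (hn : n ≤ M) (hM : M ≤ N) :
    dualCoeff (h ^ 2) (s₃ ^ 2) (s₀ ^ 2) (s₄ ^ 2) M n (M - n) ≠ 0 := by
  have hq := H.q_ne
  have h0 := pow_ne_zero 2 H.ne₀
  have h4 := pow_ne_zero 2 H.ne₄
  have hqM := qPoch_ne_zero_of_le H.qq hM
  refine div_ne_zero (mul_ne_zero (mul_ne_zero ?_ ?_) ?_) (mul_ne_zero (mul_ne_zero (mul_ne_zero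
    ?_ ?_) ?_) (mul_ne_zero ?_ ?_))
  · exact qPoch_neg_pow_ne_zero hq le_rfl (qPoch_ne_zero_of_le hqM (Nat.sub_le _ _))
  · refine qPoch_ne_zero fun l hl => ?_
    -- A zero of the l-th factor would mean s₀²s₄²q^{M+n+1-l} = 1. Since l < M-n forces n < M, this
    -- exponent lies between 2 and 2M.
    have hne := H.q₀₄ (M + n + 1 - l) (by omega) (by omega)
    intro h0'
    apply hne
    have e : (h ^ 2) ^ (-(M : ℤ)) / (s₀ ^ 2 * s₄ ^ 2 * (h ^ 2) ^ (n + 1)) * (h ^ 2) ^ l *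
        (s₀ ^ 2 * s₄ ^ 2 * (h ^ 2) ^ (M + n + 1 - l)) = 1 := by
      rw [zpow_neg, zpow_natCast]
      obtain ⟨r, hr⟩ := Nat.exists_eq_add_of_le (show l ≤ M + n + 1 by omega)
      rw [hr, Nat.add_sub_cancel_left]
      have : (h ^ 2) ^ l * (h ^ 2) ^ r = (h ^ 2) ^ M * (h ^ 2) ^ (n + 1) := by
        rw [← pow_add, ← hr]; ring
      have n1 := pow_ne_zero M hq
      have n2 := pow_ne_zero (n + 1) hq
      generalize (h ^ 2) ^ M = A at *
      generalize (h ^ 2) ^ (n + 1) = B at *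
      generalize (h ^ 2) ^ l = D at *
      generalize (h ^ 2) ^ r = E at *
      rw [div_mul_eq_mul_div, div_mul_eq_mul_div, div_eq_one_iff_eq
        (mul_ne_zero (mul_ne_zero h0 h4) n2)]
      field_simp
      linear_combination (s₀ ^ 2 * s₄ ^ 2) * this
    rw [← sub_eq_zero.1 h0', one_mul] at e
    rw [e, sub_self]
  · exact pow_ne_zero _ (mul_ne_zero (mul_ne_zero h0 h4) (pow_ne_zero _ hq))
  · exact qPoch_neg_pow_ne_zero hq (Nat.sub_le _ _) hqM
  · exact qPoch_ne_zero_of_le hqM (Nat.sub_le _ _)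
  · exact mul_ne_zero (pow_ne_zero _ (neg_ne_zero.2 h0)) (pow_ne_zero _ hq)
  · exact qPoch_ne_zero_of_le H.q₃ ((Nat.sub_le _ _).trans hM)
  · exact H.shift₄_ne hM (Nat.sub_le _ _)

/-- At x = M the duality n ↔ x gives a polynomial of top degree M, whose dual expansion has the
single term 1. The value is thus a product of nonzero factors. -/
theorem racah_last_ne (H : PairGeneric h s₀ s₁ s₂ s₃ s₄ N) {M n : ℕ} (hn : n ≤ M) (hM : M ≤ N) :
    racah h s₃ s₀ s₄ M n M ≠ 0 := by
  have hq := H.q_ne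
  have h304 := H.q₃₀₄_ne le_rfl hM
  rw [show s₃ ^ 2 * s₀ ^ 2 * s₄ ^ 2 = s₄ ^ 2 * s₀ ^ 2 * s₃ ^ 2 by ring] at h304
  rw [racah_eq_bareRacah H.h_ne _ _ _ hn le_rfl, bareRacah_duality,
    bareRacah_eq_dual hq (pow_ne_zero _ H.ne₄) (pow_ne_zero _ H.ne₀) (pow_ne_zero _ H.ne₃)
      le_rfl hn (qPoch_ne_zero_of_le H.qq hM) (qPoch_ne_zero_of_le H.q₄ hM)
      (qPoch_ne_zero_of_le H.q₀ hM) (qPoch_ne_zero_of_le H.q₃ hM) h304]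
  refine mul_ne_zero (H.Omega_ne hn hM) (mul_ne_zero (div_ne_zero (mul_ne_zero (mul_ne_zero
    (pow_ne_zero _ (neg_ne_zero.2 (pow_ne_zero _ H.ne₀))) (pow_ne_zero _ hq)) (mul_ne_zero ?_ ?_))
    (mul_ne_zero ?_ ?_)) ?_)
  · exact qPoch_ne_zero_of_le H.q₄ (hn.trans hM)
  · exact H.shift₃_ne hM hn
  · exact qPoch_ne_zero_of_le H.q₀ (hn.trans hM)
  · exact qPoch_ne_zero_of_le h304 hn
  · simp [dualRacah, dualCoeff_zero, latticePoly]

theorem xi_ne (H : PairGeneric h s₀ s₁ s₂ s₃ s₄ N) {y : ℕ} (hy : y ≤ N) : xi h s₃ s₀ y ≠ 0 :=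
  mul_ne_zero (div_ne_zero (qPoch_ne_zero_of_le H.q₃ hy) (qPoch_ne_zero_of_le H.q₀ hy))
    (pow_ne_zero _ (div_ne_zero H.ne₀ H.ne₃))

/-- The normalisation of the top product `p_N(y; N) p_0(x; N - y)`. -/
theorem pairConst_mul_Omega (H : PairGeneric h s₀ s₁ s₂ s₃ s₄ N) :
    pairConst h s₁ s₂ s₄ N 0 * Omega h s₃ s₀ s₄ N N =
      (-1) ^ N * (s₃ / s₁) ^ N * xi h s₀ (s₀ * s₄ * h ^ N) N := by
  have hq := H.q_ne
  have hh := H.h_ne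
  have h0 := H.ne₀
  have h1 := H.ne₁
  have h2 := H.ne₂
  have h3 := H.ne₃
  have h4 := H.ne₄
  have hbal := H.balance
  -- Balancing turns the denominator symbol in s₂s₁ into the numerator symbol of `Omega`, and the
  -- two cancel up to a monomial.
  have hrev := qPoch_reverse (x := s₃ ^ 2 * s₀ ^ 2 * s₄ ^ 2 * (h ^ 2) ^ (N + 2))
    (z := s₂ ^ 2 * s₁ ^ 2 * (h ^ 2) ^ 2) (m := N) (q := h ^ 2)
    (by
      calc _ = (h ^ (2 * N + 3) * (s₀ * s₁ * s₂ * s₃ * s₄)) ^ 2 * h ^ 2 := by ring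
        _ = h ^ 2 := by rw [hbal]; ring) hq
  have hskip1 : qPochSkip (s₂ ^ 2 * s₁ ^ 2 * (h ^ 2) ^ (0 + 1)) (h ^ 2) (N + 1) 0 =
      qPoch (s₂ ^ 2 * s₁ ^ 2 * (h ^ 2) ^ 2) (h ^ 2) N := by
    rw [add_comm N 1, qPochSkip_add _ _ one_pos]
    simp only [qPochSkip, Finset.range_one, Finset.erase_singleton, Finset.prod_empty, one_mul]
    congr 1; ring
  have hskip2 : qPochSkip (s₀ ^ 2 * s₄ ^ 2 * (h ^ 2) ^ (N + 1)) (h ^ 2) (N + 1) N =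
      qPoch (h ^ 2 * (s₀ * s₄ * h ^ N) ^ 2) (h ^ 2) N := by
    rw [qPochSkip, Finset.range_add_one, Finset.erase_insert (by simp), qPoch]
    exact Finset.prod_congr rfl fun l _ => by ring
  have n1 : qPoch (s₂ ^ 2 * s₁ ^ 2 * (h ^ 2) ^ 2) (h ^ 2) N ≠ 0 := by
    have := H.skip_ne (Nat.zero_le N) le_rfl
    rwa [hskip1] at this
  have n2 := H.q₄
  have n3 := H.qq
  have e1 : (h * s₀) ^ (2 * (N : ℤ) - (N : ℤ)) = (h * s₀) ^ N := by
    rw [← zpow_natCast]; congr 1; ring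
  have e2 : (h * s₂) ^ ((N : ℤ) - 2 * ((0 : ℕ) : ℤ)) = (h * s₂) ^ N := by
    rw [← zpow_natCast]; simp
  rw [pairConst, Omega, hskip1, hskip2, e1, e2, ← hrev, xi, qBinom, if_pos le_rfl]
  simp only [Nat.sub_self, Nat.sub_zero, qPoch_zero, pow_zero, zero_mul, Nat.choose_zero_succ,
    add_zero, mul_one, one_mul]
  have hC : (h ^ 2) ^ N.choose 2 * h ^ N = h ^ (N * N) := by
    have h2 : 2 * N.choose 2 + N = N * N := by
      rw [Nat.choose_two_right, Nat.mul_div_cancel' (Nat.even_mul_pred_self N).two_dvd]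
      rcases N with _ | N
      · rfl
      · simp; ring
    rw [← h2]; ring
  have key : (h * s₂) ^ N * (-(s₃ ^ 2 * s₀ ^ 2 * s₄ ^ 2 * (h ^ 2) ^ (N + 2))) ^ N *
      (h ^ 2) ^ N.choose 2 = (-1) ^ N * (s₃ / s₁) ^ N * (s₀ * s₄ * h ^ N / s₀) ^ N *
        (h * s₀) ^ N := by
    have hb : h * s₂ * (s₃ ^ 2 * s₀ ^ 2 * s₄ ^ 2 * (h ^ 2) ^ (N + 2)) * h ^ N =
        s₃ / s₁ * (s₀ * s₄ * h ^ N / s₀) * (h * s₀) * h := by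
      rw [show s₃ / s₁ * (s₀ * s₄ * h ^ N / s₀) * (h * s₀) * h =
        (s₃ * s₀ * s₄ * h ^ (N + 2)) / s₁ by field_simp; ring, eq_div_iff h1]
      linear_combination (s₃ * s₀ * s₄ * h ^ (N + 2)) * hbal
    apply mul_right_cancel₀ (pow_ne_zero N hh)
    calc _ = (h * s₂) ^ N * (-(s₃ ^ 2 * s₀ ^ 2 * s₄ ^ 2 * (h ^ 2) ^ (N + 2))) ^ N *
          ((h ^ 2) ^ N.choose 2 * h ^ N) := by ring
      _ = (-1) ^ N *
          (h * s₂ * (s₃ ^ 2 * s₀ ^ 2 * s₄ ^ 2 * (h ^ 2) ^ (N + 2)) * h ^ N) ^ N := by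
          rw [hC, neg_pow]; ring
      _ = _ := by rw [hb]; ring
  have n4 : (h * s₀) ^ N ≠ 0 := pow_ne_zero _ (mul_ne_zero hh h0)
  have n5 : qPoch (h ^ 2 * (s₀ * s₄ * h ^ N) ^ 2) (h ^ 2) N ≠ 0 := by
    have := H.Omega_ne (le_refl N) le_rfl
    intro h0
    rw [Omega, hskip2, h0] at this
    simp at this
  generalize (-(s₃ ^ 2 * s₀ ^ 2 * s₄ ^ 2 * (h ^ 2) ^ (N + 2))) ^ N = A at *
  generalize qPoch (h ^ 2 * (s₀ * s₄ * h ^ N) ^ 2) (h ^ 2) N = B at *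
  generalize qPoch (s₂ ^ 2 * s₁ ^ 2 * (h ^ 2) ^ 2) (h ^ 2) N = D at *
  generalize (s₃ / s₁) ^ N = A1 at *
  generalize (s₀ * s₄ * h ^ N / s₀) ^ N = A2 at *
  generalize (h * s₀) ^ N = A3 at *
  generalize (h * s₂) ^ N = A4 at *
  generalize (h ^ 2) ^ N.choose 2 = A5 at *
  generalize qPoch (h ^ 2) (h ^ 2) N = Q at *
  generalize qPoch (h ^ 2 * s₄ ^ 2) (h ^ 2) N = R at *
  field_simp
  linear_combination qPoch (h ^ 2 * s₀ ^ 2) (h ^ 2) N * key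

end PairGeneric

end

end QRacah

namespace QRacah

noncomputable section

/-! ### A very-well-poised weight and its moments -/

/-- The very-well-poised weight on `0 ≤ a ≤ K`. -/
def wpWeight (q c d : ℂ) (K a : ℕ) : ℂ :=
  (-1) ^ a * q ^ a.choose 2 * qBinom q K a *
    (qPoch (d * c * q ^ (K + 2)) q a * qPoch (q * d) q (K - a)) /
      qPochSkip (c * q ^ (a + 1)) q (K + 1) a

/-- Moments of `wpWeight` with respect to `λ(a;c)^s (q^{-a};q)_m (c q^{a+1};q)_m`. -/
def wpMoment (q c d : ℂ) (K s m : ℕ) : ℂ :=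
  ∑ a ∈ Finset.range (K + 1), wpWeight q c d K a * lam q c a ^ s * latticePoly q c a m

/-- Partial sums in the telescoping evaluation of the moments. -/
def wpPartial (q c d : ℂ) (K r a : ℕ) : ℂ :=
  (-1) ^ a * q ^ a.choose 2 * q ^ a / q ^ K *
    (qPoch q q K / (qPoch q q a * qPoch q q (K - (a + 1)))) *
    (qPoch (d * c * q ^ (K + 2)) q (a + 1) * qPoch (q * d) q (K - a)) /
    qPoch (c * q ^ (a + 2)) q K * (qPoch (q ^ (-(a : ℤ))) q r * qPoch (c * q ^ (a + 2)) q r)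

/-- The summand in the telescoping evaluation of the moments. -/
def wpBracket (q c d : ℂ) (K r a : ℕ) : ℂ :=
  wpWeight q c d K a * (latticePoly q c a (r + 1) * (q * d) -
    (1 - q ^ (-(K : ℤ)) * q ^ r) * (1 - d * c * q ^ (K + 2) * q ^ r) * latticePoly q c a r)

theorem latticePoly_succ (q c : ℂ) (x k : ℕ) :
    latticePoly q c x (k + 1) = latticePoly q c x k *
      ((1 - q ^ (-(x : ℤ)) * q ^ k) * (1 - c * q ^ (x + 1) * q ^ k)) := by
  rw [latticePoly, latticePoly, qPoch_succ, qPoch_succ]; ring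

theorem qPoch_zero_shift_one {q : ℂ} {r : ℕ} (hr : r ≠ 0) :
    qPoch (q ^ (-((0 : ℕ) : ℤ))) q r = 0 :=
  Finset.prod_eq_zero (i := 0) (by simp; omega) (by simp)

theorem qPochSkip_zero (a q : ℂ) (m : ℕ) : qPochSkip a q (m + 1) 0 = qPoch (a * q) q m := by
  rw [add_comm, qPochSkip_add _ _ one_pos]
  simp [qPochSkip]

theorem qPochSkip_last (a q : ℂ) (m : ℕ) : qPochSkip a q (m + 1) m = qPoch a q m := by
  rw [qPochSkip, Finset.range_add_one, Finset.erase_insert (by simp), qPoch]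

theorem qPoch_eq_mul_skip (a q : ℂ) {m n : ℕ} (hn : n < m) :
    qPoch a q m = (1 - a * q ^ n) * qPochSkip a q m n :=
  (Finset.mul_prod_erase (Finset.range m) (fun l => 1 - a * q ^ l) (Finset.mem_range.2 hn)).symm

theorem wpBracket_zero {q c d : ℂ} (hq : q ≠ 0) {K r : ℕ} (hK : qPoch q q (K + 1) ≠ 0) :
    wpBracket q c d (K + 1) r 0 = wpPartial q c d (K + 1) r 0 := by
  rcases Nat.eq_zero_or_pos r with rfl | hr
  · have e : qPoch q q (K + 1) = qPoch q q K * (1 - q * q ^ K) := qPoch_succ _ _ _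
    have hKK := qPoch_ne_zero_of_le hK (Nat.le_succ K)
    rw [wpBracket, wpWeight, wpPartial, qPochSkip_zero, latticePoly_succ, qBinom]
    simp only [zero_le, if_true, Nat.sub_zero, Nat.choose_zero_succ, pow_zero, qPoch_zero,
      one_mul, div_self hK, zero_add, Nat.add_sub_cancel, latticePoly, mul_one]
    rw [qPoch_succ (d * c * q ^ (K + 1 + 2)), qPoch_zero, e, mul_div_assoc,
      show c * q ^ 1 * q = c * q ^ 2 by ring]
    simp only [Nat.cast_zero, neg_zero, zpow_zero, sub_self, zero_mul, zero_sub, pow_zero, mul_one,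
      one_mul]
    rw [zpow_neg, zpow_natCast]
    generalize qPoch (c * q ^ 2) q (K + 1) = X
    generalize qPoch (q * d) q (K + 1) = Y
    field_simp
    ring
  · rw [wpBracket, wpPartial, latticePoly, latticePoly, qPoch_zero_shift_one hr.ne',
      qPoch_zero_shift_one (by omega)]
    simp

theorem qPoch_neg_shift (q : ℂ) (hq : q ≠ 0) (n r : ℕ) :
    (1 - q ^ (-((n + 1 : ℕ) : ℤ))) * qPoch (q ^ (-(n : ℤ))) q r =
      qPoch (q ^ (-((n + 1 : ℕ) : ℤ))) q r * (1 - q ^ (-((n + 1 : ℕ) : ℤ)) * q ^ r) := by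
  rw [← qPoch_succ, qPoch_succ']
  congr 2
  rw [← zpow_add_one₀ hq]; congr 1; push_cast; ring

/-- Writes the partial sum at n with the factors of the weight at n+1. Together with `wpPartial_eq`,
which does this at equal index, it reduces the telescoping step to a rational identity. -/
theorem wpPartial_eq_pred {q c d : ℂ} (hq : q ≠ 0) {n s : ℕ} (r : ℕ)
    (hK : qPoch q q (n + 1 + s) ≠ 0) :
    wpPartial q c d (n + 1 + s) r n =
      (-1) ^ (n + 1) * q ^ (n + 1).choose 2 * qBinom q (n + 1 + s) (n + 1) *
        (qPoch (d * c * q ^ (n + 1 + s + 2)) q (n + 1) * qPoch (q * d) q s) / q ^ s *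
        ((1 - d * q * q ^ s) * (1 - q ^ (-((n + 1 : ℕ) : ℤ)) * q ^ r)) *
        latticePoly q c (n + 1) r / qPoch (c * q ^ (n + 2)) q (n + 1 + s) := by
  have e1 : n + 1 + s - (n + 1) = s := by omega
  have e2 : n + 1 + s - n = s + 1 := by omega
  have e3 : (n + 1).choose 2 = n.choose 2 + n := by
    rw [Nat.choose_succ_succ' n]; simp; ring
  have e4 : qPoch q q (n + 1) = qPoch q q n * (1 - q * q ^ n) := qPoch_succ _ _ _
  have e5 : qPoch (q * d) q (s + 1) = qPoch (q * d) q s * (1 - q * d * q ^ s) := qPoch_succ _ _ _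
  have h := qPoch_neg_shift q hq n r
  have n1 : qPoch q q n ≠ 0 := qPoch_ne_zero_of_le hK (by omega)
  have n2 : 1 - q * q ^ n ≠ 0 := factor_ne_zero_of_qPoch hK (by omega)
  have e6 : q ^ (-((n + 1 : ℕ) : ℤ)) * (q * q ^ n) = 1 := by
    rw [zpow_neg, zpow_natCast, pow_succ']; exact inv_mul_cancel₀ (by positivity)
  rw [wpPartial, qBinom, if_pos (by omega), e1, e2, e3, e4, e5, latticePoly,
    show n + 1 + 1 = n + 2 by ring]
  have h' : qPoch (q ^ (-((n + 1 : ℕ) : ℤ))) q r * (1 - q ^ (-((n + 1 : ℕ) : ℤ)) * q ^ r) *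
      (q * q ^ n) = - (1 - q * q ^ n) * qPoch (q ^ (-(n : ℤ))) q r := by
    rw [← h]; linear_combination (-qPoch (q ^ (-(n : ℤ))) q r) * e6
  generalize qPoch (q ^ (-((n + 1 : ℕ) : ℤ))) q r = A at *
  generalize q ^ (-((n + 1 : ℕ) : ℤ)) = z at *
  generalize qPoch (q ^ (-(n : ℤ))) q r = A' at *
  generalize qPoch (c * q ^ (n + 2)) q (n + 1 + s) = D
  generalize qPoch (c * q ^ (n + 2)) q r = D'
  generalize qPoch (d * c * q ^ (n + 1 + s + 2)) q (n + 1) = B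
  generalize qPoch (q * d) q s = E
  generalize qPoch q q (n + 1 + s) = Q
  generalize qPoch q q n = Q1 at *
  generalize qPoch q q s = Q2
  rw [pow_succ (-1 : ℂ) n, pow_add q _ n, show q ^ (n + 1 + s) = q * q ^ n * q ^ s by ring]
  have n3 := pow_ne_zero n hq
  have n4 := pow_ne_zero s hq
  have hA : A' = -(A * (1 - z * q ^ r) * (q * q ^ n)) / (1 - q * q ^ n) := by
    rw [eq_div_iff n2]; linear_combination h'
  rw [hA]
  generalize 1 - q * q ^ n = S
  have n5 : q * q ^ n ≠ 0 := mul_ne_zero hq n3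
  calc _ = ((q * q ^ n) / (q * q ^ n)) * ((-1) ^ n * -1 * (q ^ n.choose 2 * q ^ n) *
        (Q / (Q1 * S * Q2)) * (B * E) / q ^ s *
          ((1 - d * q * q ^ s) * (1 - z * q ^ r)) * (A * D') / D) := by ring
    _ = _ := by rw [div_self n5, one_mul]

theorem wpPartial_eq {q c d : ℂ} {a s : ℕ} (r : ℕ) (hK : qPoch q q (a + (s + 1)) ≠ 0)
    (hc : 1 - c * q ^ (a + 1) ≠ 0) :
    wpPartial q c d (a + (s + 1)) r a =
      (-1) ^ a * q ^ a.choose 2 * qBinom q (a + (s + 1)) a *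
        (qPoch (d * c * q ^ (a + (s + 1) + 2)) q a * qPoch (q * d) q (s + 1)) *
        (q ^ a / q ^ (a + (s + 1))) *
        ((1 - q * q ^ s) * (1 - d * c * q ^ (a + (s + 1) + 2) * q ^ a) *
          (1 - c * q ^ (a + 1) * q ^ r)) *
        latticePoly q c a r / qPoch (c * q ^ (a + 1)) q (a + (s + 1) + 1) := by
  have e1 : a + (s + 1) - (a + 1) = s := by omega
  have e2 : a + (s + 1) - a = s + 1 := by omega
  have e4 : qPoch q q (s + 1) = qPoch q q s * (1 - q * q ^ s) := qPoch_succ _ _ _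
  have n2 : 1 - q * q ^ s ≠ 0 := factor_ne_zero_of_qPoch hK (by omega)
  have e5 : (1 - c * q ^ (a + 1)) * qPoch (c * q ^ (a + 2)) q r =
      qPoch (c * q ^ (a + 1)) q r * (1 - c * q ^ (a + 1) * q ^ r) := by
    rw [← qPoch_succ, qPoch_succ']; congr 2; ring
  have e6 : qPoch (c * q ^ (a + 1)) q (a + (s + 1) + 1) =
      (1 - c * q ^ (a + 1)) * qPoch (c * q ^ (a + 2)) q (a + (s + 1)) := by
    rw [qPoch_succ']; congr 2; ring
  have e7 : qPoch (c * q ^ (a + 2)) q r =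
      qPoch (c * q ^ (a + 1)) q r * (1 - c * q ^ (a + 1) * q ^ r) / (1 - c * q ^ (a + 1)) := by
    rw [eq_div_iff hc, ← e5]; ring
  rw [wpPartial, qBinom, if_pos (by omega), e1, e2, e4, e6, e7, latticePoly, qPoch_succ _ q a]
  generalize 1 - c * q ^ (a + 1) = C at *
  generalize 1 - q * q ^ s = S at *
  generalize qPoch (c * q ^ (a + 2)) q (a + (s + 1)) = D
  generalize qPoch (d * c * q ^ (a + (s + 1) + 2)) q a = B
  generalize qPoch q q (a + (s + 1)) = Q
  generalize qPoch q q a = Q1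
  generalize qPoch q q s = Q2
  calc _ = (S / S) * (1 / C) * ((-1) ^ a * q ^ a.choose 2 * (Q / (Q1 * Q2)) * B *
      qPoch (q * d) q (s + 1) * (q ^ a / q ^ (a + (s + 1))) *
      (1 - d * c * q ^ (a + (s + 1) + 2) * q ^ a) * (qPoch (q ^ (-(a : ℤ))) q r *
      (qPoch (c * q ^ (a + 1)) q r * (1 - c * q ^ (a + 1) * q ^ r))) / D) := by
        rw [div_self n2]; ring
    _ = _ := by ring

theorem wpPartial_succ {q c d : ℂ} (hq : q ≠ 0) {n s : ℕ} (r : ℕ)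
    (hK : qPoch q q (n + 1 + (s + 1)) ≠ 0)
    (hc : ∀ k, 2 ≤ k → k ≤ 2 * (n + 1 + (s + 1)) → 1 - c * q ^ k ≠ 0) :
    wpPartial q c d (n + 1 + (s + 1)) r n + wpBracket q c d (n + 1 + (s + 1)) r (n + 1) =
      wpPartial q c d (n + 1 + (s + 1)) r (n + 1) := by
  rw [wpPartial_eq_pred hq r hK, wpPartial_eq r hK (hc _ (by omega) (by omega)), wpBracket,
    wpWeight, latticePoly_succ, show n + 1 + 1 = n + 2 by ring,
    show n + 1 + (s + 1) - (n + 1) = s + 1 by omega]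
  set K := n + 1 + (s + 1) with hKdef
  have h1 : qPoch (c * q ^ (n + 2)) q (K + 1) =
      qPoch (c * q ^ (n + 2)) q K * (1 - c * q ^ (n + 2) * q ^ K) := qPoch_succ _ _ _
  have h2 : qPoch (c * q ^ (n + 2)) q (K + 1) =
      (1 - c * q ^ (n + 2) * q ^ (n + 1)) * qPochSkip (c * q ^ (n + 2)) q (K + 1) (n + 1) :=
    qPoch_eq_mul_skip _ _ (by omega)
  have n1 : 1 - c * q ^ (n + 2) * q ^ K ≠ 0 := by
    rw [mul_assoc, ← pow_add]; exact hc _ (by omega) (by omega)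
  have n2 : 1 - c * q ^ (n + 2) * q ^ (n + 1) ≠ 0 := by
    rw [mul_assoc, ← pow_add]; exact hc _ (by omega) (by omega)
  have h3 : 1 / qPoch (c * q ^ (n + 2)) q K =
      (1 - c * q ^ (n + 2) * q ^ K) / qPoch (c * q ^ (n + 2)) q (K + 1) := by
    rw [h1, mul_comm (qPoch _ _ _) (1 - _), ← div_div, div_self n1]
  have h4 : 1 / qPochSkip (c * q ^ (n + 2)) q (K + 1) (n + 1) =
      (1 - c * q ^ (n + 2) * q ^ (n + 1)) / qPoch (c * q ^ (n + 2)) q (K + 1) := by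
    rw [h2, ← div_div, div_self n2]
  rw [div_eq_mul_one_div _ (qPoch (c * q ^ (n + 2)) q K), h3,
    div_eq_mul_one_div _ (qPochSkip _ _ _ _), h4]
  -- The telescoping identity after removal of all common Pochhammer factors, a rational identity in
  -- q^{n+1}, q^{s+1}, q^r.
  have hz : (1 - d * q * q ^ (s + 1)) / q ^ (s + 1) *
        (1 - q ^ (-((n + 1 : ℕ) : ℤ)) * q ^ r) * (1 - c * q ^ (n + 2) * q ^ K) +
      (1 - c * q ^ (n + 2) * q ^ (n + 1)) *
      ((1 - q ^ (-((n + 1 : ℕ) : ℤ)) * q ^ r) * (1 - c * q ^ (n + 2) * q ^ r) * (q * d) -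
        (1 - q ^ (-(K : ℤ)) * q ^ r) * (1 - d * c * q ^ (K + 2) * q ^ r)) =
      (q ^ (n + 1) / q ^ K) * ((1 - q * q ^ s) * (1 - d * c * q ^ (K + 2) * q ^ (n + 1)) *
          (1 - c * q ^ (n + 2) * q ^ r)) := by
    rw [zpow_neg, zpow_neg, zpow_natCast, zpow_natCast, hKdef,
      show q ^ (n + 1 + (s + 1)) = q ^ (n + 1) * q ^ (s + 1) by ring,
      show q ^ (n + 1 + (s + 1) + 2) = q ^ (n + 1) * q ^ (s + 1) * q ^ 2 by ring,
      show q ^ (n + 2) = q * q ^ (n + 1) by ring, show q * q ^ s = q ^ (s + 1) by ring]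
    have m1 := pow_ne_zero (n + 1) hq
    have m2 := pow_ne_zero (s + 1) hq
    generalize q ^ (n + 1) = z at *
    generalize q ^ (s + 1) = w at *
    generalize q ^ r = v at *
    field_simp
    ring
  linear_combination ((-1) ^ (n + 1) * q ^ (n + 1).choose 2 * qBinom q K (n + 1) *
    (qPoch (d * c * q ^ (K + 2)) q (n + 1) * qPoch (q * d) q (s + 1)) * latticePoly q c (n + 1) r /
    qPoch (c * q ^ (n + 2)) q (K + 1)) * hz

/-- The closing step is separate: at the last index the truncated K-(a+1) would make `wpPartial`
wrong, whereas the true full sum is zero. -/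
theorem wpPartial_last {q c d : ℂ} (hq : q ≠ 0) {n : ℕ} (r : ℕ) (hK : qPoch q q (n + 1) ≠ 0) :
    wpPartial q c d (n + 1) r n + wpBracket q c d (n + 1) r (n + 1) = 0 := by
  have h0 := wpPartial_eq_pred (q := q) (c := c) (d := d) hq (n := n) (s := 0) r hK
  simp only [add_zero] at h0
  rw [h0, wpBracket, wpWeight, latticePoly_succ, qPochSkip_last, Nat.sub_self,
    show n + 1 + 1 = n + 2 by ring]
  have e : q ^ (n + 1 + 2) = q ^ (n + 2) * q := by ring
  rw [e]
  ring

theorem sum_wpBracket {q c d : ℂ} (hq : q ≠ 0) {K : ℕ} (r : ℕ) (hK : qPoch q q K ≠ 0)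
    (hc : ∀ k, 2 ≤ k → k ≤ 2 * K → 1 - c * q ^ k ≠ 0) :
    ∑ a ∈ Finset.range (K + 1), wpBracket q c d K r a = 0 := by
  rcases K with _ | K
  · rw [zero_add, Finset.sum_range_one, wpBracket]
    rcases Nat.eq_zero_or_pos r with rfl | hr
    · simp [latticePoly, qPoch_succ]
    · rw [latticePoly, latticePoly, qPoch_zero_shift_one hr.ne', qPoch_zero_shift_one (by omega)]
      simp
  · have key : ∀ n ≤ K, ∑ a ∈ Finset.range (n + 1), wpBracket q c d (K + 1) r a =
        wpPartial q c d (K + 1) r n := by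
      intro n
      induction n with
      | zero => intro _; rw [zero_add, Finset.sum_range_one, wpBracket_zero hq hK]
      | succ n ih =>
        intro hn
        obtain ⟨s, rfl⟩ := Nat.exists_eq_add_of_le hn
        rw [Finset.sum_range_succ, ih (by omega)]
        exact wpPartial_succ hq r hK hc
    rw [Finset.sum_range_succ, key K le_rfl, wpPartial_last hq r hK]

/-- The telescoping sum of `wpBracket`, read as a first-order recurrence in the index r. -/
theorem wpMoment_succ {q c d : ℂ} (hq : q ≠ 0) {K : ℕ} (r : ℕ) (hK : qPoch q q K ≠ 0)
    (hc : ∀ k, 2 ≤ k → k ≤ 2 * K → 1 - c * q ^ k ≠ 0) :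
    wpMoment q c d K 0 (r + 1) * (q * d) =
      (1 - q ^ (-(K : ℤ)) * q ^ r) * (1 - d * c * q ^ (K + 2) * q ^ r) *
        wpMoment q c d K 0 r := by
  have h := sum_wpBracket (d := d) hq r hK hc
  rw [← sub_eq_zero, ← h, wpMoment, wpMoment, Finset.sum_mul, Finset.mul_sum,
    ← Finset.sum_sub_distrib]
  refine Finset.sum_congr rfl fun a _ => ?_
  rw [wpBracket]; ring

theorem wpMoment_eq {q c d : ℂ} (hq : q ≠ 0) {K : ℕ} (hK : qPoch q q K ≠ 0)
    (hc : ∀ k, 2 ≤ k → k ≤ 2 * K → 1 - c * q ^ k ≠ 0) (r : ℕ) :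
    wpMoment q c d K 0 r * (q * d) ^ r =
      qPoch (q ^ (-(K : ℤ))) q r * qPoch (d * c * q ^ (K + 2)) q r * wpMoment q c d K 0 0 := by
  induction r with
  | zero => simp
  | succ r ih =>
    have h := wpMoment_succ (d := d) hq r hK hc
    rw [qPoch_succ, qPoch_succ, pow_succ]
    linear_combination (q * d) ^ r * h +
      (1 - q ^ (-(K : ℤ)) * q ^ r) * (1 - d * c * q ^ (K + 2) * q ^ r) * ih

/-- Evaluated from the other end: (q^{-a};q)_K vanishes for a < K, so the K-th moment is the single
term a = K, and the product formula of `wpMoment_eq` is solved for the zeroth moment. -/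
theorem wpMoment_zero {q c d : ℂ} (hq : q ≠ 0) {K : ℕ} (hK : qPoch q q K ≠ 0)
    (hc : ∀ k, 2 ≤ k → k ≤ 2 * K → 1 - c * q ^ k ≠ 0)
    (hB : qPoch (d * c * q ^ (K + 2)) q K ≠ 0) :
    wpMoment q c d K 0 0 = (-1) ^ K * (q * d) ^ K * q ^ K.choose 2 := by
  have h := wpMoment_eq (d := d) hq hK hc K
  have htop : wpMoment q c d K 0 K = wpWeight q c d K K * latticePoly q c K K := by
    rw [wpMoment, Finset.sum_eq_single K]
    · simp
    · intro a ha haK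
      have := Finset.mem_range.1 ha
      rw [latticePoly_eq_zero hq _ (by omega), mul_zero]
    · simp
  have n1 : qPoch (c * q ^ (K + 1)) q K ≠ 0 := by
    rcases Nat.eq_zero_or_pos K with h0 | h0
    · rw [h0]; simp
    · exact qPoch_shift_ne_zero hc (s := K + 1) (by omega) (by omega) rfl
  have n2 := qPoch_neg_pow_ne_zero hq (le_refl K) hK
  rw [htop, wpWeight, qPochSkip_last, Nat.sub_self, qPoch_zero, qBinom, if_pos le_rfl,
    Nat.sub_self, qPoch_zero, latticePoly] at h
  apply mul_left_cancel₀ (mul_ne_zero n2 hB)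
  rw [← h]
  field_simp

/-- Multiplication by λ(a;c) is bidiagonal on the lattice polynomials: it maps the m-th one to a
combination of the m-th and the (m+1)-st. -/
theorem wpMoment_succ_left {q c d : ℂ} (hq : q ≠ 0) (K s m : ℕ) :
    wpMoment q c d K (s + 1) m =
      (q ^ (-(m : ℤ)) + c * q * q ^ m - 1 - c * q) * wpMoment q c d K s m -
        q ^ (-(m : ℤ)) * wpMoment q c d K s (m + 1) := by
  rw [wpMoment, wpMoment, wpMoment, Finset.mul_sum, Finset.mul_sum, ← Finset.sum_sub_distrib]
  refine Finset.sum_congr rfl fun a _ => ?_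
  have h1 : q ^ (-(m : ℤ)) * q ^ m = 1 := by
    rw [zpow_neg, zpow_natCast, inv_mul_cancel₀ (pow_ne_zero _ hq)]
  have h2 := zpow_neg_mul_pow_succ hq a
  rw [latticePoly_succ, pow_succ, lam]
  linear_combination (wpWeight q c d K a *
    (-(1 - q ^ (-(a : ℤ))) * (1 - c * q ^ (a + 1))) ^ s * latticePoly q c a m) *
      ((-(q ^ (-(a : ℤ))) - c * q ^ (a + 1) + c * q * q ^ m) * h1 +
        (c * q ^ m * q ^ m * q ^ (-(m : ℤ)) - c) * h2)

end

end QRacah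

namespace QRacah

noncomputable section

/-! ### Higher moments as polynomial multiples of the zeroth ones -/

section Moments

variable {κ : Type*}

/-- The shift m → m+1 scales q^{-m} by q^{-1}. In the difference the terms free of q^{-m} cancel, so
it is divisible by q^{-m}, and multiplication by q^m keeps it polynomial while lowering its degree.
-/
theorem hasRep_shift {q : ℂ} (hq : q ≠ 0) {v : κ → ℂ} {d : ℕ} {a : ℂ} {f : ℕ × κ → ℂ}
    (hf : HasRep (fun p : ℕ × κ => q ^ (-(p.1 : ℤ))) (fun p => v p.2) d a f) :
    HasRep (fun p : ℕ × κ => q ^ (-(p.1 : ℤ))) (fun p => v p.2) d (a * (q ^ d)⁻¹)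
        (fun p => f (p.1 + 1, p.2)) ∧
      HasRep (fun p : ℕ × κ => q ^ (-(p.1 : ℤ))) (fun p => v p.2) d 0
        (fun p => (f p - f (p.1 + 1, p.2)) * q ^ p.1) := by
  obtain ⟨c, hc0, hc, hfc⟩ := hf.exists_coeff
  have hs : ∀ m : ℕ, q ^ (-((m + 1 : ℕ) : ℤ)) = q⁻¹ * q ^ (-(m : ℤ)) := fun m => by
    rw [← zpow_neg_one, ← zpow_add₀ hq]; congr 1; push_cast; ring
  constructor
  · have h := HasRep.sum_monomials (d := d) (u' := fun p : ℕ × κ => q ^ (-(p.1 : ℤ)))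
      (v' := fun p => v p.2)
      (F := fun i j p => (q ^ i)⁻¹ * ((q ^ (-(p.1 : ℤ))) ^ i * v p.2 ^ j))
      (γ := fun d => (q ^ d)⁻¹) hc (by
        intro i j hij
        have := (HasRep.pow_mul_pow (u := fun p : ℕ × κ => q ^ (-(p.1 : ℤ)))
          (v := fun p => v p.2) i j hij).const_mul ((q ^ i)⁻¹)
        convert this using 1
        split_ifs with h
        · rw [h, mul_one]
        · rw [mul_zero])
    rw [hc0] at h
    refine h.congr fun p => ?_
    rw [hfc]
    refine Finset.sum_congr rfl fun i _ => Finset.sum_congr rfl fun j _ => ?_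
    rw [hs, mul_pow, inv_pow]; ring
  · have h := HasRep.sum_monomials (d := d) (u' := fun p : ℕ × κ => q ^ (-(p.1 : ℤ)))
      (v' := fun p => v p.2)
      (F := fun i j p => (1 - (q ^ i)⁻¹) * ((q ^ (-(p.1 : ℤ))) ^ i * v p.2 ^ j) * q ^ p.1)
      (γ := fun _ => 0) hc (by
        intro i j hij
        rw [ite_self]
        rcases i with _ | i
        · have := HasRep.pow_mul_pow (u := fun p : ℕ × κ => q ^ (-(p.1 : ℤ)))
            (v := fun p => v p.2) 0 0 (Nat.zero_le d)
          have := this.const_mul 0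
          rw [zero_mul] at this
          exact this.congr fun p => by simp
        · have := (HasRep.pow_mul_pow (u := fun p : ℕ × κ => q ^ (-(p.1 : ℤ)))
            (v := fun p => v p.2) (d := i + j) i j le_rfl).const_mul (1 - (q ^ (i + 1))⁻¹)
          refine (this.mono (by omega)).congr fun p => ?_
          have h1 : q ^ (-(p.1 : ℤ)) * q ^ p.1 = 1 := by
            rw [zpow_neg, zpow_natCast, inv_mul_cancel₀ (pow_ne_zero _ hq)]
          rw [pow_succ]
          linear_combination ((1 - (q ^ i * q)⁻¹) * (q ^ (-(p.1 : ℤ))) ^ i * v p.2 ^ j) * h1)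
    rw [mul_zero] at h
    refine h.congr fun p => ?_
    rw [hfc, hfc, ← Finset.sum_sub_distrib, Finset.sum_mul]
    refine Finset.sum_congr rfl fun i _ => ?_
    rw [← Finset.sum_sub_distrib, Finset.sum_mul]
    refine Finset.sum_congr rfl fun j _ => ?_
    rw [hs, mul_pow, inv_pow]; ring

/-- Induction on s through `wpMoment_succ_left`, the (m+1)-st symbols being expanded by
`pair_factor`. The positive powers q^m that appear are not polynomial in q^{-m}; they occur only in
cq·q^m(f(m)-f(m+1)), which `hasRep_shift` handles. -/
theorem wpMoment_hasRep {q c d C : ℂ} (hq : q ≠ 0) {N : ℕ} {Y : κ → ℕ} (hY : ∀ y, Y y ≤ N)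
    (hbal : d * c * C * q ^ (2 * N + 3) = 1) (hqq : qPoch q q N ≠ 0)
    (hd : qPoch (q * d) q N ≠ 0) (hc : ∀ k, 2 ≤ k → k ≤ 2 * N → 1 - c * q ^ k ≠ 0)
    (s : ℕ) (hs : s ≤ N) :
    ∃ γ ≠ 0, ∃ f : ℕ × κ → ℂ,
      HasRep (fun p : ℕ × κ => q ^ (-(p.1 : ℤ))) (fun p => lam q C (Y p.2)) s γ f ∧
      ∀ m y, wpMoment q c d (N - Y y) s m * (q * d) ^ m =
        qPoch (q ^ (-((N - Y y : ℕ) : ℤ))) q m * qPoch (d * c * q ^ (N - Y y + 2)) q m *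
          wpMoment q c d (N - Y y) 0 0 * f (m, y) := by
  have hd0 : d ≠ 0 := fun h0 => by simp [h0] at hbal
  have hqd : q * d ≠ 0 := mul_ne_zero hq hd0
  induction s with
  | zero =>
    refine ⟨1, one_ne_zero, fun _ => 1, HasRep.const 1, fun m y => ?_⟩
    rw [wpMoment_eq hq (qPoch_ne_zero_of_le hqq (Nat.sub_le _ _))
      (fun k h1 h2 => hc k h1 (by omega)), mul_one]
  | succ s ih =>
    obtain ⟨γ, hγ, f, hf, hfm⟩ := ih (by omega)
    obtain ⟨hsh, hdiff⟩ := hasRep_shift (v := fun y => lam q C (Y y)) hq hf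
    set u : ℕ × κ → ℂ := fun p => q ^ (-(p.1 : ℤ)) with hu
    set v : ℕ × κ → ℂ := fun p => lam q C (Y p.2) with hv
    have hds := factor_ne_zero_of_qPoch hd (show s < N by omega)
    have r1 : HasRep u v (s + 1) γ fun p => f p * u p := by
      simpa using hf.mul HasRep.fst
    have r2 := (hsh.mul HasRep.fst).const_mul (-(q * d)⁻¹)
    have r3 := hsh.mul (HasRep.linear_snd (u := u) (v := v)
      ((q * d)⁻¹ * (d * c * q ^ (N + 2)) * (1 + C * q)) ((q * d)⁻¹ * (d * c * q ^ (N + 2))))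
    have r4 := (hf.mono (Nat.lt_succ_self s)).const_mul (-(1 + c * q))
    have r5 := (hdiff.mono (Nat.lt_succ_self s)).const_mul (c * q)
    have r := (((r1.add r2).add r3).add r4).add r5
    refine ⟨_, ?_, _, r, ?_⟩
    -- Only q^{-m}f(m) and -(qd)^{-1}q^{-m}f(m+1) reach the top power of q^{-m}; the leading
    -- coefficient acquires the factor 1-(qd·q^s)^{-1}, nonzero because s < N.
    · have e : γ + -(q * d)⁻¹ * (γ * (q ^ s)⁻¹ * 1) + γ * (q ^ s)⁻¹ * 0 + -(1 + c * q) * 0 +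
          c * q * 0 = -(γ * (1 - q * d * q ^ s)) * (q * d * q ^ s)⁻¹ := by
        have := pow_ne_zero s hq
        field_simp
        ring
      rw [e]
      exact mul_ne_zero (neg_ne_zero.2 (mul_ne_zero hγ hds))
        (inv_ne_zero (mul_ne_zero hqd (pow_ne_zero _ hq)))
    · intro m y
      have h0 := hfm m y
      have h1 := hfm (m + 1) y
      have hp := pair_factor hq (hY y) hbal m
      have hw : q ^ (-(m : ℤ)) * q ^ m = 1 := by
        rw [zpow_neg, zpow_natCast, inv_mul_cancel₀ (pow_ne_zero _ hq)]
      rw [qPoch_succ, qPoch_succ, pow_succ] at h1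
      rw [wpMoment_succ_left hq]
      simp only [hu, hv]
      generalize wpMoment q c d (N - Y y) s m = L0 at *
      generalize wpMoment q c d (N - Y y) s (m + 1) = L1 at *
      generalize wpMoment q c d (N - Y y) 0 0 = L at *
      generalize f (m, y) = f0 at *
      generalize f (m + 1, y) = f1 at *
      generalize lam q C (Y y) = mu at *
      generalize qPoch (q ^ (-((N - Y y : ℕ) : ℤ))) q m = D1 at *
      generalize qPoch (d * c * q ^ (N - Y y + 2)) q m = D2 at *
      have h1' : L1 * (q * d) ^ m = D1 * D2 * ((1 - q ^ (-((N - Y y : ℕ) : ℤ)) * q ^ m) *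
          (1 - d * c * q ^ (N - Y y + 2) * q ^ m)) * L * f1 * (q * d)⁻¹ := by
        rw [eq_mul_inv_iff_mul_eq₀ hqd]; linear_combination h1
      rw [hp] at h1'
      have hi : (q * d)⁻¹ * (q * d) = 1 := inv_mul_cancel₀ hqd
      generalize (q * d)⁻¹ = i at *
      generalize q ^ (-(m : ℤ)) = w at *
      linear_combination (w + c * q * q ^ m - 1 - c * q) * h0 - w * h1' +
        D1 * D2 * L * f1 * i * d * c * (q ^ (N + 2) * (1 + C * q) + q ^ (N + 2) * mu
          - q ^ 2 * q ^ m) * hw - D1 * D2 * L * f1 * c * q * q ^ m * hi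

end Moments

/-- Moments of the `q`-Chu–Vandermonde sum. -/
def cvMoment (q c d : ℂ) (x : ℕ) (s : ℤ) : ℂ :=
  ∑ m ∈ Finset.range (x + 1), latticePoly q (d * c) x m /
    (d ^ m * (qPoch (q * c) q m * qPoch q q m)) * (q ^ s)⁻¹ ^ m

theorem cvMoment_zero {q c d : ℂ} (hq : q ≠ 0) (hd : d ≠ 0) {x : ℕ} (hx : qPoch q q x ≠ 0)
    (hc : qPoch (q * c) q x ≠ 0) :
    cvMoment q c d x 0 * ((-(d * q)) ^ x * q ^ x.choose 2) =
      qPoch (q * d) q x / qPoch (q * c) q x := by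
  -- The `q`-Chu–Vandermonde sum is the homogeneous Saalschütz sum at e = 0.
  have hs := saalschuetz (q := q) (d * c * q ^ (x + 1)) 0 ((q ^ x * d)⁻¹) x hx
  have hz : q ^ x * d ≠ 0 := mul_ne_zero (pow_ne_zero _ hq) hd
  have h1 : cvMoment q c d x 0 * qPoch (q * c) q x = ∑ k ∈ Finset.range (x + 1),
      saalTerm q (d * c * q ^ (x + 1)) 0 ((q ^ x * d)⁻¹) x k := by
    rw [cvMoment, Finset.sum_mul]
    refine Finset.sum_congr rfl fun k hk => ?_
    obtain ⟨m, rfl⟩ := Nat.exists_eq_add_of_le (Nat.lt_succ_iff.1 (Finset.mem_range.1 hk))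
    have hneg := qPoch_neg_pow hq m k
    rw [add_comm m k] at hneg
    have n1 : qPoch q q k ≠ 0 := qPoch_ne_zero_of_le hx (by omega)
    have n2 : qPoch q q m ≠ 0 := qPoch_ne_zero_of_le hx (by omega)
    have n3 : qPoch (q * c) q k ≠ 0 := qPoch_ne_zero_of_le hc (by omega)
    have hprod : ∏ l ∈ Finset.range k, ((0 : ℂ) - (q ^ (k + m) * d)⁻¹ * q ^ l) =
        (-(q ^ (k + m) * d)⁻¹) ^ k * q ^ k.choose 2 := by
      rw [Nat.choose_two_right, ← Finset.sum_range_id, ← Finset.prod_pow_eq_pow_sum,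
        ← Finset.card_range k, ← Finset.prod_const, Finset.card_range, ← Finset.prod_mul_distrib]
      exact Finset.prod_congr rfl fun l _ => by ring
    have e1 : d * c * q ^ (k + m + 1) * (q ^ (k + m) * d)⁻¹ = q * c := by
      field_simp; ring
    have e2 : qPoch 0 q m = 1 := by simp [qPoch]
    have e3 : (q ^ (k + m) * d)⁻¹ ^ k * (q ^ (m * k + k + k.choose 2) * q ^ k.choose 2) =
        (d ^ k)⁻¹ := by
      have h2 : 2 * k.choose 2 + k = k * k := by
        rw [Nat.choose_two_right, Nat.mul_div_cancel' (Nat.even_mul_pred_self k).two_dvd]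
        rcases k with _ | k
        · rfl
        · simp; ring
      rw [← pow_add, show m * k + k + k.choose 2 + k.choose 2 = (k + m) * k by linarith,
        pow_mul, mul_inv, mul_pow, mul_right_comm, ← mul_pow,
        inv_mul_cancel₀ (pow_ne_zero _ hq), one_pow, one_mul, inv_pow]
    have e4 : ((-1 : ℂ)) ^ k * (-1) ^ k = 1 := by rw [← mul_pow]; norm_num
    rw [saalTerm, hprod, e1, qBinom, if_pos (by omega), Nat.add_sub_cancel_left, e2,
      qPoch_add (q * c) q k m, ← hneg, latticePoly, neg_pow (q ^ (k + m) * d)⁻¹, zpow_zero]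
    generalize qPoch (q ^ (-((k + m : ℕ) : ℤ))) q k = A at *
    generalize qPoch (d * c * q ^ (k + m + 1)) q k = B at *
    generalize qPoch (q * c * q ^ k) q m = C' at *
    generalize (q ^ (k + m) * d)⁻¹ ^ k = E at *
    generalize q ^ (m * k + k + k.choose 2) = Z at *
    generalize q ^ k.choose 2 = W at *
    generalize qPoch q q k = Q1 at *
    generalize qPoch q q m = Q2 at *
    generalize qPoch (q * c) q k = Q3 at *
    generalize (-1 : ℂ) ^ k = σ at *
    calc _ = (d ^ k)⁻¹ * (Q3 / Q3) * (A * B * C' / Q1) := by rw [inv_one, one_pow]; ring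
      _ = (σ * σ) * (E * (Z * W)) * (Q2 / Q2) * (A * B * C' / Q1) := by
        rw [e3, e4, div_self n3, div_self n2]; ring
      _ = _ := by ring
  have hrev := qPoch_reverse (x := q * d) (z := (q ^ x * d)⁻¹) (m := x) (q := q)
    (by field_simp) hq
  rw [eq_div_iff hc, mul_right_comm, h1, hs, mul_zero, ← hrev, mul_comm d q]
  simp [qPoch]

/-- The ratio of consecutive summands is a quotient of quadratics in q^m. Clearing it, multiplying
by q^{-(s+1)(m+1)} and summing gives three terms, since each factor q^m lowers s by one; the middle
one carries λ(x). -/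
theorem cvMoment_rec {q c d : ℂ} (hq : q ≠ 0) (hd : d ≠ 0) {x : ℕ} (hx : qPoch q q x ≠ 0)
    (hc : qPoch (q * c) q x ≠ 0) (s : ℤ) :
    (1 - (d * q ^ (s + 1))⁻¹) * cvMoment q c d x (s + 1) =
      ((1 + c) - (d * q ^ (s + 1))⁻¹ * (lam q (d * c) x + 1 + d * c * q)) * cvMoment q c d x s -
        c * (1 - (q ^ s)⁻¹) * cvMoment q c d x (s - 1) := by
  set r : ℂ := (q ^ (s + 1))⁻¹ with hr
  have e1 : (q ^ s)⁻¹ = r * q := by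
    rw [hr, zpow_add_one₀ hq, mul_inv, inv_mul_cancel_right₀ hq]
  have e2 : (q ^ (s - 1))⁻¹ = r * q * q := by
    rw [← e1, zpow_sub_one₀ hq, mul_inv, inv_inv]
  set k : ℕ → ℂ := fun m => latticePoly q (d * c) x m /
    (d ^ m * (qPoch (q * c) q m * qPoch q q m)) with hk
  set Λ := lam q (d * c) x + 1 + d * c * q with hΛ
  have hfac : ∀ m : ℕ, (1 - q ^ (-(x : ℤ)) * q ^ m) * (1 - d * c * q ^ (x + 1) * q ^ m) =
      1 - q ^ m * Λ + d * c * q * q ^ (2 * m) := by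
    intro m
    rw [hΛ, lam]
    linear_combination (d * c * q ^ (2 * m) - q ^ m * d * c) * zpow_neg_mul_pow_succ hq x
  have hstep : ∀ m < x, k (m + 1) * ((1 - q ^ (m + 1)) * (1 - c * q ^ (m + 1))) =
      d⁻¹ * k m * (1 - q ^ m * Λ + d * c * q * q ^ (2 * m)) := by
    intro m hm
    have n1 : 1 - q * q ^ m ≠ 0 := factor_ne_zero_of_qPoch hx hm
    have n2 : 1 - q * c * q ^ m ≠ 0 := factor_ne_zero_of_qPoch hc hm
    simp only [hk]
    rw [latticePoly_succ, qPoch_succ, qPoch_succ, hfac, pow_succ,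
      show q ^ (m + 1) = q * q ^ m by ring, show c * (q * q ^ m) = q * c * q ^ m by ring]
    generalize 1 - q ^ m * Λ + d * c * q * q ^ (2 * m) = F
    generalize 1 - q * q ^ m = a at *
    generalize 1 - q * c * q ^ m = b at *
    calc _ = (a / a) * (b / b) * (latticePoly q (d * c) x m /
        (d ^ m * (qPoch (q * c) q m * qPoch q q m)) * F * d⁻¹) := by ring
      _ = _ := by rw [div_self n1, div_self n2]; ring
  -- The upper boundary term vanishes because the series terminates at x; the lower one vanishes
  -- through 1 - q^0.
  have hlast : 1 - q ^ x * Λ + d * c * q * q ^ (2 * x) = 0 := by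
    rw [← hfac, zpow_neg, zpow_natCast, inv_mul_cancel₀ (pow_ne_zero _ hq), sub_self, zero_mul]
  have hsum : ∑ m ∈ Finset.range (x + 1), k m * ((1 - q ^ m) * (1 - c * q ^ m)) * r ^ m =
      ∑ m ∈ Finset.range (x + 1),
        d⁻¹ * k m * (1 - q ^ m * Λ + d * c * q * q ^ (2 * m)) * r ^ (m + 1) := by
    rw [Finset.sum_range_succ', Finset.sum_range_succ _ x, hlast]
    simp only [pow_zero, sub_self, zero_mul, mul_zero, add_zero]
    exact Finset.sum_congr rfl fun m hm => by rw [hstep m (Finset.mem_range.1 hm)]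
  have hJ : cvMoment q c d x (s + 1) - (1 + c) * cvMoment q c d x s +
      c * cvMoment q c d x (s - 1) = d⁻¹ * r * (cvMoment q c d x (s + 1) -
        Λ * cvMoment q c d x s + d * c * q * cvMoment q c d x (s - 1)) := by
    simp only [cvMoment, ← hr, e1, e2]
    simp only [Finset.mul_sum, ← Finset.sum_sub_distrib, ← Finset.sum_add_distrib]
    refine (Eq.trans ?_ hsum).trans ?_ <;>
    refine Finset.sum_congr rfl fun m _ => ?_ <;> simp only [hk] <;> ring
  have hdd : d⁻¹ * d = 1 := inv_mul_cancel₀ hd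
  rw [e1, mul_inv, ← hr]
  linear_combination hJ + r * c * q * cvMoment q c d x (s - 1) * hdd

theorem cvMoment_hasRep {ι : Type*} {u v : ι → ℂ} {q c d : ℂ} (hq : q ≠ 0) (hd : d ≠ 0) {N : ℕ}
    {X : ι → ℕ} (hX : ∀ i, X i ≤ N) (hqq : qPoch q q N ≠ 0) (hc : qPoch (q * c) q N ≠ 0)
    (hqd : qPoch (q * d) q N ≠ 0) (hu : ∀ i, u i = lam q (d * c) (X i)) (s : ℕ) (hs : s ≤ N) :
    ∃ τ ≠ 0, ∃ g : ι → ℂ, HasRep u v s τ g ∧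
      ∀ i, cvMoment q c d (X i) s = cvMoment q c d (X i) 0 * g i := by
  induction s using Nat.strong_induction_on with
  | _ s ih =>
    rcases s with _ | s
    · exact ⟨1, one_ne_zero, fun _ => 1, HasRep.const 1, fun i => by simp⟩
    · obtain ⟨τ, hτ, g, hg, hgi⟩ := ih s (Nat.lt_succ_self s) (by omega)
      have hdq : d * q ^ (s + 1) ≠ 0 := mul_ne_zero hd (pow_ne_zero _ hq)
      have n1 : 1 - (d * q ^ (s + 1))⁻¹ ≠ 0 := by
        have := factor_ne_zero_of_qPoch hqd (show s < N by omega)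
        intro h0
        apply this
        have h1 : (d * q ^ (s + 1))⁻¹ = 1 := (sub_eq_zero.1 h0).symm
        rw [inv_eq_one] at h1
        rw [sub_eq_zero, ← h1]; ring
      have hrec : ∀ i, cvMoment q c d (X i) ((s + 1 : ℕ) : ℤ) = (1 - (d * q ^ (s + 1))⁻¹)⁻¹ *
          (((1 + c) - (d * q ^ (s + 1))⁻¹ * (u i + 1 + d * c * q)) * cvMoment q c d (X i) s -
          c * (1 - (q ^ s)⁻¹) * cvMoment q c d (X i) ((s : ℤ) - 1)) := fun i => by
        have := cvMoment_rec hq hd (qPoch_ne_zero_of_le hqq (hX i))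
          (qPoch_ne_zero_of_le hc (hX i)) (s : ℤ)
        rw [hu, eq_inv_mul_iff_mul_eq₀ n1]
        exact_mod_cast this
      have r1 := hg.mul (HasRep.linear_fst (u := u) (v := v)
        ((1 + c) - (d * q ^ (s + 1))⁻¹ * (1 + d * c * q)) (-(d * q ^ (s + 1))⁻¹))
      have hne : (1 - (d * q ^ (s + 1))⁻¹)⁻¹ * (τ * -(d * q ^ (s + 1))⁻¹) ≠ 0 :=
        mul_ne_zero (inv_ne_zero n1) (mul_ne_zero hτ (neg_ne_zero.2 (inv_ne_zero hdq)))
      -- For the first step the term with index -1 has coefficient 1-(q^0)^{-1} = 0, so no negative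
      -- moment is needed.
      rcases s with _ | s
      · refine ⟨_, hne, _, r1.const_mul _, fun i => ?_⟩
        rw [hrec, hgi]
        simp only [pow_zero, inv_one, sub_self, mul_zero, zero_mul, sub_zero]
        ring
      · obtain ⟨τ', -, g', hg', hgi'⟩ := ih s (by omega) (by omega)
        have r2 := (hg'.mono (show s < s + 1 + 1 by omega)).const_mul (-(c * (1 - (q ^ (s + 1))⁻¹)))
        refine ⟨_, ?_, _, (r1.add r2).const_mul (1 - (d * q ^ (s + 1 + 1))⁻¹)⁻¹, fun i => ?_⟩
        · rw [mul_zero, add_zero]; exact hne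
        · rw [hrec, hgi, show ((s + 1 : ℕ) : ℤ) - 1 = (s : ℤ) by push_cast; ring, hgi']
          ring

end

end QRacah

namespace QRacah

noncomputable section

/-! ### The sum over the very-well-poised weight -/

/-- In its degree a, the ₄φ₃ is a combination of lattice polynomials with parameter c₂c₁. Summing
over a first therefore gives moments of the weight, whose symbols cancel the K-dependent
denominators. -/
theorem sum_wpWeight_mul {q c₁ c₂ d : ℂ} (hq : q ≠ 0) (hd : d ≠ 0) {K s x : ℕ} (hx : x ≤ K)
    (hqq : qPoch q q K ≠ 0) (hB : qPoch (d * c₂ * c₁ * q ^ (K + 2)) q K ≠ 0) {f : ℕ → ℂ}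
    (hf : ∀ m, wpMoment q (c₂ * c₁) d K s m * (q * d) ^ m =
        qPoch (q ^ (-(K : ℤ))) q m * qPoch (d * (c₂ * c₁) * q ^ (K + 2)) q m *
          wpMoment q (c₂ * c₁) d K 0 0 * f m) :
    ∑ a ∈ Finset.range (K + 1), wpWeight q (c₂ * c₁) d K a * lam q (c₂ * c₁) a ^ s *
        bareRacah q d c₂ c₁ K a x =
      wpMoment q (c₂ * c₁) d K 0 0 * ∑ m ∈ Finset.range (x + 1), latticePoly q (d * c₂) x m /
        (d ^ m * (qPoch (q * c₂) q m * qPoch q q m)) * f m := by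
  rw [sum_range_extend hx fun k hk => by rw [latticePoly_eq_zero hq _ hk]; simp]
  simp only [bareRacah, Finset.mul_sum]
  rw [Finset.sum_comm]
  refine Finset.sum_congr rfl fun m hm => ?_
  have hm : m ≤ K := Nat.lt_succ_iff.1 (Finset.mem_range.1 hm)
  have n1 := qPoch_neg_pow_ne_zero hq hm hqq
  have n2 := qPoch_ne_zero_of_le hB hm
  have n3 : (q * d) ^ m ≠ 0 := pow_ne_zero _ (mul_ne_zero hq hd)
  have h := hf m
  rw [← mul_assoc d c₂ c₁] at h
  have hL : wpMoment q (c₂ * c₁) d K s m = qPoch (q ^ (-(K : ℤ))) q m *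
      qPoch (d * c₂ * c₁ * q ^ (K + 2)) q m * wpMoment q (c₂ * c₁) d K 0 0 * f m / (q * d) ^ m := by
    rw [eq_div_iff n3, h]
  calc _ = wpMoment q (c₂ * c₁) d K s m * (latticePoly q (d * c₂) x m /
      (qPoch (q * c₂) q m * qPoch (d * c₂ * c₁ * q ^ (K + 2)) q m * qPoch (q ^ (-(K : ℤ))) q m) *
        (q ^ m / qPoch q q m)) := by
        rw [wpMoment, Finset.sum_mul]
        refine Finset.sum_congr rfl fun a _ => ?_
        rw [latticePoly, latticePoly]; ring
    _ = _ := by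
        rw [hL, mul_pow]
        have n4 := pow_ne_zero m hq
        generalize qPoch (q ^ (-(K : ℤ))) q m = A at *
        generalize qPoch (d * c₂ * c₁ * q ^ (K + 2)) q m = B at *
        calc _ = (A / A) * (B / B) * (q ^ m / q ^ m) * (wpMoment q (c₂ * c₁) d K 0 0 *
              (latticePoly q (d * c₂) x m / (d ^ m * (qPoch (q * c₂) q m * qPoch q q m)) *
                f m)) := by ring
          _ = _ := by rw [div_self n1, div_self n2, div_self n4]; ring

theorem sum_wpWeight_zero {q c₁ c₂ d : ℂ} (hq : q ≠ 0) (hd : d ≠ 0) {K x : ℕ} (hx : x ≤ K)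
    (hqq : qPoch q q K ≠ 0) (hB : qPoch (d * c₂ * c₁ * q ^ (K + 2)) q K ≠ 0)
    (hc : ∀ k, 2 ≤ k → k ≤ 2 * K → 1 - c₂ * c₁ * q ^ k ≠ 0) :
    ∑ a ∈ Finset.range (K + 1), wpWeight q (c₂ * c₁) d K a * bareRacah q d c₂ c₁ K a x =
      wpMoment q (c₂ * c₁) d K 0 0 * cvMoment q c₂ d x 0 := by
  have h := sum_wpWeight_mul (s := 0) (f := fun _ => 1) hq hd hx hqq hB fun m => by
    rw [wpMoment_eq hq hqq hc, mul_one]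
  simpa [cvMoment] using h

/-- The polynomial in q^{-m} and λ(Y) from `wpMoment_hasRep` is expanded in monomials; a power
(q^{-m})^r turns the sum over m into the r-th `cvMoment`, of degree r in λ(X). -/
theorem sum_wpWeight_hasRep {ι : Type*} {u v : ι → ℂ} {q c₁ c₂ d C : ℂ} (hq : q ≠ 0) {N : ℕ}
    {X Y : ι → ℕ} (hXY : ∀ i, X i + Y i ≤ N)
    (hbal : d * (c₂ * c₁) * C * q ^ (2 * N + 3) = 1) (hqq : qPoch q q N ≠ 0)
    (hqd : qPoch (q * d) q N ≠ 0) (hqc : qPoch (q * c₂) q N ≠ 0)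
    (hc : ∀ k, 2 ≤ k → k ≤ 2 * N → 1 - c₂ * c₁ * q ^ k ≠ 0)
    (hB : ∀ K ≤ N, qPoch (d * c₂ * c₁ * q ^ (K + 2)) q K ≠ 0)
    (hu : ∀ i, u i = lam q (d * c₂) (X i)) (hv : ∀ i, v i = lam q C (Y i)) (s : ℕ) (hs : s ≤ N) :
    ∃ ρ ≠ 0, ∃ g : ι → ℂ, HasRep u v s ρ g ∧ ∀ i,
      ∑ a ∈ Finset.range (N - Y i + 1), wpWeight q (c₂ * c₁) d (N - Y i) a *
          lam q (c₂ * c₁) a ^ s * bareRacah q d c₂ c₁ (N - Y i) a (X i) =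
        wpMoment q (c₂ * c₁) d (N - Y i) 0 0 * cvMoment q c₂ d (X i) 0 * g i := by
  have hd0 : d ≠ 0 := fun h0 => by simp [h0] at hbal
  have hY : ∀ i, Y i ≤ N := fun i => by have := hXY i; omega
  have hX : ∀ i, X i ≤ N := fun i => by have := hXY i; omega
  obtain ⟨γ, hγ, f, hf, hfm⟩ := wpMoment_hasRep hq hY hbal hqq hqd hc s hs
  obtain ⟨k, hk0, hk, hkf⟩ := hf.exists_coeff
  have hcv : ∀ j, ∃ τ : ℂ, ∃ g : ι → ℂ, j ≤ N → τ ≠ 0 ∧ HasRep u v j τ g ∧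
      ∀ i, cvMoment q c₂ d (X i) j = cvMoment q c₂ d (X i) 0 * g i := fun j => by
    by_cases hj : j ≤ N
    · obtain ⟨τ, h1, g, h2, h3⟩ :=
        cvMoment_hasRep (u := u) (v := v) hq hd0 hX hqq hqc hqd hu j hj
      exact ⟨τ, g, fun _ => ⟨h1, h2, h3⟩⟩
    · exact ⟨0, 0, fun h => absurd h hj⟩
  choose τ g hg using hcv
  have hrep := HasRep.sum_monomials (u' := u) (v' := v) (d := s) (F := fun i j p => g i p * v p ^ j)
    (γ := τ) hk (by
      intro i j hij
      have h1 := (hg i (by omega)).2.1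
      have h2 := HasRep.pow_mul_pow (u := u) (v := v) (d := j) 0 j (by omega)
      have h3 := h1.mul h2
      rcases hij.eq_or_lt with h | h
      · rw [h] at h3
        rcases Nat.eq_zero_or_pos j with rfl | hj
        · rw [add_zero] at h
          subst h
          simpa using h3
        · rw [if_neg (by omega)]
          rw [if_neg (by omega), mul_zero] at h3
          simpa using h3
      · rw [if_neg (by omega)]
        simpa using h3.mono h)
  rw [hk0] at hrep
  refine ⟨_, mul_ne_zero hγ (hg s hs).1, _, hrep, fun i => ?_⟩
  rw [sum_wpWeight_mul hq hd0 (by have := hXY i; omega)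
    (qPoch_ne_zero_of_le hqq (Nat.sub_le _ _)) (hB _ (Nat.sub_le _ _)) (f := fun m => f (m, i))
    (fun m => hfm m i), mul_assoc]
  congr 1
  simp only [hkf, Finset.mul_sum]
  rw [Finset.sum_comm]
  refine Finset.sum_congr rfl fun a ha => ?_
  rw [Finset.sum_comm]
  refine Finset.sum_congr rfl fun b _ => ?_
  have ha : a ≤ N := by have := Finset.mem_range.1 ha; omega
  rw [show cvMoment q c₂ d (X i) 0 * (k a b * (g a i * v i ^ b)) =
    (cvMoment q c₂ d (X i) 0 * g a i) * (k a b * v i ^ b) by ring, ← (hg a ha).2.2 i, cvMoment,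
    Finset.sum_mul]
  refine Finset.sum_congr rfl fun m _ => ?_
  have e : (q ^ (-(m : ℤ))) ^ a = (q ^ (a : ℤ))⁻¹ ^ m := by
    rw [zpow_neg, zpow_natCast, zpow_natCast, inv_pow, inv_pow, ← pow_mul, ← pow_mul, mul_comm]
  rw [e, hv]
  ring

/-! ### Griffiths polynomials -/

namespace Admissible

variable {h : ℂ} {t : Fin 5 → ℂ} {N : ℕ}

theorem q_ne (ht : Admissible h t N) : h ^ 2 ≠ 0 := pow_ne_zero _ ht.h_ne

theorem one_sub_ne {q a : ℂ} {m n : ℕ} (ha : AvoidsInvPowers q a m n) {k : ℕ}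
    (h1 : m ≤ k) (h2 : k ≤ n) : 1 - a * q ^ k ≠ 0 := by
  intro h0
  apply ha k h1 h2
  rw [zpow_neg, zpow_natCast, eq_comm, inv_eq_iff_eq_inv]
  exact eq_inv_of_mul_eq_one_right (sub_eq_zero.1 h0).symm

theorem qq_ne (ht : Admissible h t N) : qPoch (h ^ 2) (h ^ 2) N ≠ 0 :=
  qPoch_ne_zero fun l hl h0 => ht.q_pow_ne (l + 1) (by omega) hl (by
    rw [pow_succ', ← sub_eq_zero.1 h0])

theorem single_ne (ht : Admissible h t N) (i : Fin 5) :
    qPoch (h ^ 2 * t i ^ 2) (h ^ 2) N ≠ 0 :=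
  qPoch_ne_zero fun l hl => by
    have := one_sub_ne (ht.c_single i) (k := l + 1) (by omega) hl
    rwa [pow_succ' _ l, ← mul_assoc, mul_comm (t i ^ 2)] at this

theorem triple_ne {q a b : ℂ} {N : ℕ} (ha : AvoidsInvPowers q (q * a) 2 (2 * N))
    (hab : b = a) (k : ℕ) (h1 : 3 ≤ k) (h2 : k ≤ 2 * N + 1) : 1 - b * q ^ k ≠ 0 := by
  have := one_sub_ne ha (k := k - 1) (by omega) (by omega)
  rwa [hab, show k = k - 1 + 1 by omega, pow_succ', ← mul_assoc, mul_comm a]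

theorem pairGeneric (ht : Admissible h t N) : PairGeneric h (t 0) (t 1) (t 2) (t 3) (t 4) N where
  h_ne := ht.h_ne
  ne₀ := ht.t_ne 0
  ne₁ := ht.t_ne 1
  ne₂ := ht.t_ne 2
  ne₃ := ht.t_ne 3
  ne₄ := ht.t_ne 4
  balance := ht.balance
  qq := ht.qq_ne
  q₀ := ht.single_ne 0
  q₁ := ht.single_ne 1
  q₂ := ht.single_ne 2
  q₃ := ht.single_ne 3
  q₄ := ht.single_ne 4
  q₀₄ := fun _ h1 h2 => one_sub_ne ht.c04 h1 h2
  q₂₁ := fun _ h1 h2 => by rw [mul_comm (t 2 ^ 2)]; exact one_sub_ne ht.c12 h1 h2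
  q₃₀₄ := triple_ne ht.c034 (by ring)
  q₄₂₁ := triple_ne ht.c124 (by ring)

/-- The relabelling under which the first two factors p_i(a;N-j) p_j(y;N-a) take the place of the
last two. -/
theorem pairGeneric' (ht : Admissible h t N) : PairGeneric h (t 2) (t 4) (t 0) (t 1) (t 3) N where
  h_ne := ht.h_ne
  ne₀ := ht.t_ne 2
  ne₁ := ht.t_ne 4
  ne₂ := ht.t_ne 0
  ne₃ := ht.t_ne 1
  ne₄ := ht.t_ne 3
  balance := by rw [← ht.balance]; ring
  qq := ht.qq_ne
  q₀ := ht.single_ne 2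
  q₁ := ht.single_ne 4
  q₂ := ht.single_ne 0
  q₃ := ht.single_ne 1
  q₄ := ht.single_ne 3
  q₀₄ := fun _ h1 h2 => one_sub_ne ht.c23 h1 h2
  q₂₁ := fun _ h1 h2 => one_sub_ne ht.c04 h1 h2
  q₃₀₄ := triple_ne ht.c123 rfl
  q₄₂₁ := triple_ne ht.c034 (by ring)

theorem balance_sq (ht : Admissible h t N) :
    t 0 ^ 2 * t 1 ^ 2 * t 2 ^ 2 * t 3 ^ 2 * t 4 ^ 2 * (h ^ 2) ^ (2 * N + 3) = 1 := by
  calc _ = (h ^ (2 * N + 3) * (t 0 * t 1 * t 2 * t 3 * t 4)) ^ 2 := by ring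
    _ = 1 := by rw [ht.balance, one_pow]

end Admissible

theorem racah_of_lt_left {h t₁ t₂ t₃ : ℂ} {N n x : ℕ} (hn : N < n) : racah h t₁ t₂ t₃ N n x = 0 :=
  if_neg (by omega)

theorem racah_of_lt_right {h t₁ t₂ t₃ : ℂ} {N n x : ℕ} (hx : N < x) : racah h t₁ t₂ t₃ N n x = 0 :=
  if_neg (by omega)

theorem pairPoly_zero (q α β γ : ℂ) (K x : ℕ) : pairPoly q α β γ K 0 x = 1 := by
  simp [pairPoly, latticePoly]

theorem dualRacah_self (q α β γ : ℂ) (M x : ℕ) : dualRacah q α β γ M M x = 1 := by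
  simp [dualRacah, dualCoeff_zero, latticePoly]

theorem racah_zero (h t₁ t₂ t₃ : ℂ) : racah h t₁ t₂ t₃ 0 0 0 = 1 := by
  simp [racah, Omega, phi43, qBinom, qPochSkip]

variable {h : ℂ} {t : Fin 5 → ℂ} {N : ℕ}

theorem griffiths_eq_sum_left (ht : Admissible h t N) {i j x y : ℕ} (hij : i + j ≤ N)
    (hxy : x + y ≤ N) :
    griffiths h t N i j x y = (t 1 / t 4) ^ y * xi h (t 3) (t 0) y *
      ∑ a ∈ Finset.range (N - j + 1),
        (omega h (t 1 * t 2 * t 3 / t 4) a * racah h (t 1) (t 2) (t 3) (N - j) i a *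
          (pairConst h (t 1) (t 2) (t 4) N a * Omega h (t 3) (t 0) (t 4) (N - a) j)) *
        (dualRacah (h ^ 2) (t 3 ^ 2) (t 0 ^ 2) (t 4 ^ 2) (N - a) j y *
          pairPoly (h ^ 2) (t 4 ^ 2) (t 2 ^ 2) (t 1 ^ 2) (N - y) a x) := by
  -- The range is extended to N-j, independent of y; the added terms vanish by the convention in
  -- `racah`.
  rw [griffiths, Finset.mul_sum, sum_range_extend (min_le_left _ (N - y)) fun k hk => by
    rcases lt_or_ge (N - j) k with h1 | h1
    · rw [racah_of_lt_right h1]; ring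
    · rw [racah_of_lt_left (n := k) (show N - y < k by omega), mul_zero]]
  refine Finset.sum_congr rfl fun a ha => ?_
  have ha := Finset.mem_range.1 ha
  rw [mul_assoc, racah_mul_racah ht.pairGeneric (by omega) hxy]
  ring

theorem griffiths_zero_top (ht : Admissible h t N) {x y : ℕ} (hxy : x + y ≤ N) :
    griffiths h t N 0 N x y = (-1) ^ N * (t 3 / t 1) ^ N * (t 1 / t 4) ^ y *
      xi h (t 0) (t 0 * t 4 * h ^ N) N * xi h (t 3) (t 0) y := by
  have hC := ht.pairGeneric.pairConst_mul_Omega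
  rw [griffiths_eq_sum_left ht (by omega) hxy, Nat.sub_self, zero_add, Finset.sum_range_one,
    Nat.sub_zero, dualRacah_self, pairPoly_zero, racah_zero, hC]
  simp only [omega, pow_zero]
  simp
  ring

theorem griffiths_zero_top_ne (ht : Admissible h t N) {x y : ℕ} (hxy : x + y ≤ N) :
    griffiths h t N 0 N x y ≠ 0 := by
  have H := ht.pairGeneric
  have hC := H.pairConst_mul_Omega
  rw [griffiths_zero_top ht hxy, mul_right_comm _ ((t 1 / t 4) ^ y), ← hC]
  exact mul_ne_zero (mul_ne_zero (mul_ne_zero (H.pairConst_ne (Nat.zero_le _))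
    (H.Omega_ne le_rfl le_rfl)) (pow_ne_zero _ (div_ne_zero H.ne₁ H.ne₄))) (H.xi_ne (by omega))

theorem exists_polynomial_left (ht : Admissible h t N) {i j : ℕ} (hij : i + j ≤ N) :
    ∃ P : MvPolynomial (Fin 2) ℂ, P.totalDegree = N - j ∧ ∀ x y : ℕ, x + y ≤ N →
      griffiths h t N i j x y / griffiths h t N 0 N x y = MvPolynomial.eval
        ![lam (h ^ 2) (t 4 ^ 2 * t 2 ^ 2) x, lam (h ^ 2) (t 0 ^ 2 * t 3 ^ 2) y] P := by
  have H := ht.pairGeneric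
  have H' := ht.pairGeneric'
  have hq := ht.q_ne
  let ι := {p : ℕ × ℕ // p.1 + p.2 ≤ N}
  let u : ι → ℂ := fun p => lam (h ^ 2) (t 4 ^ 2 * t 2 ^ 2) p.1.1
  let v : ι → ℂ := fun p => lam (h ^ 2) (t 0 ^ 2 * t 3 ^ 2) p.1.2
  set A : ℂ := pairConst h (t 1) (t 2) (t 4) N 0 * Omega h (t 3) (t 0) (t 4) N N with hA
  have hA0 : A ≠ 0 := mul_ne_zero (H.pairConst_ne (Nat.zero_le _)) (H.Omega_ne le_rfl le_rfl)
  let k : ℕ → ℂ := fun a => (omega h (t 1 * t 2 * t 3 / t 4) a *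
    racah h (t 1) (t 2) (t 3) (N - j) i a *
      (pairConst h (t 1) (t 2) (t 4) N a * Omega h (t 3) (t 0) (t 4) (N - a) j)) / A
  have hP : ∀ a, ∃ c : ℂ, a ≤ N → c ≠ 0 ∧ HasRep u v a c fun p : ι =>
      pairPoly (h ^ 2) (t 4 ^ 2) (t 2 ^ 2) (t 1 ^ 2) (N - p.1.2) a p.1.1 := fun a => by
    by_cases ha : a ≤ N
    · have hβγ : qPoch (t 2 ^ 2 * t 1 ^ 2 * (h ^ 2) ^ (a + 1)) (h ^ 2) a ≠ 0 := by
        rcases Nat.eq_zero_or_pos a with h0 | h0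
        · rw [h0]; simp
        · exact qPoch_shift_ne_zero H.q₂₁ (s := a + 1) (by omega) (by omega) rfl
      obtain ⟨c, hc, hr⟩ := hasRep_pairPoly (u := u) (v := v) (q := h ^ 2) (α := t 4 ^ 2)
        (β := t 2 ^ 2) (γ := t 1 ^ 2) (C := t 0 ^ 2 * t 3 ^ 2) (N := N) (a := a)
        (X := fun p : ι => p.1.1) (Y := fun p : ι => p.1.2) hq
        (fun p => by have := p.2; omega) (by rw [← ht.balance_sq]; ring) (fun _ => rfl)
        (fun _ => rfl) (qPoch_ne_zero_of_le H.qq ha) (qPoch_ne_zero_of_le H.q₂ ha) hβγ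
      exact ⟨c, fun _ => ⟨hc, hr⟩⟩
    · exact ⟨0, fun h => absurd h ha⟩
  choose c hc using hP
  have hrep := HasRep.sum (u := u) (v := v) (d := N - j) (Finset.range (N - j + 1))
    (F := fun a p => k a * (dualRacah (h ^ 2) (t 3 ^ 2) (t 0 ^ 2) (t 4 ^ 2) (N - a) j p.1.2 *
      pairPoly (h ^ 2) (t 4 ^ 2) (t 2 ^ 2) (t 1 ^ 2) (N - p.1.2) a p.1.1))
    (c := fun a => k a * ((if N - a - j = 0 then 1 else 0) * c a)) (by
      intro a ha
      have ha := Finset.mem_range.1 ha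
      have h1 := hasRep_dualRacah_snd (u := u) (v := v) (q := h ^ 2) (α := t 3 ^ 2) (β := t 0 ^ 2)
        (γ := t 4 ^ 2) (M := N - a) (n := j) (X := fun p : ι => p.1.2) hq
        (fun p => by rw [mul_comm (t 3 ^ 2)])
      have h2 := (h1.mul (hc a (by omega)).2).const_mul (k a)
      rwa [show N - a - j + a = N - j by omega] at h2)
  -- For a < N-j the factor `dualRacah` has positive degree in λ(y), so such a term cannot
  -- contribute to λ(x)^{N-j}.
  rw [Finset.sum_eq_single (N - j) (fun a ha hne => by
      have ha := Finset.mem_range.1 ha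
      rw [if_neg (by omega)]; ring) (fun hn => by simp at hn)] at hrep
  rw [if_pos (by omega), one_mul] at hrep
  obtain ⟨P, hPd, hPe⟩ := hrep.exists_totalDegree_eq (by
    refine mul_ne_zero (div_ne_zero (mul_ne_zero (mul_ne_zero ?_ ?_) (mul_ne_zero ?_ ?_)) hA0)
      (hc _ (Nat.sub_le _ _)).1
    · exact mul_ne_zero (mul_ne_zero (pow_ne_zero _ (by norm_num)) (pow_ne_zero _
        (div_ne_zero (mul_ne_zero (mul_ne_zero H.ne₁ H.ne₂) H.ne₃) H.ne₄))) (pow_ne_zero _ hq)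
    · exact H'.racah_last_ne (by omega) (Nat.sub_le _ _)
    · exact H.pairConst_ne (Nat.sub_le _ _)
    · exact H.Omega_ne (by omega) (Nat.sub_le _ _))
  refine ⟨P, hPd, fun x y hxy => ?_⟩
  rw [← hPe ⟨(x, y), hxy⟩, griffiths_eq_sum_left ht hij hxy, griffiths_zero_top ht hxy,
    mul_right_comm _ ((t 1 / t 4) ^ y), ← H.pairConst_mul_Omega, ← hA]
  have hg : (t 1 / t 4) ^ y * xi h (t 3) (t 0) y ≠ 0 :=
    mul_ne_zero (pow_ne_zero _ (div_ne_zero H.ne₁ H.ne₄)) (H.xi_ne (by omega))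
  rw [mul_assoc A, mul_comm A, mul_div_mul_left _ _ hg, Finset.sum_div]
  exact Finset.sum_congr rfl fun a _ => by simp only [k]; ring

end

end QRacah

/-! ### The Griffiths sum with its first two factors combined, normalised by G_{N,0} -/

namespace QRacah

noncomputable section

variable {h : ℂ} {t : Fin 5 → ℂ} {N : ℕ}

/-- The function of a split off from the first two factors cancels the ratio (qc₂;q)_a/(qc₁;q)_a in
Ω(a;K); what is left is the very-well-poised weight, up to a power. -/
theorem omega_mul_xi_mul_Omega (ht : Admissible h t N) {K a : ℕ} (ha : a ≤ K) (hK : K ≤ N) :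
    omega h (t 1 * t 2 * t 3 / t 4) a * ((t 4 / t 3) ^ a * xi h (t 1) (t 2) a) *
        Omega h (t 4) (t 2) (t 1) K a =
      (h * t 2) ^ K * wpWeight (h ^ 2) (t 2 ^ 2 * t 1 ^ 2) (t 4 ^ 2) K a := by
  have H := ht.pairGeneric
  have n1 := qPoch_ne_zero_of_le H.q₁ (ha.trans hK)
  have n2 := qPoch_ne_zero_of_le H.q₂ (ha.trans hK)
  have m2 : h * t 2 ≠ 0 := mul_ne_zero H.h_ne H.ne₂
  have e1 : (h * t 2) ^ (2 * (a : ℤ) - (K : ℤ)) = (h * t 2) ^ (2 * a) / (h * t 2) ^ K := by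
    rw [← zpow_natCast, ← zpow_natCast, ← zpow_sub₀ m2]; push_cast; rfl
  have e2 : (a + 1).choose 2 = a.choose 2 + a := by
    rw [Nat.choose_succ_succ' a]; simp; ring
  have e3 : (t 1 * t 2 * t 3 / t 4) ^ a * (t 4 / t 3) ^ a * (t 2 / t 1) ^ a * (h ^ 2) ^ a =
      (h * t 2) ^ (2 * a) := by
    rw [← mul_pow, ← mul_pow, ← mul_pow, pow_mul]
    congr 1
    have := H.ne₁; have := H.ne₃; have := H.ne₄
    field_simp
  have m3 : (h * t 2) ^ (2 * a) ≠ 0 := pow_ne_zero _ m2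
  rw [omega, xi, Omega, wpWeight, e1, e2, pow_add, ← mul_assoc (t 4 ^ 2)]
  generalize (h * t 2) ^ K = Z
  generalize qPoch (h ^ 2 * t 1 ^ 2) (h ^ 2) a = A at *
  generalize qPoch (h ^ 2 * t 2 ^ 2) (h ^ 2) a = B at *
  generalize qPoch (t 4 ^ 2 * t 2 ^ 2 * t 1 ^ 2 * (h ^ 2) ^ (K + 2)) (h ^ 2) a = D
  generalize qPoch (h ^ 2 * t 4 ^ 2) (h ^ 2) (K - a) = E
  generalize qPochSkip _ _ _ _ = F
  calc _ = ((t 1 * t 2 * t 3 / t 4) ^ a * (t 4 / t 3) ^ a * (t 2 / t 1) ^ a * (h ^ 2) ^ a) /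
        (h * t 2) ^ (2 * a) * (A / A) * (B / B) *
        (Z * ((-1) ^ a * (h ^ 2) ^ a.choose 2 * qBinom (h ^ 2) K a * (D * E) / F)) := by
        simp only [div_eq_mul_inv, mul_inv, inv_inv]; ring
    _ = _ := by rw [e3, div_self m3, div_self n1, div_self n2]; ring

theorem griffiths_eq_sum_right (ht : Admissible h t N) {i j x y : ℕ} (hij : i + j ≤ N)
    (hxy : x + y ≤ N) :
    griffiths h t N i j x y =
      (pairConst h (t 4) (t 0) (t 3) N j * Omega h (t 1) (t 2) (t 3) (N - j) i) *
      (h * t 2) ^ (N - y) * ∑ a ∈ Finset.range (N - y + 1),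
        wpWeight (h ^ 2) (t 2 ^ 2 * t 1 ^ 2) (t 4 ^ 2) (N - y) a *
        (dualRacah (h ^ 2) (t 1 ^ 2) (t 2 ^ 2) (t 3 ^ 2) (N - j) i a *
          pairPoly (h ^ 2) (t 3 ^ 2) (t 0 ^ 2) (t 4 ^ 2) (N - a) j y) *
        bareRacah (h ^ 2) (t 4 ^ 2) (t 2 ^ 2) (t 1 ^ 2) (N - y) a x := by
  rw [griffiths, Finset.mul_sum, sum_range_extend (min_le_right (N - j) _) fun k hk => by
    rcases lt_or_ge (N - j) k with h1 | h1
    · rw [racah_of_lt_right h1]; ring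
    · rw [racah_of_lt_left (n := k) (show N - y < k by omega), mul_zero]]
  refine Finset.sum_congr rfl fun a ha => ?_
  have ha := Finset.mem_range.1 ha
  have hw := omega_mul_xi_mul_Omega ht (a := a) (K := N - y) (by omega) (Nat.sub_le _ _)
  rw [mul_assoc (omega _ _ _), racah_mul_racah ht.pairGeneric' (by omega) (by omega),
    racah_eq_bareRacah ht.h_ne _ _ _ (by omega) (by omega)]
  linear_combination ((pairConst h (t 4) (t 0) (t 3) N j * Omega h (t 1) (t 2) (t 3) (N - j) i) *
    (dualRacah (h ^ 2) (t 1 ^ 2) (t 2 ^ 2) (t 3 ^ 2) (N - j) i a *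
      pairPoly (h ^ 2) (t 3 ^ 2) (t 0 ^ 2) (t 4 ^ 2) (N - a) j y) *
    bareRacah (h ^ 2) (t 4 ^ 2) (t 2 ^ 2) (t 1 ^ 2) (N - y) a x) * hw

theorem griffiths_top_zero_eq (ht : Admissible h t N) {x y : ℕ} (hxy : x + y ≤ N) :
    griffiths h t N N 0 x y =
      (pairConst h (t 4) (t 0) (t 3) N 0 * Omega h (t 1) (t 2) (t 3) N N) *
      (h * t 2) ^ (N - y) * (wpMoment (h ^ 2) (t 2 ^ 2 * t 1 ^ 2) (t 4 ^ 2) (N - y) 0 0 *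
        cvMoment (h ^ 2) (t 2 ^ 2) (t 4 ^ 2) x 0) := by
  have H := ht.pairGeneric
  rw [griffiths_eq_sum_right ht (by omega) hxy,
    ← sum_wpWeight_zero ht.q_ne (pow_ne_zero _ H.ne₄) (by omega)
      (qPoch_ne_zero_of_le H.qq (Nat.sub_le _ _)) (H.q₄₂₁_ne le_rfl (Nat.sub_le _ _))
      (fun k h1 h2 => H.q₂₁ k h1 (by omega))]
  simp only [pairPoly_zero, Nat.sub_zero, dualRacah_self, mul_one]

theorem griffiths_top_zero (ht : Admissible h t N) {x y : ℕ} (hxy : x + y ≤ N) :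
    griffiths h t N N 0 x y = ((t 0 * t 3 * h ^ (N + 1)) ^ N)⁻¹ *
      (omega h (t 1 * t 0 * t 3 / t 4) y / omega h (t 2 * t 4) x) *
        xi h (t 2) (t 2 * t 3 * h ^ N) N * xi h (t 4) (t 2) x := by
  have H := ht.pairGeneric
  have hq := ht.q_ne
  have hh := ht.h_ne
  have h0 := H.ne₀
  have h1 := H.ne₁
  have h2 := H.ne₂
  have h3 := H.ne₃
  have h4 := H.ne₄
  have hbal := ht.balance
  have hcv := cvMoment_zero hq (pow_ne_zero 2 h4) (qPoch_ne_zero_of_le H.qq (show x ≤ N by omega))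
    (qPoch_ne_zero_of_le H.q₂ (show x ≤ N by omega))
  have hB := H.q₄₂₁_ne (le_refl (N - y)) (Nat.sub_le _ _)
  rw [mul_assoc (t 4 ^ 2)] at hB
  rw [griffiths_top_zero_eq ht hxy, ht.pairGeneric'.pairConst_mul_Omega,
    wpMoment_zero hq (qPoch_ne_zero_of_le H.qq (Nat.sub_le _ _))
      (fun k h1 h2 => H.q₂₁ k h1 (by omega)) hB]
  have hs : ∀ n : ℕ, (n + 1).choose 2 = n.choose 2 + n := fun n => by
    rw [Nat.choose_succ_succ' n]; simp; ring
  have hsq : ∀ n : ℕ, h ^ (n * n) = (h ^ 2) ^ n.choose 2 * h ^ n := fun n => by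
    have h2 : 2 * n.choose 2 + n = n * n := by
      rw [Nat.choose_two_right, Nat.mul_div_cancel' (Nat.even_mul_pred_self n).two_dvd]
      rcases n with _ | n
      · rfl
      · simp; ring
    rw [← h2]; ring
  have hJ : cvMoment (h ^ 2) (t 2 ^ 2) (t 4 ^ 2) x 0 = xi h (t 4) (t 2) x / omega h (t 2 * t 4) x := by
    have n1 : (-(t 4 ^ 2 * h ^ 2)) ^ x * (h ^ 2) ^ x.choose 2 ≠ 0 :=
      mul_ne_zero (pow_ne_zero _ (neg_ne_zero.2 (mul_ne_zero (pow_ne_zero _ h4) hq)))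
        (pow_ne_zero _ hq)
    have n2 : omega h (t 2 * t 4) x ≠ 0 := mul_ne_zero (mul_ne_zero (pow_ne_zero _ (by norm_num))
      (pow_ne_zero _ (mul_ne_zero h2 h4))) (pow_ne_zero _ hq)
    have e : omega h (t 2 * t 4) x =
        (t 2 / t 4) ^ x * ((-(t 4 ^ 2 * h ^ 2)) ^ x * (h ^ 2) ^ x.choose 2) := by
      rw [omega, hs, neg_pow, pow_add, show t 2 * t 4 = t 2 / t 4 * t 4 ^ 2 by field_simp]
      ring
    rw [eq_div_iff n2, e, mul_left_comm, hcv, xi]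
    ring
  have hpow : (-1 : ℂ) ^ N * (t 1 / t 4) ^ N * ((h * t 2) ^ (N - y) * ((-1) ^ (N - y) *
      (h ^ 2 * t 4 ^ 2) ^ (N - y) * (h ^ 2) ^ (N - y).choose 2)) =
      ((t 0 * t 3 * h ^ (N + 1)) ^ N)⁻¹ * omega h (t 1 * t 0 * t 3 / t 4) y := by
    obtain ⟨K, rfl⟩ := Nat.exists_eq_add_of_le (show y ≤ N by omega)
    have n1 : (t 0 * t 3 * h ^ (y + K + 1)) ^ (y + K) ≠ 0 :=
      pow_ne_zero _ (mul_ne_zero (mul_ne_zero h0 h3) (pow_ne_zero _ hh))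
    rw [Nat.add_sub_cancel_left, eq_inv_mul_iff_mul_eq₀ n1, omega, hs]
    have hm : (-1 : ℂ) ^ (y + K) * (-1) ^ K = (-1) ^ y := by
      rw [pow_add, mul_assoc, ← mul_pow]; norm_num
    have e1 : (t 0 * t 3 * h ^ (y + K + 1)) ^ (y + K) * (t 1 / t 4) ^ (y + K) =
        (t 1 * t 0 * t 3 / t 4) ^ y * (t 1 * t 0 * t 3 / t 4) ^ K *
          h ^ ((y + K) * (y + K + 1)) := by
      rw [← pow_add, pow_mul', ← mul_pow, ← mul_pow]
      congr 1; ring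
    -- The K-th power of the balancing condition for the chosen square roots.
    have e2 : (t 1 * t 0 * t 3 / t 4) ^ K * (h * t 2) ^ K * (h ^ 2 * t 4 ^ 2) ^ K *
        h ^ (2 * (y + K) * K) = 1 := by
      rw [pow_mul, ← mul_pow, ← mul_pow, ← mul_pow]
      rw [show t 1 * t 0 * t 3 / t 4 * (h * t 2) * (h ^ 2 * t 4 ^ 2) * h ^ (2 * (y + K)) =
        h ^ (2 * (y + K) + 3) * (t 0 * t 1 * t 2 * t 3 * t 4) by field_simp; ring, hbal, one_pow]
    have e3 : h ^ ((y + K) * (y + K + 1)) * (h ^ 2) ^ K.choose 2 =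
        h ^ (2 * (y + K) * K) * (h ^ 2) ^ (y.choose 2 + y) := by
      apply mul_right_cancel₀ (pow_ne_zero K hh)
      calc _ = h ^ ((y + K) * (y + K + 1)) * ((h ^ 2) ^ K.choose 2 * h ^ K) := by ring
        _ = h ^ (2 * (y + K) * K) * (h ^ (y * y)) * h ^ y * h ^ K := by rw [← hsq]; ring
        _ = _ := by rw [hsq]; ring
    calc _ = ((-1 : ℂ) ^ (y + K) * (-1) ^ K) * ((t 0 * t 3 * h ^ (y + K + 1)) ^ (y + K) *
          (t 1 / t 4) ^ (y + K)) * ((h * t 2) ^ K * (h ^ 2 * t 4 ^ 2) ^ K *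
          (h ^ 2) ^ K.choose 2) := by ring
      _ = (-1) ^ y * (t 1 * t 0 * t 3 / t 4) ^ y * ((t 1 * t 0 * t 3 / t 4) ^ K * (h * t 2) ^ K *
          (h ^ 2 * t 4 ^ 2) ^ K) * (h ^ ((y + K) * (y + K + 1)) * (h ^ 2) ^ K.choose 2) := by
          rw [hm, e1]; ring
      _ = (-1) ^ y * (t 1 * t 0 * t 3 / t 4) ^ y * ((t 1 * t 0 * t 3 / t 4) ^ K * (h * t 2) ^ K *
          (h ^ 2 * t 4 ^ 2) ^ K * h ^ (2 * (y + K) * K)) * (h ^ 2) ^ (y.choose 2 + y) := by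
          rw [e3]; ring
      _ = _ := by rw [e2]; ring
  rw [hJ]
  linear_combination (xi h (t 2) (t 2 * t 3 * h ^ N) N *
    (xi h (t 4) (t 2) x / omega h (t 2 * t 4) x)) * hpow

theorem griffiths_top_zero_ne (ht : Admissible h t N) {x y : ℕ} (hxy : x + y ≤ N) :
    griffiths h t N N 0 x y ≠ 0 := by
  have H := ht.pairGeneric
  have H' := ht.pairGeneric'
  have hq := ht.q_ne
  have hh := ht.h_ne
  have hxi : xi h (t 2) (t 2 * t 3 * h ^ N) N ≠ 0 := by
    have hC := H'.pairConst_mul_Omega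
    have := mul_ne_zero (H'.pairConst_ne (Nat.zero_le _)) (H'.Omega_ne (le_refl N) le_rfl)
    rw [hC] at this
    exact right_ne_zero_of_mul this
  have hom : ∀ (s : ℂ) (n : ℕ), s ≠ 0 → omega h s n ≠ 0 := fun s n hs =>
    mul_ne_zero (mul_ne_zero (pow_ne_zero _ (by norm_num)) (pow_ne_zero _ hs)) (pow_ne_zero _ hq)
  rw [griffiths_top_zero ht hxy]
  refine mul_ne_zero (mul_ne_zero (mul_ne_zero (inv_ne_zero (pow_ne_zero _ (mul_ne_zero
    (mul_ne_zero H.ne₀ H.ne₃) (pow_ne_zero _ hh)))) (div_ne_zero (hom _ _ ?_) (hom _ _ ?_))) hxi) ?_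
  · exact div_ne_zero (mul_ne_zero (mul_ne_zero H.ne₁ H.ne₀) H.ne₃) H.ne₄
  · exact mul_ne_zero H.ne₂ H.ne₄
  · exact mul_ne_zero (div_ne_zero (qPoch_ne_zero_of_le H.q₄ (by omega))
      (qPoch_ne_zero_of_le H.q₂ (by omega))) (pow_ne_zero _ (div_ne_zero H.ne₂ H.ne₄))

theorem exists_polynomial_right (ht : Admissible h t N) {i j : ℕ} (hij : i + j ≤ N) :
    ∃ P : MvPolynomial (Fin 2) ℂ, P.totalDegree = N - i ∧ ∀ x y : ℕ, x + y ≤ N →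
      griffiths h t N i j x y / griffiths h t N N 0 x y = MvPolynomial.eval
        ![lam (h ^ 2) (t 4 ^ 2 * t 2 ^ 2) x, lam (h ^ 2) (t 0 ^ 2 * t 3 ^ 2) y] P := by
  have H := ht.pairGeneric
  have H' := ht.pairGeneric'
  have hq := ht.q_ne
  let ι := {p : ℕ × ℕ // p.1 + p.2 ≤ N}
  let u : ι → ℂ := fun p => lam (h ^ 2) (t 4 ^ 2 * t 2 ^ 2) p.1.1
  let v : ι → ℂ := fun p => lam (h ^ 2) (t 0 ^ 2 * t 3 ^ 2) p.1.2
  -- The same index set serves twice: here its first coordinate stands for the summation index a,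
  -- which satisfies a + y ≤ N just as x does.
  let w : ι → ℂ := fun p => lam (h ^ 2) (t 2 ^ 2 * t 1 ^ 2) p.1.1
  have hS : ∀ s, ∃ ρ : ℂ, ∃ g : ι → ℂ, s ≤ N → ρ ≠ 0 ∧ HasRep u v s ρ g ∧ ∀ p : ι,
      ∑ a ∈ Finset.range (N - p.1.2 + 1),
        wpWeight (h ^ 2) (t 2 ^ 2 * t 1 ^ 2) (t 4 ^ 2) (N - p.1.2) a *
          lam (h ^ 2) (t 2 ^ 2 * t 1 ^ 2) a ^ s *
            bareRacah (h ^ 2) (t 4 ^ 2) (t 2 ^ 2) (t 1 ^ 2) (N - p.1.2) a p.1.1 =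
        wpMoment (h ^ 2) (t 2 ^ 2 * t 1 ^ 2) (t 4 ^ 2) (N - p.1.2) 0 0 *
          cvMoment (h ^ 2) (t 2 ^ 2) (t 4 ^ 2) p.1.1 0 * g p := fun s => by
    by_cases hs : s ≤ N
    · obtain ⟨ρ, h1, g, h2, h3⟩ := sum_wpWeight_hasRep (u := u) (v := v) (q := h ^ 2)
        (c₁ := t 1 ^ 2) (c₂ := t 2 ^ 2) (d := t 4 ^ 2) (C := t 0 ^ 2 * t 3 ^ 2) (N := N)
        (X := fun p : ι => p.1.1) (Y := fun p : ι => p.1.2) hq (fun p => p.2)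
        (by rw [← ht.balance_sq]; ring) H.qq H.q₄ H.q₂ H.q₂₁
        (fun K hK => H.q₄₂₁_ne le_rfl hK) (fun _ => rfl) (fun _ => rfl) s hs
      exact ⟨ρ, g, fun _ => ⟨h1, h2, h3⟩⟩
    · exact ⟨0, 0, fun h => absurd h hs⟩
  choose ρ g hg using hS
  have hQ := hasRep_dualRacah (u := w) (v := v) (q := h ^ 2) (α := t 1 ^ 2) (β := t 2 ^ 2)
    (γ := t 3 ^ 2) (M := N - j) (n := i) (X := fun p : ι => p.1.1) hq
    (fun p => by rw [mul_comm (t 1 ^ 2)])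
  obtain ⟨c, hc, hP⟩ := hasRep_pairPoly_swap (u := w) (v := v) (q := h ^ 2) (α := t 3 ^ 2)
    (β := t 0 ^ 2) (γ := t 4 ^ 2) (C := t 2 ^ 2 * t 1 ^ 2) (N := N) (a := j)
    (X := fun p : ι => p.1.2) (Y := fun p : ι => p.1.1) hq (fun p => by have := p.2; omega)
    (by rw [← ht.balance_sq]; ring) (fun p => by rw [mul_comm (t 3 ^ 2)]) (fun _ => rfl)
  have hQP := hQ.mul hP
  rw [show N - j - i + j = N - i by omega] at hQP
  obtain ⟨k, hk0, hk, hkf⟩ := hQP.exists_coeff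
  have hk0' : k (N - i) 0 ≠ 0 := by
    rw [hk0]
    exact mul_ne_zero (mul_ne_zero (H'.dualCoeff_ne (by omega) (Nat.sub_le _ _))
      (Finset.prod_ne_zero_iff.2 fun l _ => neg_ne_zero.2 (pow_ne_zero _ hq))) hc
  -- Summation over a replaces λ(a)^s by a polynomial of degree s with nonzero coefficient of
  -- λ(x)^s, so total degree and leading term carry over from (λ(a), λ(y)) to (λ(x), λ(y)).
  have hrep := HasRep.sum_monomials (u' := u) (v' := v) (d := N - i)
    (F := fun a b p => g a p * v p ^ b) (γ := ρ) hk (by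
      intro a b hab
      have h3 := (hg a (by omega)).2.1.mul
        (HasRep.pow_mul_pow (u := u) (v := v) (d := b) 0 b (by omega))
      rcases hab.eq_or_lt with h | h
      · rw [h] at h3
        rcases Nat.eq_zero_or_pos b with rfl | hb
        · rw [add_zero] at h
          subst h
          simpa using h3
        · rw [if_neg (by omega)]
          rw [if_neg (by omega), mul_zero] at h3
          simpa using h3
      · rw [if_neg (by omega)]
        simpa using h3.mono h)
  set A : ℂ := pairConst h (t 4) (t 0) (t 3) N 0 * Omega h (t 1) (t 2) (t 3) N N with hA
  set B : ℂ := pairConst h (t 4) (t 0) (t 3) N j * Omega h (t 1) (t 2) (t 3) (N - j) i with hB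
  have hA0 : A ≠ 0 := mul_ne_zero (H'.pairConst_ne (Nat.zero_le _)) (H'.Omega_ne le_rfl le_rfl)
  have hB0 : B ≠ 0 := mul_ne_zero (H'.pairConst_ne (by omega))
    (H'.Omega_ne (by omega) (Nat.sub_le _ _))
  obtain ⟨P, hPd, hPe⟩ := (hrep.const_mul (B / A)).exists_totalDegree_eq
    (mul_ne_zero (div_ne_zero hB0 hA0) (mul_ne_zero hk0' (hg _ (Nat.sub_le _ _)).1))
  refine ⟨P, hPd, fun x y hxy => ?_⟩
  rw [← hPe ⟨(x, y), hxy⟩]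
  have hne := griffiths_top_zero_ne ht hxy
  rw [griffiths_top_zero_eq ht hxy, ← hA] at hne ⊢
  rw [div_eq_iff hne, griffiths_eq_sum_right ht hij hxy, ← hB]
  set L := wpMoment (h ^ 2) (t 2 ^ 2 * t 1 ^ 2) (t 4 ^ 2) (N - y) 0 0 *
    cvMoment (h ^ 2) (t 2 ^ 2) (t 4 ^ 2) x 0 with hL
  have hsum : ∑ a ∈ Finset.range (N - y + 1),
        wpWeight (h ^ 2) (t 2 ^ 2 * t 1 ^ 2) (t 4 ^ 2) (N - y) a *
        (dualRacah (h ^ 2) (t 1 ^ 2) (t 2 ^ 2) (t 3 ^ 2) (N - j) i a *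
          pairPoly (h ^ 2) (t 3 ^ 2) (t 0 ^ 2) (t 4 ^ 2) (N - a) j y) *
        bareRacah (h ^ 2) (t 4 ^ 2) (t 2 ^ 2) (t 1 ^ 2) (N - y) a x =
      L * ∑ a ∈ Finset.range (N - i + 1), ∑ b ∈ Finset.range (N - i + 1),
        k a b * (g a ⟨(x, y), hxy⟩ * v ⟨(x, y), hxy⟩ ^ b) := by
    have e1 : ∀ a ∈ Finset.range (N - y + 1),
        dualRacah (h ^ 2) (t 1 ^ 2) (t 2 ^ 2) (t 3 ^ 2) (N - j) i a *
          pairPoly (h ^ 2) (t 3 ^ 2) (t 0 ^ 2) (t 4 ^ 2) (N - a) j y =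
        ∑ m ∈ Finset.range (N - i + 1), ∑ b ∈ Finset.range (N - i + 1),
          k m b * lam (h ^ 2) (t 2 ^ 2 * t 1 ^ 2) a ^ m *
            lam (h ^ 2) (t 0 ^ 2 * t 3 ^ 2) y ^ b := fun a ha =>
      hkf ⟨(a, y), by have := Finset.mem_range.1 ha; simp only; omega⟩
    rw [Finset.sum_congr rfl fun a ha => by rw [e1 a ha]]
    simp only [Finset.mul_sum, Finset.sum_mul]
    rw [Finset.sum_comm]
    refine Finset.sum_congr rfl fun m hm => ?_
    rw [Finset.sum_comm]
    refine Finset.sum_congr rfl fun b _ => ?_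
    have hm : m ≤ N := by have := Finset.mem_range.1 hm; omega
    have := (hg m hm).2.2 ⟨(x, y), hxy⟩
    simp only at this
    rw [show L * (k m b * (g m ⟨(x, y), hxy⟩ * v ⟨(x, y), hxy⟩ ^ b)) =
      (L * g m ⟨(x, y), hxy⟩) * (k m b * v ⟨(x, y), hxy⟩ ^ b) by ring, ← this, Finset.sum_mul]
    exact Finset.sum_congr rfl fun a _ => by simp only [v]; ring
  rw [hsum]
  field_simp

end

end QRacah

theorem mainTheorem9 (N : ℕ) (h : ℂ) (t : Fin 5 → ℂ) (ht : QRacah.Admissible h t N) :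
    -- closed form of `G_{0,N}`, which does not vanish
    (∀ x y : ℕ, x + y ≤ N →
      QRacah.griffiths h t N 0 N x y =
        (-1) ^ N * (t 3 / t 1) ^ N * (t 1 / t 4) ^ y *
          QRacah.xi h (t 0) (t 0 * t 4 * h ^ N) N * QRacah.xi h (t 3) (t 0) y ∧
      QRacah.griffiths h t N 0 N x y ≠ 0) ∧
    -- closed form of `G_{N,0}`, which does not vanish
    (∀ x y : ℕ, x + y ≤ N →
      QRacah.griffiths h t N N 0 x y =
        ((t 0 * t 3 * h ^ (N + 1)) ^ N)⁻¹ *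
          (QRacah.omega h (t 1 * t 0 * t 3 / t 4) y / QRacah.omega h (t 2 * t 4) x) *
          QRacah.xi h (t 2) (t 2 * t 3 * h ^ N) N * QRacah.xi h (t 4) (t 2) x ∧
      QRacah.griffiths h t N N 0 x y ≠ 0) ∧
    -- polynomiality, with either normalisation
    (∀ i j : ℕ, i + j ≤ N →
      (∃ P : MvPolynomial (Fin 2) ℂ, P.totalDegree = N - j ∧
        ∀ x y : ℕ, x + y ≤ N →
          QRacah.griffiths h t N i j x y / QRacah.griffiths h t N 0 N x y =
            MvPolynomial.eval
              ![QRacah.lam (h ^ 2) (t 4 ^ 2 * t 2 ^ 2) x,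
                QRacah.lam (h ^ 2) (t 0 ^ 2 * t 3 ^ 2) y] P) ∧
      (∃ P : MvPolynomial (Fin 2) ℂ, P.totalDegree = N - i ∧
        ∀ x y : ℕ, x + y ≤ N →
          QRacah.griffiths h t N i j x y / QRacah.griffiths h t N N 0 x y =
            MvPolynomial.eval
              ![QRacah.lam (h ^ 2) (t 4 ^ 2 * t 2 ^ 2) x,
                QRacah.lam (h ^ 2) (t 0 ^ 2 * t 3 ^ 2) y] P)) :=
  ⟨fun _ _ hxy => ⟨QRacah.griffiths_zero_top ht hxy, QRacah.griffiths_zero_top_ne ht hxy⟩,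
    fun _ _ hxy => ⟨QRacah.griffiths_top_zero ht hxy, QRacah.griffiths_top_zero_ne ht hxy⟩,
    fun _ _ hij => ⟨QRacah.exists_polynomial_left ht hij, QRacah.exists_polynomial_right ht hij⟩⟩
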